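/- Let $H$ be a Hilbert space with orthonormal basis $\{E_k\}_{k\ge 0}$, let $U E_k=E_{k+1}$ be the unilateral shift, and let $\mathcal T=C^*(U)$ be the Toeplitz algebra. Let $\mathcal K^\infty$ be the set of smooth compact operators, i.e. the bounded operators $c$ whose matrix $c_{k,l}=\langle E_k, cE_l\rangle$ decays rapidly in both indices: $\sup_{k,l}(1+k)^M(1+l)^N|c_{k,l}|<\infty$ for all $M,N\ge 0$. For $f\in C(\mathbb R/\mathbb Z)$ let $T(f)=PM_f$ be the Toeplitz operator with symbol $f$ on $H\cong\ell^2(\mathbb Z_{\ge 0})\subseteq \ell^2(\mathbb Z)\cong L^2(\mathbb R/\mathbb Z)$, where $E_k$ is identified with $e^{2\pi i kx}$, $M_f$ is multiplication by $f$ and $P$ is the orthogonal projection onto $H$. The smooth Toeplitz algebra is $$\mathcal T^\infty=\{T(f)+c : f\in C^\infty(\mathbb R/\mathbb Z),\ c\in\mathcal K^\infty\}\subseteq\mathcal T ,$$ with the Fréchet topology of $C^\infty(\mathbb R/\mathbb Z)\oplus\mathcal K^\infty$. Then: 1. $\mathcal T^\infty$ is closed under the holomorphic functional calculus: if $a\in\mathcal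 T^\infty$ and $f$ is holomorphic on an open set $\Omega\subseteq\mathbb C$ containing the spectrum $\sigma(a)$, then $$f(a)=\frac1{2\pi i}\oint_\Gamma f(\zeta)(\zeta-a)^{-1}\,d\zeta\in\mathcal T^\infty .$$ Here $\Gamma$ is any contour surrounding $\sigma(a)$ in $\Omega$ (it runs in $\Omega\setminus\sigma(a)$ and has winding number $1$ about each point of $\sigma(a)$ and $0$ about each point outside $\Omega$), and such contours exist. 2. In particular, $\mathcal T^\infty$ is inverse-closed in $\mathcal T$: if $a\in\mathcal T^\infty$ is invertible in $\mathcal T$, then $a^{-1}\in\mathcal T^\infty$. More precisely, if $f\in C^\infty(\mathbb R/\mathbb Z)$, $c\in\mathcal K^\infty$ and $T(f)+c$ is invertible, then $f$ vanishes nowhere, $1/f\in C^\infty(\mathbb R/\mathbb Z)$, and $(T(f)+c)^{-1}=T(1/f)+b$ for some $b\in\mathcal K^\infty$. 3. $\mathcal T^\infty$ has the same K-theory as $\mathcal T$: the inclusion $\mathcal T^\infty\hookrightarrow\mathcal T$ induces isomorphisms $K_0(\mathcal T^\infty)\cong K_0(\mathcal T)$ and $K_1(\mathcal T^\infty)\cong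 K_1(\mathcal T)$. Here $K_0(A)$ is the Grothendieck group of the monoid of equivalence classes of idempotent matrices over $A$ (with $e\sim e'$ when $e=xy$ and $e'=yx$ for some rectangular matrices $x,y$ over $A$, and addition $[e]+[e']=[e\oplus e']$), and $K_1(A)$ is the group of stable homotopy classes of invertible matrices over $A$ (with $u\sim v$ when $u\oplus 1$ and $v\oplus 1$ are joined by a continuous path in $GL_N(A)$ for some $N$, and addition $[u]+[v]=[u\oplus v]$); the norm topology is used for $\mathcal T$ and the Fréchet topology for $\mathcal T^\infty$. -/

import Mathlib

open MeasureTheory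
set_option linter.unusedSectionVars false
noncomputable section
namespace QDisk

section Basic
variable {H : Type*} [NormedAddCommGroup H] [InnerProductSpace ℂ H] [CompleteSpace H]
variable {K : Type*} [NormedAddCommGroup K] [InnerProductSpace ℂ K] [CompleteSpace K]

/-- The linear isometry sending the `k`-th vector of the Hilbert basis `E` to `v k`. -/
def isometryOf (E : HilbertBasis ℕ ℂ H) {v : ℕ → K} (hv : Orthonormal ℂ v) : H →ₗᵢ[ℂ] K :=
  hv.orthogonalFamily.linearIsometry.comp E.repr.toLinearIsometry

theorem isometryOf_apply (E : HilbertBasis ℕ ℂ H) {v : ℕ → K} (hv : Orthonormal ℂ v) (k : ℕ) :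
    isometryOf E hv (E k) = v k := by
  classical
  simp [isometryOf, HilbertBasis.repr_self, OrthogonalFamily.linearIsometry_apply_single]

/-- The unilateral shift `U E_k = E_{k+1}`. -/
def shift (E : HilbertBasis ℕ ℂ H) : H →L[ℂ] H :=
  (isometryOf E (v := fun k => E (k + 1))
    (E.orthonormal.comp _ (add_left_injective 1))).toContinuousLinearMap

/-- The Toeplitz algebra: the `C*`-algebra generated by the shift. -/
def toeplitzAlgebra (E : HilbertBasis ℕ ℂ H) : StarSubalgebra ℂ (H →L[ℂ] H) :=
  StarAlgebra.elemental ℂ (shift E)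

instance (E : HilbertBasis ℕ ℂ H) : CompleteSpace (toeplitzAlgebra E) :=
  inferInstanceAs (CompleteSpace (StarAlgebra.elemental ℂ (shift E)))

/-- The Hilbert space `L²(ℝ/ℤ)`. -/
abbrev L2Circle : Type := Lp ℂ 2 (AddCircle.haarAddCircle (T := (1 : ℝ)))

/-- The multiplication operator `M_f` on `L²(ℝ/ℤ)`. -/
def mulOp (f : C(UnitAddCircle, ℂ)) : L2Circle →L[ℂ] L2Circle :=
  (ContinuousLinearMap.mul ℂ ℂ).holderL AddCircle.haarAddCircle ⊤ 2 2
    (ContinuousMap.toLp ⊤ AddCircle.haarAddCircle ℂ f)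

/-- The embedding of `H` in `L²(ℝ/ℤ)` sending `E_k` to `e^{2πikx}`, for `k ≥ 0`. -/
def hardyEmbedding (E : HilbertBasis ℕ ℂ H) : H →ₗᵢ[ℂ] L2Circle :=
  isometryOf E (v := fun k : ℕ => fourierLp (T := (1 : ℝ)) 2 (k : ℤ))
    (orthonormal_fourier.comp _ Nat.cast_injective)

/-- The Toeplitz operator `T(f) = P M_f` on `H`. -/
def toeplitzOp (E : HilbertBasis ℕ ℂ H) (f : C(UnitAddCircle, ℂ)) : H →L[ℂ] H :=
  (hardyEmbedding E).toContinuousLinearMap.adjoint ∘L mulOp f ∘L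
    (hardyEmbedding E).toContinuousLinearMap

/-- Smoothness of a function on `ℝ/ℤ`. -/
def IsSmooth (f : C(UnitAddCircle, ℂ)) : Prop :=
  ContDiff ℝ ((⊤ : ℕ∞) : WithTop ℕ∞) (fun x : ℝ => f (x : UnitAddCircle))

/-- Rapid decay of a double sequence, in both indices. -/
def IsRD (c : ℕ → ℕ → ℂ) : Prop :=
  ∀ M N : ℕ, ∃ C : ℝ, ∀ k l : ℕ, (1 + k : ℝ) ^ M * (1 + l : ℝ) ^ N * ‖c k l‖ ≤ C

/-- The matrix coefficients of an operator in the basis `E`. -/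
def coeff (E : HilbertBasis ℕ ℂ H) (a : H →L[ℂ] H) (k l : ℕ) : ℂ := inner ℂ (E k) (a (E l))

/-- Smooth compact operators with respect to `E`: the operators `∑ c_{kl} P_{kl}` with rapidly
decaying coefficients, that is, those whose matrix in the basis `E` decays rapidly. -/
def IsSmoothCompact (E : HilbertBasis ℕ ℂ H) (c : H →L[ℂ] H) : Prop := IsRD (coeff E c)

theorem coeff_mul (E : HilbertBasis ℕ ℂ H) (a b : H →L[ℂ] H) (k l : ℕ) :
    HasSum (fun j => coeff E a k j * coeff E b j l) (coeff E (a * b) k l) := by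
  have := E.hasSum_inner_mul_inner (a.adjoint (E k)) (b (E l))
  simpa [coeff, ContinuousLinearMap.adjoint_inner_left] using this

theorem inner_mulOp (f : C(UnitAddCircle, ℂ)) (k l : ℤ) :
    inner ℂ (fourierLp (T := (1 : ℝ)) 2 k) (mulOp f (fourierLp 2 l)) = fourierCoeff f (k - l) := by
  rw [L2.inner_def, fourierCoeff]
  apply integral_congr_ae
  have h1 := coeFn_fourierLp (T := (1 : ℝ)) 2 k
  have h2 := coeFn_fourierLp (T := (1 : ℝ)) 2 l
  have h3 := ContinuousLinearMap.coeFn_holder (r := 2) (ContinuousLinearMap.mul ℂ ℂ)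
    (ContinuousMap.toLp ⊤ AddCircle.haarAddCircle ℂ f) (fourierLp (T := (1 : ℝ)) 2 l)
  have h4 := ContinuousMap.coeFn_toLp (p := ⊤) (𝕜 := ℂ) (AddCircle.haarAddCircle (T := (1:ℝ))) f
  filter_upwards [h1, h2, h3, h4] with x h1 h2 h3 h4
  rw [h1]
  simp only [mulOp, ContinuousLinearMap.holderL_apply_apply]
  rw [h3, h4, h2]
  simp only [RCLike.inner_apply, ContinuousLinearMap.mul_apply', smul_eq_mul]
  rw [← fourier_neg, show -(k - l) = l + -k by ring, fourier_add]
  ring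

theorem coeff_toeplitzOp (E : HilbertBasis ℕ ℂ H) (f : C(UnitAddCircle, ℂ)) (k l : ℕ) :
    coeff E (toeplitzOp E f) k l = fourierCoeff f ((k : ℤ) - l) := by
  rw [← inner_mulOp]
  simp only [coeff, toeplitzOp, ContinuousLinearMap.comp_apply,
    ContinuousLinearMap.adjoint_inner_right]
  simp [hardyEmbedding, isometryOf_apply]

theorem toeplitzOp_add (E : HilbertBasis ℕ ℂ H) (f g : C(UnitAddCircle, ℂ)) :
    toeplitzOp E (f + g) = toeplitzOp E f + toeplitzOp E g := by
  simp [toeplitzOp, mulOp]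

theorem toeplitzOp_smul (E : HilbertBasis ℕ ℂ H) (z : ℂ) (f : C(UnitAddCircle, ℂ)) :
    toeplitzOp E (z • f) = z • toeplitzOp E f := by
  simp [toeplitzOp, mulOp]

theorem mulOp_mul (f g : C(UnitAddCircle, ℂ)) : mulOp (f * g) = mulOp f ∘L mulOp g := by
  ext1 h
  apply Lp.ext
  have h1 (f : C(UnitAddCircle, ℂ)) (h : L2Circle) : mulOp f h =ᵐ[AddCircle.haarAddCircle] fun x => f x * h x := by
    have h3 := ContinuousLinearMap.coeFn_holder (r := 2) (ContinuousLinearMap.mul ℂ ℂ)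
      (ContinuousMap.toLp ⊤ AddCircle.haarAddCircle ℂ f) h
    have h4 := ContinuousMap.coeFn_toLp (p := ⊤) (𝕜 := ℂ) (AddCircle.haarAddCircle (T := (1:ℝ))) f
    filter_upwards [h3, h4] with x h3 h4
    simp only [mulOp, ContinuousLinearMap.holderL_apply_apply]
    rw [h3, h4]; rfl
  filter_upwards [h1 (f * g) h, h1 g h, h1 f (mulOp g h)] with x a b c
  rw [a, ContinuousLinearMap.comp_apply, c, b]
  simp [mul_assoc]

theorem toeplitzOp_one (E : HilbertBasis ℕ ℂ H) : toeplitzOp E 1 = 1 := by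
  have : mulOp 1 = ContinuousLinearMap.id ℂ L2Circle := by
    ext1 h
    apply Lp.ext
    have h3 := ContinuousLinearMap.coeFn_holder (r := 2) (ContinuousLinearMap.mul ℂ ℂ)
      (ContinuousMap.toLp ⊤ AddCircle.haarAddCircle ℂ 1) h
    have h4 := ContinuousMap.coeFn_toLp (p := ⊤) (𝕜 := ℂ) (AddCircle.haarAddCircle (T := (1:ℝ)))
      (1 : C(UnitAddCircle, ℂ))
    filter_upwards [h3, h4] with x h3 h4
    simp only [mulOp, ContinuousLinearMap.holderL_apply_apply]
    rw [h3, h4]; simp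
  ext1 x
  simp only [toeplitzOp, this]
  refine ext_inner_left ℂ fun y => ?_
  simp


theorem fourierCoeff_eq_On (f : C(UnitAddCircle, ℂ)) (n : ℤ) :
    fourierCoeff f n = fourierCoeffOn (zero_lt_one' ℝ) (fun x : ℝ => f (x : UnitAddCircle)) n := by
  rw [fourierCoeffOn_eq_integral, fourierCoeff_eq_intervalIntegral f n 0]
  simp

theorem periodic_decay (M : ℕ) : ∀ F : ℝ → ℂ, ContDiff ℝ ((⊤ : ℕ∞) : WithTop ℕ∞) F →
    Function.Periodic F 1 → ∃ C : ℝ, ∀ n : ℤ,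
      |(n : ℝ)| ^ M * ‖fourierCoeffOn (zero_lt_one' ℝ) F n‖ ≤ C := by
  induction M with
  | zero =>
    intro F hF _
    obtain ⟨C, hC⟩ := (isCompact_Icc (a := (0 : ℝ)) (b := 1)).exists_bound_of_continuousOn
      hF.continuous.continuousOn
    refine ⟨C, fun n => ?_⟩
    rw [pow_zero, one_mul, fourierCoeffOn_eq_integral]
    simp only [sub_zero, div_one, one_smul]
    refine (intervalIntegral.norm_integral_le_of_norm_le_const (C := C) ?_).trans (by simp)
    intro x hx
    rw [Set.uIoc_of_le zero_le_one] at hx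
    rw [norm_smul, fourier_apply, Circle.norm_coe, one_mul]
    exact hC x ⟨hx.1.le, hx.2⟩
  | succ M ih =>
    intro F hF hp
    have hF' : ContDiff ℝ ((⊤ : ℕ∞) : WithTop ℕ∞) (deriv F) := (contDiff_infty_iff_deriv.1 hF).2
    obtain ⟨C, hC⟩ := ih (deriv F) hF' (fun x => by
      have h : F = fun y => F (y + 1) := funext fun y => (hp y).symm
      conv_rhs => rw [h]
      rw [deriv_comp_add_const])
    have hC0 : 0 ≤ C := le_trans (by positivity) (hC 0)
    refine ⟨C, fun n => ?_⟩
    by_cases hn : n = 0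
    · subst hn; simpa using hC0
    have h := fourierCoeffOn_of_hasDerivAt (zero_lt_one' ℝ) (f := F) (f' := deriv F) hn
      (fun x _ => (hF.differentiable (by simp) x).hasDerivAt)
      (hF'.continuous.intervalIntegrable _ _)
    have h01 : F 1 = F 0 := by simpa using hp 0
    rw [h, h01]
    simp only [sub_self, mul_zero, sub_zero, zero_sub, Complex.ofReal_one, Complex.ofReal_zero, one_mul]
    rw [norm_mul, norm_neg, norm_div]
    have hn' : 0 < |(n : ℝ)| := by positivity
    have : ‖-2 * (Real.pi : ℂ) * Complex.I * (n : ℂ)‖ = 2 * Real.pi * |(n : ℝ)| := by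
      simp [abs_of_pos Real.pi_pos]
    rw [this, norm_one]
    have h2 : 1 ≤ 2 * Real.pi := by linarith [Real.pi_gt_three]
    calc _ = (|(n : ℝ)| ^ M * ‖fourierCoeffOn (zero_lt_one' ℝ) (deriv F) n‖) / (2 * Real.pi) := by
          field_simp
          ring
      _ ≤ C / (2 * Real.pi) := by gcongr; exact hC n
      _ ≤ C := div_le_self hC0 h2

theorem IsSmooth.decay {f : C(UnitAddCircle, ℂ)} (hf : IsSmooth f) (M : ℕ) :
    ∃ C : ℝ, 0 ≤ C ∧ ∀ n : ℤ, (1 + |(n : ℝ)|) ^ M * ‖fourierCoeff f n‖ ≤ C := by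
  obtain ⟨C, hC⟩ := periodic_decay M _ hf (fun x => by simp)
  obtain ⟨D, hD⟩ := periodic_decay 0 _ hf (fun x => by simp)
  have hC0 : 0 ≤ C := le_trans (by positivity) (hC 0)
  have hD0 : 0 ≤ D := le_trans (by positivity) (hD 0)
  refine ⟨2 ^ M * (C + D), by positivity, fun n => ?_⟩
  have h1 := hC n
  have h2 := hD n
  rw [← fourierCoeff_eq_On] at h1 h2
  rw [pow_zero, one_mul] at h2
  have h3 : (1 + |(n : ℝ)|) ^ M ≤ 2 ^ M * (|(n : ℝ)| ^ M + 1) := by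
    rcases le_total |(n : ℝ)| 1 with h | h
    · calc (1 + |(n : ℝ)|) ^ M ≤ 2 ^ M := by gcongr; linarith
        _ ≤ _ := by
          have : 0 ≤ |(n : ℝ)| ^ M := by positivity
          nlinarith [pow_pos (two_pos (α := ℝ)) M]
    · calc (1 + |(n : ℝ)|) ^ M ≤ (2 * |(n : ℝ)|) ^ M := by gcongr; linarith
        _ = 2 ^ M * |(n : ℝ)| ^ M := mul_pow _ _ _
        _ ≤ _ := by gcongr; linarith
  calc _ ≤ 2 ^ M * (|(n : ℝ)| ^ M + 1) * ‖fourierCoeff f n‖ := by gcongr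
    _ = 2 ^ M * (|(n : ℝ)| ^ M * ‖fourierCoeff f n‖ + ‖fourierCoeff f n‖) := by ring
    _ ≤ _ := by gcongr

theorem IsSmooth.add {f g : C(UnitAddCircle, ℂ)} (hf : IsSmooth f) (hg : IsSmooth g) :
    IsSmooth (f + g) := ContDiff.add hf hg

theorem IsSmooth.mul {f g : C(UnitAddCircle, ℂ)} (hf : IsSmooth f) (hg : IsSmooth g) :
    IsSmooth (f * g) := ContDiff.mul hf hg

theorem isSmooth_const (z : ℂ) : IsSmooth (algebraMap ℂ C(UnitAddCircle, ℂ) z) := contDiff_const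

theorem IsSmooth.smul {f : C(UnitAddCircle, ℂ)} (hf : IsSmooth f) (z : ℂ) :
    IsSmooth (z • f) := ContDiff.const_smul z hf

theorem coeff_add (E : HilbertBasis ℕ ℂ H) (a b : H →L[ℂ] H) (k l : ℕ) :
    coeff E (a + b) k l = coeff E a k l + coeff E b k l := by simp [coeff]

theorem coeff_sub (E : HilbertBasis ℕ ℂ H) (a b : H →L[ℂ] H) (k l : ℕ) :
    coeff E (a - b) k l = coeff E a k l - coeff E b k l := by simp [coeff]

theorem coeff_smul (E : HilbertBasis ℕ ℂ H) (z : ℂ) (a : H →L[ℂ] H) (k l : ℕ) :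
    coeff E (z • a) k l = z * coeff E a k l := by simp [coeff]

theorem IsRD.add {c d : ℕ → ℕ → ℂ} (hc : IsRD c) (hd : IsRD d) :
    IsRD (fun k l => c k l + d k l) := by
  intro M N
  obtain ⟨C, hC⟩ := hc M N
  obtain ⟨D, hD⟩ := hd M N
  refine ⟨C + D, fun k l => ?_⟩
  calc _ ≤ (1 + k : ℝ) ^ M * (1 + l : ℝ) ^ N * (‖c k l‖ + ‖d k l‖) := by
        gcongr; exact norm_add_le _ _
    _ = (1 + k : ℝ) ^ M * (1 + l : ℝ) ^ N * ‖c k l‖ + (1 + k : ℝ) ^ M * (1 + l : ℝ) ^ N * ‖d k l‖ := by ring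
    _ ≤ _ := add_le_add (hC k l) (hD k l)

theorem IsSmoothCompact.add {E : HilbertBasis ℕ ℂ H} {c d : H →L[ℂ] H} (hc : IsSmoothCompact E c)
    (hd : IsSmoothCompact E d) : IsSmoothCompact E (c + d) := by
  have := IsRD.add hc hd
  simpa only [IsSmoothCompact, ← coeff_add] using! this

theorem IsSmoothCompact.smul {E : HilbertBasis ℕ ℂ H} {c : H →L[ℂ] H} (hc : IsSmoothCompact E c)
    (z : ℂ) : IsSmoothCompact E (z • c) := by
  intro M N
  obtain ⟨C, hC⟩ := hc M N
  refine ⟨‖z‖ * C, fun k l => ?_⟩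
  rw [coeff_smul, norm_mul]
  calc _ = ‖z‖ * ((1 + k : ℝ) ^ M * (1 + l : ℝ) ^ N * ‖coeff E c k l‖) := by ring
    _ ≤ _ := by gcongr; exact hC k l

theorem isSmoothCompact_zero (E : HilbertBasis ℕ ℂ H) : IsSmoothCompact E 0 :=
  fun M N => ⟨0, fun k l => by simp [coeff]⟩

theorem summable_inv_sq : Summable (fun j : ℕ => ((1 + j : ℝ) ^ 2)⁻¹) := by
  have := (summable_nat_add_iff 1).2 (Real.summable_nat_pow_inv (p := 2) |>.2 one_lt_two)
  simpa [add_comm] using this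

/-- A sum over an intermediate index dominated by `D / (1 + j)²` has rapid decay. -/
theorem isRD_of_hasSum {s : ℕ → ℕ → ℂ} {t : ℕ → ℕ → ℕ → ℂ}
    (hs : ∀ k l, HasSum (t k l) (s k l))
    (ht : ∀ M N : ℕ, ∃ D : ℝ, ∀ k l j : ℕ,
      (1 + k : ℝ) ^ M * (1 + l : ℝ) ^ N * (1 + j : ℝ) ^ 2 * ‖t k l j‖ ≤ D) : IsRD s := by
  intro M N
  obtain ⟨D, hD⟩ := ht M N
  refine ⟨D * ∑' j : ℕ, ((1 + j : ℝ) ^ 2)⁻¹, fun k l => ?_⟩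
  have h1 : HasSum (fun j => (((1 + k : ℝ) ^ M * (1 + l : ℝ) ^ N : ℝ) : ℂ) * t k l j)
    ((((1 + k : ℝ) ^ M * (1 + l : ℝ) ^ N : ℝ) : ℂ) * s k l) := (hs k l).mul_left _
  have hn : ∀ z : ℂ, ‖(((1 + k : ℝ) ^ M * (1 + l : ℝ) ^ N : ℝ) : ℂ) * z‖
      = (1 + k : ℝ) ^ M * (1 + l : ℝ) ^ N * ‖z‖ := fun z => by
    rw [norm_mul, Complex.norm_real, Real.norm_of_nonneg (by positivity)]
  rw [← hn, ← h1.tsum_eq, ← tsum_mul_left]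
  refine tsum_of_norm_bounded (summable_inv_sq.mul_left D).hasSum fun j => ?_
  rw [hn]
  have hj : (0 : ℝ) < (1 + j : ℝ) ^ 2 := by positivity
  rw [← div_eq_mul_inv, le_div_iff₀ hj]
  calc _ = (1 + k : ℝ) ^ M * (1 + l : ℝ) ^ N * (1 + j : ℝ) ^ 2 * ‖t k l j‖ := by ring
    _ ≤ D := hD k l j

/-- Matrices of polynomial growth off each index, which multiply rapidly decaying matrices. -/
def IsTempered (c : ℕ → ℕ → ℂ) : Prop :=
  ∀ M : ℕ, ∃ C : ℝ, 0 ≤ C ∧ ∀ k l : ℕ, (1 + k : ℝ) ^ M * ‖c k l‖ ≤ C * (1 + l : ℝ) ^ M ∧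
    (1 + l : ℝ) ^ M * ‖c k l‖ ≤ C * (1 + k : ℝ) ^ M

theorem IsRD.isTempered {c : ℕ → ℕ → ℂ} (hc : IsRD c) : IsTempered c := by
  intro M
  obtain ⟨C, hC⟩ := hc M M
  have hC0 : 0 ≤ C := le_trans (by positivity) (hC 0 0)
  refine ⟨C, hC0, fun k l => ?_⟩
  have hk : (1 : ℝ) ≤ (1 + k : ℝ) ^ M := one_le_pow₀ (by linarith [(k.cast_nonneg : (0 : ℝ) ≤ k)])
  have hl : (1 : ℝ) ≤ (1 + l : ℝ) ^ M := one_le_pow₀ (by linarith [(l.cast_nonneg : (0 : ℝ) ≤ l)])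
  have h := hC k l
  have hc0 := norm_nonneg (c k l)
  have e1 : (1 + k : ℝ) ^ M * ‖c k l‖ ≤ (1 + k : ℝ) ^ M * (1 + l : ℝ) ^ M * ‖c k l‖ := by
    gcongr; exact le_mul_of_one_le_right (by positivity) hl
  have e2 : (1 + l : ℝ) ^ M * ‖c k l‖ ≤ (1 + k : ℝ) ^ M * (1 + l : ℝ) ^ M * ‖c k l‖ := by
    gcongr; exact le_mul_of_one_le_left (by positivity) hk
  exact ⟨e1.trans (h.trans (le_mul_of_one_le_right hC0 hl)),
    e2.trans (h.trans (le_mul_of_one_le_right hC0 hk))⟩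

theorem IsSmooth.isTempered (E : HilbertBasis ℕ ℂ H) {f : C(UnitAddCircle, ℂ)} (hf : IsSmooth f) :
    IsTempered (coeff E (toeplitzOp E f)) := by
  intro M
  obtain ⟨C, hC0, hC⟩ := hf.decay M
  refine ⟨C, hC0, fun k l => ?_⟩
  rw [coeff_toeplitzOp]
  have h := hC ((k : ℤ) - l)
  push_cast at h
  set z := ‖fourierCoeff (f : UnitAddCircle → ℂ) ((k : ℤ) - l)‖
  have hz : 0 ≤ z := norm_nonneg _
  have hk : (0 : ℝ) ≤ k := k.cast_nonneg
  have hl : (0 : ℝ) ≤ l := l.cast_nonneg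
  have h1 := le_abs_self ((k : ℝ) - l)
  have h2 := neg_abs_le ((k : ℝ) - l)
  have h0 := abs_nonneg ((k : ℝ) - l)
  constructor
  · calc (1 + k : ℝ) ^ M * z ≤ ((1 + |(k : ℝ) - l|) * (1 + l)) ^ M * z := by
          gcongr; nlinarith
      _ = (1 + |(k : ℝ) - l|) ^ M * z * (1 + l : ℝ) ^ M := by rw [mul_pow]; ring
      _ ≤ _ := by gcongr
  · calc (1 + l : ℝ) ^ M * z ≤ ((1 + |(k : ℝ) - l|) * (1 + k)) ^ M * z := by
          gcongr; nlinarith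
      _ = (1 + |(k : ℝ) - l|) ^ M * z * (1 + k : ℝ) ^ M := by rw [mul_pow]; ring
      _ ≤ _ := by gcongr

theorem IsSmoothCompact.tempered_mul {E : HilbertBasis ℕ ℂ H} {a c : H →L[ℂ] H}
    (ha : IsTempered (coeff E a)) (hc : IsSmoothCompact E c) : IsSmoothCompact E (a * c) := by
  refine isRD_of_hasSum (coeff_mul E a c) fun M N => ?_
  obtain ⟨A, hA0, hA⟩ := ha M
  obtain ⟨C, hC⟩ := hc (M + 2) N
  refine ⟨A * C, fun k l j => ?_⟩
  rw [norm_mul]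
  calc _ = ((1 + k : ℝ) ^ M * ‖coeff E a k j‖) * ((1 + l : ℝ) ^ N * (1 + j : ℝ) ^ 2 * ‖coeff E c j l‖) := by ring
    _ ≤ (A * (1 + j : ℝ) ^ M) * ((1 + l : ℝ) ^ N * (1 + j : ℝ) ^ 2 * ‖coeff E c j l‖) := by
        exact mul_le_mul_of_nonneg_right (hA k j).1 (by positivity)
    _ = A * ((1 + j : ℝ) ^ (M + 2) * (1 + l : ℝ) ^ N * ‖coeff E c j l‖) := by ring
    _ ≤ _ := by gcongr; exact hC j l

theorem IsSmoothCompact.mul_tempered {E : HilbertBasis ℕ ℂ H} {a c : H →L[ℂ] H}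
    (hc : IsSmoothCompact E c) (ha : IsTempered (coeff E a)) : IsSmoothCompact E (c * a) := by
  refine isRD_of_hasSum (coeff_mul E c a) fun M N => ?_
  obtain ⟨A, hA0, hA⟩ := ha N
  obtain ⟨C, hC⟩ := hc M (N + 2)
  refine ⟨A * C, fun k l j => ?_⟩
  rw [norm_mul]
  calc _ = ((1 + l : ℝ) ^ N * ‖coeff E a j l‖) * ((1 + k : ℝ) ^ M * (1 + j : ℝ) ^ 2 * ‖coeff E c k j‖) := by ring
    _ ≤ (A * (1 + j : ℝ) ^ N) * ((1 + k : ℝ) ^ M * (1 + j : ℝ) ^ 2 * ‖coeff E c k j‖) := by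
        exact mul_le_mul_of_nonneg_right (hA j l).2 (by positivity)
    _ = A * ((1 + k : ℝ) ^ M * (1 + j : ℝ) ^ (N + 2) * ‖coeff E c k j‖) := by ring
    _ ≤ _ := by gcongr; exact hC k j

theorem fourierCoeff_mul (f g : C(UnitAddCircle, ℂ)) (k l : ℤ) :
    HasSum (fun j : ℤ => fourierCoeff f (k - j) * fourierCoeff g (j - l))
      (fourierCoeff (f * g : C(UnitAddCircle, ℂ)) (k - l)) := by
  have h := (fourierBasis (T := (1 : ℝ))).hasSum_inner_mul_inner
    ((mulOp f).adjoint (fourierLp 2 k)) (mulOp g (fourierLp 2 l))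
  simp only [coe_fourierBasis, ContinuousLinearMap.adjoint_inner_left, inner_mulOp] at h
  rwa [← inner_mulOp, mulOp_mul, ContinuousLinearMap.comp_apply]

theorem toeplitzOp_mul_sub (E : HilbertBasis ℕ ℂ H) {f g : C(UnitAddCircle, ℂ)} (hf : IsSmooth f)
    (hg : IsSmooth g) :
    IsSmoothCompact E (toeplitzOp E f * toeplitzOp E g - toeplitzOp E (f * g)) := by
  have key : ∀ k l : ℕ, HasSum (fun j : ℕ => -(fourierCoeff f ((k : ℤ) - (-(j + 1 : ℤ))) *
      fourierCoeff g (-(j + 1 : ℤ) - l)))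
      (coeff E (toeplitzOp E f * toeplitzOp E g - toeplitzOp E (f * g)) k l) := by
    intro k l
    have h1 := fourierCoeff_mul f g k l
    have h2 := coeff_mul E (toeplitzOp E f) (toeplitzOp E g) k l
    simp only [coeff_toeplitzOp] at h2
    have h3 := h1.summable.comp_injective (i := fun j : ℕ => (-(j + 1 : ℤ)))
      (fun a b h => by simpa using h)
    have h4 := h2.of_nat_of_neg_add_one (f := fun j : ℤ => fourierCoeff f ((k : ℤ) - j) *
      fourierCoeff g (j - l)) h3.hasSum
    have h5 := h4.unique h1
    rw [coeff_sub, coeff_toeplitzOp, ← h5, sub_add_cancel_left]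
    exact h3.hasSum.neg
  refine isRD_of_hasSum key fun M N => ?_
  obtain ⟨C, hC0, hC⟩ := hf.decay (M + 2)
  obtain ⟨D, hD0, hD⟩ := hg.decay N
  refine ⟨C * D, fun k l j => ?_⟩
  rw [norm_neg, norm_mul]
  have hk : (0 : ℝ) ≤ k := k.cast_nonneg
  have hl : (0 : ℝ) ≤ l := l.cast_nonneg
  have hj : (0 : ℝ) ≤ j := j.cast_nonneg
  have h1 := hC ((k : ℤ) - (-(j + 1 : ℤ)))
  have h2 := hD (-(j + 1 : ℤ) - l)
  push_cast at h1 h2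
  have p1 : (0 : ℝ) ≤ 1 + (k - (-(j + 1 : ℝ))) := by linarith
  have p2 : (0 : ℝ) ≤ 1 + -(-(j + 1 : ℝ) - l) := by linarith
  rw [abs_of_nonneg (by linarith)] at h1
  rw [abs_of_nonpos (by linarith)] at h2
  calc _ = ((1 + k : ℝ) ^ M * (1 + j : ℝ) ^ 2 * ‖fourierCoeff f ((k : ℤ) - (-(j + 1 : ℤ)))‖) *
        ((1 + l : ℝ) ^ N * ‖fourierCoeff g (-(j + 1 : ℤ) - l)‖) := by ring
    _ ≤ ((1 + (k - (-(j + 1 : ℝ)))) ^ M * (1 + (k - (-(j + 1 : ℝ)))) ^ 2 *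
          ‖fourierCoeff f ((k : ℤ) - (-(j + 1 : ℤ)))‖) *
        ((1 + -(-(j + 1 : ℝ) - l)) ^ N * ‖fourierCoeff g (-(j + 1 : ℤ) - l)‖) := by
        refine mul_le_mul (mul_le_mul_of_nonneg_right (mul_le_mul
          (pow_le_pow_left₀ (by positivity) (by linarith) _)
          (pow_le_pow_left₀ (by positivity) (by linarith) _) (by positivity)
          (pow_nonneg p1 _)) (norm_nonneg _))
          (mul_le_mul_of_nonneg_right (pow_le_pow_left₀ (by positivity) (by linarith) _)
          (norm_nonneg _)) (by positivity)
          (mul_nonneg (mul_nonneg (pow_nonneg p1 _) (pow_nonneg p1 _)) (norm_nonneg _))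
    _ ≤ C * D := by
        rw [← pow_add]
        exact mul_le_mul h1 h2 (mul_nonneg (pow_nonneg p2 _) (norm_nonneg _)) hC0

/-- `f` is the symbol and `c` the smooth compact part of the operator `a`. -/
def IsDecomp (E : HilbertBasis ℕ ℂ H) (a : H →L[ℂ] H) (f : C(UnitAddCircle, ℂ))
    (c : H →L[ℂ] H) : Prop :=
  IsSmooth f ∧ IsSmoothCompact E c ∧ a = toeplitzOp E f + c

/-- The smooth Toeplitz algebra as a subalgebra of the Toeplitz algebra: the elements
`T(f) + c` with `f` smooth and `c` smooth compact. -/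
def smoothToeplitz (E : HilbertBasis ℕ ℂ H) : Subalgebra ℂ (toeplitzAlgebra E) where
  carrier := {a | ∃ f c, IsDecomp E (a : H →L[ℂ] H) f c}
  mul_mem' := by
    rintro a b ⟨f, c, hf, hc, ha⟩ ⟨g, d, hg, hd, hb⟩
    refine ⟨f * g, (toeplitzOp E f * toeplitzOp E g - toeplitzOp E (f * g)) +
      (toeplitzOp E f * d + (c * toeplitzOp E g + c * d)), hf.mul hg, ?_, ?_⟩
    · exact (toeplitzOp_mul_sub E hf hg).add ((hd.tempered_mul (hf.isTempered E)).add
        ((hc.mul_tempered (hg.isTempered E)).add (hd.tempered_mul (IsRD.isTempered hc))))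
    · rw [MulMemClass.coe_mul, ha, hb]
      noncomm_ring
  add_mem' := by
    rintro a b ⟨f, c, hf, hc, ha⟩ ⟨g, d, hg, hd, hb⟩
    refine ⟨f + g, c + d, hf.add hg, hc.add hd, ?_⟩
    rw [AddMemClass.coe_add, ha, hb, toeplitzOp_add]
    abel
  algebraMap_mem' := by
    intro z
    refine ⟨algebraMap ℂ _ z, 0, isSmooth_const z, isSmoothCompact_zero E, ?_⟩
    rw [Algebra.algebraMap_eq_smul_one, Algebra.algebraMap_eq_smul_one, toeplitzOp_smul, toeplitzOp_one, add_zero]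
    rfl

theorem toeplitz_symbol_unique {E : HilbertBasis ℕ ℂ H} {a : H →L[ℂ] H}
    {f g : C(UnitAddCircle, ℂ)} {c d : H →L[ℂ] H} (h : IsDecomp E a f c) (h' : IsDecomp E a g d) :
    f = g ∧ c = d := by
  obtain ⟨hf, hc, ha⟩ := h
  obtain ⟨hg, hd, hb⟩ := h'
  have e : toeplitzOp E (f + (-1 : ℂ) • g) = d + (-1 : ℂ) • c := by
    rw [toeplitzOp_add, toeplitzOp_smul]
    have : toeplitzOp E f + c = toeplitzOp E g + d := ha.symm.trans hb
    rw [eq_sub_of_add_eq this]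
    simp only [neg_smul, one_smul]; abel
  have hk : IsSmoothCompact E (toeplitzOp E (f + (-1 : ℂ) • g)) := e ▸ hd.add (hc.smul _)
  have hz : ∀ n : ℤ, fourierCoeff (f + (-1 : ℂ) • g : C(UnitAddCircle, ℂ)) n = 0 := by
    intro n
    obtain ⟨C, hC⟩ := hk 1 0
    set z := ‖fourierCoeff (f + (-1 : ℂ) • g : C(UnitAddCircle, ℂ)) n‖ with hzdef
    have hb : ∀ j : ℕ, (j : ℝ) * z ≤ C := by
      intro j
      have h := hC (j + n.toNat) (j + (-n).toNat)
      rw [coeff_toeplitzOp] at h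
      have : ((j + n.toNat : ℕ) : ℤ) - ((j + (-n).toNat : ℕ) : ℤ) = n := by omega
      rw [this, ← hzdef] at h
      refine le_trans ?_ h
      simp only [pow_one, pow_zero, mul_one]
      gcongr
      push_cast
      have : (0 : ℝ) ≤ n.toNat := Nat.cast_nonneg _
      linarith
    by_contra hne
    have hz0 : 0 < z := norm_pos_iff.2 hne
    obtain ⟨j, hj⟩ := exists_nat_gt (C / z)
    rw [div_lt_iff₀ hz0] at hj
    exact absurd (hb j) (not_le.2 hj)
  have h0 : f + (-1 : ℂ) • g = 0 := by
    apply ContinuousMap.toLp_injective (p := 2) (𝕜 := ℂ)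
      (AddCircle.haarAddCircle (T := (1 : ℝ)))
    rw [map_zero]
    apply (fourierBasis (T := (1 : ℝ))).repr.injective
    ext n
    rw [fourierBasis_repr, fourierCoeff_toLp, hz n]
    simp
  have hfg : f = g := by
    rw [← sub_eq_zero, ← h0]
    module
  subst hfg
  exact ⟨rfl, add_left_cancel (ha.symm.trans hb)⟩

end Basic
section Frechet
variable {H : Type*} [NormedAddCommGroup H] [InnerProductSpace ℂ H] [CompleteSpace H]

/-- The smooth Toeplitz algebra as a type. It carries its Fréchet topology, not the topology of the
operator norm. -/
def SmoothToeplitz (E : HilbertBasis ℕ ℂ H) : Type _ := smoothToeplitz E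

instance (E : HilbertBasis ℕ ℂ H) : Ring (SmoothToeplitz E) :=
  inferInstanceAs (Ring (smoothToeplitz E))

instance (E : HilbertBasis ℕ ℂ H) : Algebra ℂ (SmoothToeplitz E) :=
  inferInstanceAs (Algebra ℂ (smoothToeplitz E))

/-- The inclusion of the smooth Toeplitz algebra in the Toeplitz algebra. -/
def incl (E : HilbertBasis ℕ ℂ H) : SmoothToeplitz E →ₐ[ℂ] toeplitzAlgebra E :=
  (smoothToeplitz E).val

/-- The symbol `f` of `T(f) + c`. -/
def symbol {E : HilbertBasis ℕ ℂ H} (a : SmoothToeplitz E) : C(UnitAddCircle, ℂ) :=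
  (show ∃ f c, IsDecomp E (incl E a : H →L[ℂ] H) f c from a.2).choose

/-- The smooth compact part `c` of `T(f) + c`. -/
def compactPart {E : HilbertBasis ℕ ℂ H} (a : SmoothToeplitz E) : H →L[ℂ] H :=
  (show ∃ f c, IsDecomp E (incl E a : H →L[ℂ] H) f c from a.2).choose_spec.choose

theorem decomp {E : HilbertBasis ℕ ℂ H} (a : SmoothToeplitz E) :
    IsDecomp E (incl E a : H →L[ℂ] H) (symbol a) (compactPart a) :=
  (show ∃ f c, IsDecomp E (incl E a : H →L[ℂ] H) f c from a.2).choose_spec.choose_spec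

theorem decomp_add {E : HilbertBasis ℕ ℂ H} (a b : SmoothToeplitz E) :
    symbol (a + b) = symbol a + symbol b ∧
      compactPart (a + b) = compactPart a + compactPart b := by
  refine toeplitz_symbol_unique (decomp (a + b))
    ⟨(decomp a).1.add (decomp b).1, (decomp a).2.1.add (decomp b).2.1, ?_⟩
  rw [map_add, AddMemClass.coe_add, (decomp a).2.2, (decomp b).2.2, toeplitzOp_add]
  abel

theorem decomp_smul {E : HilbertBasis ℕ ℂ H} (z : ℂ) (a : SmoothToeplitz E) :
    symbol (z • a) = z • symbol a ∧ compactPart (z • a) = z • compactPart a := by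
  refine toeplitz_symbol_unique (decomp (z • a))
    ⟨(decomp a).1.smul z, (decomp a).2.1.smul z, ?_⟩
  rw [map_smul, toeplitzOp_smul, ← smul_add, ← (decomp a).2.2]
  rfl

/-- The `j`-th derivative of the symbol, as a periodic function on the line. -/
def symbolDeriv (E : HilbertBasis ℕ ℂ H) (j : ℕ) : SmoothToeplitz E →ₗ[ℂ] C(ℝ, ℂ) where
  toFun a := ⟨iteratedDeriv j (fun x : ℝ => symbol a (x : UnitAddCircle)),
    (decomp a).1.continuous_iteratedDeriv j (by exact_mod_cast le_top)⟩
  map_add' a b := by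
    ext x
    have h1 := ((decomp a).1.of_le (m := (j : WithTop ℕ∞)) (by exact_mod_cast le_top)).contDiffAt
      (x := x)
    have h2 := ((decomp b).1.of_le (m := (j : WithTop ℕ∞)) (by exact_mod_cast le_top)).contDiffAt
      (x := x)
    have := iteratedDeriv_add h1 h2
    simpa [(decomp_add a b).1, Pi.add_def] using this
  map_smul' z a := by
    ext x
    have h1 := ((decomp a).1.of_le (m := (j : WithTop ℕ∞)) (by exact_mod_cast le_top)).contDiffAt
      (x := x)
    have := iteratedDeriv_const_smul h1 z
    simpa [(decomp_smul z a).1, Pi.smul_def] using this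

/-- The weighted matrix `(1 + k)^M (1 + l)^N c_{kl}` of the smooth compact part. -/
def weighted (E : HilbertBasis ℕ ℂ H) (M N : ℕ) :
    SmoothToeplitz E →ₗ[ℂ] BoundedContinuousFunction (ℕ × ℕ) ℂ where
  toFun a := BoundedContinuousFunction.ofNormedAddCommGroupDiscrete
    (fun p => (1 + p.1 : ℂ) ^ M * (1 + p.2 : ℂ) ^ N * coeff E (compactPart a) p.1 p.2)
    ((decomp a).2.1 M N).choose (fun p => by
      have h := ((decomp a).2.1 M N).choose_spec p.1 p.2
      have e : ∀ k : ℕ, ‖(1 + k : ℂ)‖ = 1 + k := fun k => by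
        rw [← Nat.cast_one, ← Nat.cast_add, Complex.norm_natCast]; push_cast; rfl
      simpa only [norm_mul, norm_pow, e] using h)
  map_add' a b := by
    ext p
    simp [(decomp_add a b).2, coeff_add]; ring
  map_smul' z a := by
    ext p
    simp [(decomp_smul z a).2, coeff_smul]; ring

/-- The Fréchet topology of the smooth Toeplitz algebra, `C^∞(ℝ/ℤ) ⊕ K^∞`: uniform convergence of
all derivatives of the symbol, and convergence of the smooth compact part in all the norms
`sup (1 + k)^M (1 + l)^N |c_{kl}|`. -/
instance (E : HilbertBasis ℕ ℂ H) : TopologicalSpace (SmoothToeplitz E) :=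
  (⨅ j : ℕ, TopologicalSpace.induced (symbolDeriv E j) inferInstance) ⊓
    (⨅ p : ℕ × ℕ, TopologicalSpace.induced (weighted E p.1 p.2) inferInstance)

instance (E : HilbertBasis ℕ ℂ H) : ContinuousAdd (SmoothToeplitz E) :=
  continuousAdd_inf (continuousAdd_iInf fun _ => continuousAdd_induced _)
    (continuousAdd_iInf fun _ => continuousAdd_induced _)

instance (E : HilbertBasis ℕ ℂ H) : ContinuousSMul ℂ (SmoothToeplitz E) :=
  @continuousSMul_inf _ _ _ _ _ _ (continuousSMul_iInf fun _ => continuousSMul_induced _)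
    (continuousSMul_iInf fun _ => continuousSMul_induced _)

end Frechet

section HolomorphicCalculus

/-- A contour: finitely many continuously differentiable arcs `[0,1] → ℂ` such that every point is
the initial point of as many of them as it is the final point, so that the arcs can be joined to
finitely many piecewise continuously differentiable closed curves. -/
structure Contour where
  n : ℕ
  arc : Fin n → ℝ → ℂ
  contDiffOn : ∀ i, ContDiffOn ℝ 1 (arc i) (Set.Icc 0 1)
  closed : Finset.univ.val.map (fun i => arc i 0) = Finset.univ.val.map (fun i => arc i 1)

/-- The image of a contour. -/
def Contour.image (Γ : Contour) : Set ℂ := ⋃ i, Γ.arc i '' Set.Icc 0 1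

/-- The contour integral. -/
def Contour.integral {A : Type*} [NormedAddCommGroup A] [NormedSpace ℂ A] (Γ : Contour)
    (F : ℂ → A) : A :=
  ∑ i, ∫ t in (0 : ℝ)..1, derivWithin (Γ.arc i) (Set.Icc 0 1) t • F (Γ.arc i t)

/-- The winding number of a contour about a point off its image. -/
def Contour.index (Γ : Contour) (z : ℂ) : ℂ :=
  (2 * Real.pi * Complex.I)⁻¹ * Γ.integral fun ζ => (ζ - z)⁻¹

/-- `Γ` surrounds `K` in `Ω`: it runs in `Ω \ K`, winds once around every point of `K` and does not
wind around any point outside `Ω`. -/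
structure Contour.Surrounds (Γ : Contour) (K Ω : Set ℂ) : Prop where
  image_subset : Γ.image ⊆ Ω \ K
  index_inside : ∀ z ∈ K, Γ.index z = 1
  index_outside : ∀ z ∉ Ω, Γ.index z = 0

/-- `b = f(a)` in the holomorphic functional calculus, `f` being holomorphic on `Ω ⊇ σ(a)`: `b` is
the Cauchy integral `(2πi)⁻¹ ∮ f(ζ) (ζ - a)⁻¹ dζ` over some contour surrounding `σ(a)` in `Ω`. -/
def IsHolomorphicCalculus {A : Type*} [NormedRing A] [NormedAlgebra ℂ A] (a : A) (Ω : Set ℂ)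
    (f : ℂ → ℂ) (b : A) : Prop :=
  ∃ Γ : Contour, Γ.Surrounds (spectrum ℂ a) Ω ∧
    b = (2 * Real.pi * Complex.I : ℂ)⁻¹ • Γ.integral fun ζ => f ζ • resolvent a ζ

end HolomorphicCalculus

section KZero
universe u
variable {A : Type u} [Ring A]
variable {l m n p : Type*} [Fintype l] [Fintype m] [Fintype n] [Fintype p]

/-- Algebraic (Murray–von Neumann) equivalence of idempotent matrices. -/
def MvN (e : Matrix m m A) (f : Matrix n n A) : Prop :=
  ∃ (x : Matrix m n A) (y : Matrix n m A), x * y = e ∧ y * x = f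

theorem MvN.refl {e : Matrix m m A} (he : IsIdempotentElem e) : MvN e e := ⟨e, e, he, he⟩

theorem MvN.symm {e : Matrix m m A} {f : Matrix n n A} (h : MvN e f) : MvN f e :=
  let ⟨x, y, h1, h2⟩ := h
  ⟨y, x, h2, h1⟩

theorem MvN.trans {e : Matrix l l A} {f : Matrix m m A} {g : Matrix n n A}
    (he : IsIdempotentElem e) (hg : IsIdempotentElem g) (h : MvN e f) (h' : MvN f g) :
    MvN e g := by
  obtain ⟨x, y, h1, h2⟩ := h
  obtain ⟨z, w, h3, h4⟩ := h'
  refine ⟨x * z, w * y, ?_, ?_⟩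
  · calc x * z * (w * y) = x * (z * w) * y := by simp only [Matrix.mul_assoc]
      _ = (x * y) * (x * y) := by rw [h3, ← h2]; simp only [Matrix.mul_assoc]
      _ = e := by rw [h1]; exact he
  · calc w * y * (x * z) = w * (y * x) * z := by simp only [Matrix.mul_assoc]
      _ = (w * z) * (w * z) := by rw [h2, ← h3]; simp only [Matrix.mul_assoc]
      _ = g := by rw [h4]; exact hg

theorem MvN.reindex {e : Matrix m m A} (he : IsIdempotentElem e) (σ : m ≃ n) :
    MvN e (Matrix.reindex σ σ e) := by
  refine ⟨e.submatrix id σ.symm, e.submatrix σ.symm id, ?_, ?_⟩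
  · rw [Matrix.submatrix_mul_equiv, he.eq, Matrix.submatrix_id_id]
  · rw [← Matrix.submatrix_mul (he₂ := Function.bijective_id), he.eq]; rfl

/-- The block diagonal matrix `e ⊕ f`. -/
abbrev blockSum (e : Matrix m m A) (f : Matrix n n A) : Matrix (m ⊕ n) (m ⊕ n) A :=
  Matrix.fromBlocks e 0 0 f

theorem blockSum_mul (e e' : Matrix m m A) (f f' : Matrix n n A) :
    blockSum e f * blockSum e' f' = blockSum (e * e') (f * f') := by
  simp [blockSum, Matrix.fromBlocks_multiply]

theorem MvN.blockSum {e : Matrix l l A} {e' : Matrix m m A} {f : Matrix n n A} {f' : Matrix p p A}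
    (h : MvN e e') (h' : MvN f f') : MvN (blockSum e f) (blockSum e' f') := by
  obtain ⟨x, y, h1, h2⟩ := h
  obtain ⟨z, w, h3, h4⟩ := h'
  exact ⟨Matrix.fromBlocks x 0 0 z, Matrix.fromBlocks y 0 0 w,
    by simp [Matrix.fromBlocks_multiply, h1, h3], by simp [Matrix.fromBlocks_multiply, h2, h4]⟩

theorem isIdempotentElem_reindex {e : Matrix m m A} (he : IsIdempotentElem e) (σ : m ≃ n) :
    IsIdempotentElem (Matrix.reindex σ σ e) := by
  rw [IsIdempotentElem, Matrix.reindex_apply, Matrix.submatrix_mul_equiv, he.eq]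

theorem isIdempotentElem_blockSum {e : Matrix m m A} {f : Matrix n n A} (he : IsIdempotentElem e)
    (hf : IsIdempotentElem f) : IsIdempotentElem (blockSum e f) := by
  rw [IsIdempotentElem, blockSum_mul, he.eq, hf.eq]

theorem blockSum_reindex (e : Matrix l l A) (f : Matrix m m A) (α : l ≃ n) (β : m ≃ p) :
    blockSum (Matrix.reindex α α e) (Matrix.reindex β β f) =
      Matrix.reindex (α.sumCongr β) (α.sumCongr β) (blockSum e f) := by
  ext (i | i) (j | j) <;> simp [blockSum]

theorem blockSum_assoc (e : Matrix l l A) (f : Matrix m m A) (g : Matrix n n A) :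
    blockSum e (blockSum f g) = Matrix.reindex (Equiv.sumAssoc l m n) (Equiv.sumAssoc l m n)
      (blockSum (blockSum e f) g) := by
  ext (i | i | i) (j | j | j) <;> simp [blockSum]

theorem blockSum_comm (e : Matrix l l A) (f : Matrix m m A) :
    blockSum f e = Matrix.reindex (Equiv.sumComm l m) (Equiv.sumComm l m) (blockSum e f) := by
  ext (i | i) (j | j) <;> simp [blockSum]

theorem blockSum_empty [IsEmpty l] (e : Matrix l l A) (f : Matrix m m A) :
    f = Matrix.reindex (Equiv.emptySum l m) (Equiv.emptySum l m) (blockSum e f) := by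
  ext i j; simp [blockSum]

/-- The direct sum `e ⊕ f` of square matrices, indexed by `Fin`. -/
def dsum {m n : ℕ} (e : Matrix (Fin m) (Fin m) A) (f : Matrix (Fin n) (Fin n) A) :
    Matrix (Fin (m + n)) (Fin (m + n)) A :=
  Matrix.reindex finSumFinEquiv finSumFinEquiv (blockSum e f)

theorem reindex_reindex (α : l ≃ m) (β : m ≃ n) (e : Matrix l l A) :
    Matrix.reindex β β (Matrix.reindex α α e) = Matrix.reindex (α.trans β) (α.trans β) e := rfl

theorem dsum_dsum {k m n : ℕ} (e : Matrix (Fin k) (Fin k) A) (f : Matrix (Fin m) (Fin m) A)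
    (g : Matrix (Fin n) (Fin n) A) : ∃ α : (Fin k ⊕ Fin m) ⊕ Fin n ≃ Fin (k + m + n),
      dsum (dsum e f) g = Matrix.reindex α α (blockSum (blockSum e f) g) := by
  refine ⟨((finSumFinEquiv.sumCongr (Equiv.refl _)).trans finSumFinEquiv), ?_⟩
  have := blockSum_reindex (blockSum e f) g finSumFinEquiv (Equiv.refl _)
  simp only [Matrix.reindex_refl_refl] at this
  rw [dsum, dsum, this, reindex_reindex]

theorem dsum_dsum' {k m n : ℕ} (e : Matrix (Fin k) (Fin k) A) (f : Matrix (Fin m) (Fin m) A)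
    (g : Matrix (Fin n) (Fin n) A) : ∃ α : (Fin k ⊕ Fin m) ⊕ Fin n ≃ Fin (k + (m + n)),
      dsum e (dsum f g) = Matrix.reindex α α (blockSum (blockSum e f) g) := by
  refine ⟨(Equiv.sumAssoc _ _ _).trans (((Equiv.refl _).sumCongr finSumFinEquiv).trans
    finSumFinEquiv), ?_⟩
  have := blockSum_reindex e (blockSum f g) (Equiv.refl _) finSumFinEquiv
  simp only [Matrix.reindex_refl_refl] at this
  rw [dsum, dsum, this, reindex_reindex, blockSum_assoc, reindex_reindex]

theorem dsum_comm {m n : ℕ} (e : Matrix (Fin m) (Fin m) A) (f : Matrix (Fin n) (Fin n) A) :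
    ∃ α : Fin m ⊕ Fin n ≃ Fin (n + m), dsum f e = Matrix.reindex α α (blockSum e f) :=
  ⟨(Equiv.sumComm _ _).trans finSumFinEquiv, by rw [dsum, blockSum_comm, reindex_reindex]⟩

variable (A) in
/-- Idempotent matrices over `A`, of all sizes. -/
structure IdemMatrix where
  n : ℕ
  mat : Matrix (Fin n) (Fin n) A
  idem : IsIdempotentElem mat

instance IdemMatrix.setoid : Setoid (IdemMatrix A) where
  r e f := MvN e.mat f.mat
  iseqv := ⟨fun e => MvN.refl e.idem, MvN.symm, fun {e _ g} h h' => MvN.trans e.idem g.idem h h'⟩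

theorem IdemMatrix.sound {e f : IdemMatrix A} {w : Matrix l l A} (hw : IsIdempotentElem w)
    {α : l ≃ Fin e.n} {β : l ≃ Fin f.n} (he : e.mat = Matrix.reindex α α w)
    (hf : f.mat = Matrix.reindex β β w) : e ≈ f := by
  have h1 := MvN.reindex hw α
  have h2 := MvN.reindex hw β
  rw [← he] at h1
  rw [← hf] at h2
  exact MvN.trans e.idem f.idem h1.symm h2

variable (A) in
/-- The monoid of equivalence classes of idempotent matrices over `A`. -/
def IdemClass : Type u := Quotient (IdemMatrix.setoid (A := A))

/-- The direct sum of idempotent matrices. -/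
def IdemMatrix.dsum (e f : IdemMatrix A) : IdemMatrix A :=
  ⟨e.n + f.n, QDisk.dsum e.mat f.mat,
    isIdempotentElem_reindex (isIdempotentElem_blockSum e.idem f.idem) _⟩

instance : Add (IdemClass A) where
  add := Quotient.map₂ IdemMatrix.dsum fun e e' h f f' h' =>
    have hef := isIdempotentElem_blockSum e.idem f.idem
    have hef' := isIdempotentElem_blockSum e'.idem f'.idem
    ((MvN.reindex hef finSumFinEquiv).symm.trans
      (isIdempotentElem_reindex hef _) hef' (h.blockSum h')).trans
      (isIdempotentElem_reindex hef _) (isIdempotentElem_reindex hef' _)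
      (MvN.reindex hef' finSumFinEquiv)

instance : Zero (IdemClass A) := ⟨Quotient.mk _ ⟨0, 0, IsIdempotentElem.zero⟩⟩

theorem IdemClass.add_comm' (x y : IdemClass A) : x + y = y + x := by
  obtain ⟨e⟩ := x
  obtain ⟨f⟩ := y
  obtain ⟨α, hα⟩ := dsum_comm e.mat f.mat
  exact Quotient.sound (IdemMatrix.sound (isIdempotentElem_blockSum e.idem f.idem)
    (α := finSumFinEquiv) (e := e.dsum f) (f := f.dsum e) rfl hα)

theorem IdemClass.zero_add' (x : IdemClass A) : 0 + x = x := by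
  obtain ⟨e⟩ := x
  exact Quotient.sound (IdemMatrix.sound (isIdempotentElem_blockSum IsIdempotentElem.zero e.idem)
    (α := finSumFinEquiv) (e := IdemMatrix.dsum ⟨0, 0, IsIdempotentElem.zero⟩ e) (f := e) rfl
    (blockSum_empty _ _))

instance : AddCommMonoid (IdemClass A) where
  add_assoc := by
    rintro ⟨e⟩ ⟨f⟩ ⟨g⟩
    obtain ⟨α, hα⟩ := dsum_dsum e.mat f.mat g.mat
    obtain ⟨β, hβ⟩ := dsum_dsum' e.mat f.mat g.mat
    exact Quotient.sound (IdemMatrix.sound (isIdempotentElem_blockSum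
      (isIdempotentElem_blockSum e.idem f.idem) g.idem)
      (e := (e.dsum f).dsum g) (f := e.dsum (f.dsum g)) hα hβ)
  zero_add := IdemClass.zero_add'
  add_zero x := by rw [IdemClass.add_comm', IdemClass.zero_add']
  add_comm := IdemClass.add_comm'
  nsmul := nsmulRec

variable (A) in
/-- `K₀(A)`: the Grothendieck group of the monoid of equivalence classes of idempotent matrices. -/
abbrev KZero : Type u := Algebra.GrothendieckAddGroup (IdemClass A)

/-- The class `[e]` in `K₀(A)` of an idempotent matrix. -/
def KZero.mk {n : ℕ} (e : Matrix (Fin n) (Fin n) A) (he : IsIdempotentElem e) : KZero A :=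
  Algebra.GrothendieckAddGroup.of (Quotient.mk _ ⟨n, e, he⟩ : IdemClass A)

end KZero

section KOne
universe u
variable {A : Type u} [Ring A]
variable {m n : Type*} [Fintype m] [Fintype n] [DecidableEq m] [DecidableEq n]

/-- The matrix `u ⊕ 1` of size `N`, for `u` of size `n ≤ N`. -/
def padTo {n : ℕ} (N : ℕ) (u : Matrix (Fin n) (Fin n) A) : Matrix (Fin N) (Fin N) A :=
  fun i j => if h : i.1 < n ∧ j.1 < n then u ⟨i.1, h.1⟩ ⟨j.1, h.2⟩ else if i = j then 1 else 0

theorem padTo_self {n : ℕ} (u : Matrix (Fin n) (Fin n) A) : padTo n u = u := by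
  ext i j; simp [padTo]

theorem padTo_padTo {n N N' : ℕ} (h : n ≤ N) (h' : N ≤ N') (u : Matrix (Fin n) (Fin n) A) :
    padTo N' (padTo N u) = padTo N' u := by
  ext i j
  simp only [padTo, Fin.ext_iff]
  split_ifs <;> first | rfl | omega

theorem padTo_add {n : ℕ} (k : ℕ) (u : Matrix (Fin n) (Fin n) A) :
    padTo (n + k) u = dsum u (1 : Matrix (Fin k) (Fin k) A) := by
  ext i j
  refine Fin.addCases (fun i => ?_) (fun i => ?_) i <;>
    refine Fin.addCases (fun j => ?_) (fun j => ?_) j <;>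
    simp [padTo, dsum, blockSum, Matrix.one_apply, Fin.ext_iff] <;> omega

theorem isUnit_reindex {u : Matrix m m A} (hu : IsUnit u) (σ : m ≃ n) :
    IsUnit (Matrix.reindex σ σ u) := by
  obtain ⟨⟨u, v, h, h'⟩, rfl⟩ := hu
  refine ⟨⟨Matrix.reindex σ σ u, Matrix.reindex σ σ v, ?_, ?_⟩, rfl⟩
  · simp [Matrix.submatrix_mul_equiv, h]
  · simp [Matrix.submatrix_mul_equiv, h']

theorem isUnit_blockSum {u : Matrix m m A} {v : Matrix n n A} (hu : IsUnit u) (hv : IsUnit v) :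
    IsUnit (blockSum u v) := by
  obtain ⟨⟨u, u', h1, h2⟩, rfl⟩ := hu
  obtain ⟨⟨v, v', h3, h4⟩, rfl⟩ := hv
  exact ⟨⟨blockSum u v, blockSum u' v', by simp [blockSum_mul, h1, h3],
    by simp [blockSum_mul, h2, h4]⟩, rfl⟩

theorem isUnit_dsum {m n : ℕ} {u : Matrix (Fin m) (Fin m) A} {v : Matrix (Fin n) (Fin n) A}
    (hu : IsUnit u) (hv : IsUnit v) : IsUnit (dsum u v) :=
  isUnit_reindex (isUnit_blockSum hu hv) _

theorem isUnit_padTo {n N : ℕ} (h : n ≤ N) {u : Matrix (Fin n) (Fin n) A} (hu : IsUnit u) :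
    IsUnit (padTo N u) := by
  obtain ⟨k, rfl⟩ := Nat.exists_eq_add_of_le h
  rw [padTo_add]
  exact isUnit_dsum hu isUnit_one

section Topology
variable [TopologicalSpace A]

theorem continuous_padTo {n : ℕ} (N : ℕ) :
    Continuous (padTo N : Matrix (Fin n) (Fin n) A → Matrix (Fin N) (Fin N) A) := by
  refine continuous_matrix fun i j => ?_
  unfold padTo
  split_ifs
  · exact continuous_id.matrix_elem _ _
  · exact continuous_const
  · exact continuous_const

theorem continuous_dsum_left {m n : ℕ} (v : Matrix (Fin n) (Fin n) A) :
    Continuous fun u : Matrix (Fin m) (Fin m) A => dsum u v :=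
  (Continuous.matrix_fromBlocks continuous_id continuous_const continuous_const
    continuous_const).matrix_submatrix _ _

/-- Stable homotopy of invertible matrices: `u ⊕ 1` and `v ⊕ 1` are connected by a path in
`GL_N(A)`, for some `N`. -/
def StablyHomotopic {m n : ℕ} (u : Matrix (Fin m) (Fin m) A) (v : Matrix (Fin n) (Fin n) A) :
    Prop :=
  ∃ N, m ≤ N ∧ n ≤ N ∧ JoinedIn {w : Matrix (Fin N) (Fin N) A | IsUnit w} (padTo N u) (padTo N v)

variable {l m n : ℕ} {u : Matrix (Fin l) (Fin l) A} {v : Matrix (Fin m) (Fin m) A}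
  {w : Matrix (Fin n) (Fin n) A}

theorem StablyHomotopic.symm (h : StablyHomotopic u v) : StablyHomotopic v u :=
  let ⟨N, h1, h2, h3⟩ := h
  ⟨N, h2, h1, h3.symm⟩

theorem JoinedIn.padTo {v : Matrix (Fin l) (Fin l) A}
    (h : JoinedIn {w : Matrix (Fin l) (Fin l) A | IsUnit w} u v) {N : ℕ} (hN : l ≤ N) :
    JoinedIn {w : Matrix (Fin N) (Fin N) A | IsUnit w} (padTo N u) (padTo N v) :=
  (h.map (continuous_padTo N)).mono (by rintro _ ⟨w, hw, rfl⟩; exact isUnit_padTo hN hw)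

theorem StablyHomotopic.trans (h : StablyHomotopic u v) (h' : StablyHomotopic v w) :
    StablyHomotopic u w := by
  obtain ⟨N, h1, h2, h3⟩ := h
  obtain ⟨N', h4, h5, h6⟩ := h'
  have e1 := JoinedIn.padTo h3 (le_max_left N N')
  have e2 := JoinedIn.padTo h6 (le_max_right N N')
  rw [padTo_padTo h1 (le_max_left _ _), padTo_padTo h2 (le_max_left _ _)] at e1
  rw [padTo_padTo h4 (le_max_right _ _), padTo_padTo h5 (le_max_right _ _)] at e2
  exact ⟨max N N', h1.trans (le_max_left _ _), h5.trans (le_max_right _ _), e1.trans e2⟩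

theorem StablyHomotopic.of_joinedIn {v : Matrix (Fin l) (Fin l) A}
    (h : JoinedIn {w : Matrix (Fin l) (Fin l) A | IsUnit w} u v) : StablyHomotopic u v :=
  ⟨l, le_rfl, le_rfl, JoinedIn.padTo h le_rfl⟩

theorem StablyHomotopic.refl (hu : IsUnit u) : StablyHomotopic u u :=
  .of_joinedIn (JoinedIn.refl hu)

theorem StablyHomotopic.pad (hu : IsUnit u) {N : ℕ} (h : l ≤ N) : StablyHomotopic u (padTo N u) :=
  ⟨N, h, le_rfl, by rw [padTo_self]; exact JoinedIn.refl (isUnit_padTo h hu)⟩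

end Topology

/-- `GL_n(ℂ)` is path connected. -/
theorem joinedIn_GL (P : Matrix n n ℂ) (hP : P.det ≠ 0) :
    JoinedIn {Q : Matrix n n ℂ | Q.det ≠ 0} 1 P := by
  let q : Polynomial ℂ := Matrix.det
    ((1 : Matrix n n (Polynomial ℂ)) + (Polynomial.X : Polynomial ℂ) •
      (P - 1).map Polynomial.C)
  have hq : ∀ z : ℂ, q.eval z = (1 + z • (P - 1)).det := by
    intro z
    rw [← Polynomial.coe_evalRingHom, RingHom.map_det]
    congr 1
    ext i j
    by_cases h : i = j <;> simp [h] <;> ring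
  have hq0 : q ≠ 0 := by
    intro h
    have := hq 0
    simp [h] at this
  have hS : (({z : ℂ | q.IsRoot z} : Set ℂ)ᶜ : Set ℂ) = {z : ℂ | (1 + z • (P - 1)).det ≠ 0} := by
    ext z
    simp [Polynomial.IsRoot, hq]
  have hpc := (Polynomial.finite_setOfPred_isRoot hq0).countable.isPathConnected_compl_of_one_lt_rank
    (E := ℂ) (by rw [Complex.rank_real_complex]; norm_num)
  rw [hS] at hpc
  have h01 := hpc.joinedIn 0 (by simp) 1 (by simpa using hP)
  have := h01.map (f := fun z : ℂ => (1 + z • (P - 1) : Matrix n n ℂ)) (by fun_prop)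
  simp only [zero_smul, add_zero, one_smul, add_sub_cancel] at this
  exact this.mono (by rintro _ ⟨z, hz, rfl⟩; exact hz)

section Module
variable [Algebra ℂ A] [TopologicalSpace A] [ContinuousAdd A] [ContinuousSMul ℂ A]

theorem joinedIn_conj {X Y : Matrix n n A} (hX : IsUnit X) (hY : IsUnit Y) (P : Matrix n n ℂ)
    (hP : P.det ≠ 0) :
    JoinedIn {w : Matrix n n A | IsUnit w} (X * Y)
      (X * P.map (algebraMap ℂ A) * Y * P⁻¹.map (algebraMap ℂ A)) := by
  let F : Matrix n n ℂ → Matrix n n A := fun Q =>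
    X * Q.map (algebraMap ℂ A) * Y * Q⁻¹.map (algebraMap ℂ A)
  have hF : ∀ Q i j, F Q i j = ∑ c, ∑ b, ∑ a, (Q a b * Q⁻¹ c j) • (X i a * Y b c) := by
    intro Q i j
    simp only [F, Matrix.mul_apply, Finset.sum_mul, Matrix.map_apply]
    refine Finset.sum_congr rfl fun c _ => Finset.sum_congr rfl fun b _ =>
      Finset.sum_congr rfl fun a _ => ?_
    rw [← Algebra.commutes (Q a b), mul_assoc (algebraMap ℂ A (Q a b)), mul_assoc,
      ← Algebra.commutes (Q⁻¹ c j), ← mul_assoc, ← map_mul, Algebra.smul_def]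
  have hinv : ContinuousOn (fun Q : Matrix n n ℂ => Q⁻¹) {Q | Q.det ≠ 0} := by
    have : (fun Q : Matrix n n ℂ => Q⁻¹) = fun Q => Q.det⁻¹ • Q.adjugate := by
      ext1 Q
      rw [Matrix.inv_def, Ring.inverse_eq_inv']
    rw [this]
    exact (continuous_id.matrix_det.continuousOn.inv₀ fun Q hQ => hQ).smul
      continuous_id.matrix_adjugate.continuousOn
  have hFc : ContinuousOn F {Q | Q.det ≠ 0} := by
    refine continuousOn_pi.2 fun i => continuousOn_pi.2 fun j => ?_
    simp only [hF]
    refine continuousOn_finsetSum _ fun c _ => continuousOn_finsetSum _ fun b _ =>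
      continuousOn_finsetSum _ fun a _ => ?_
    refine ContinuousOn.smul (ContinuousOn.mul ?_ ?_) continuousOn_const
    · exact (continuous_id.matrix_elem a b).continuousOn
    · exact ((continuous_id.matrix_elem c j).comp_continuousOn hinv)
  have h := (joinedIn_GL P hP).map_continuousOn hFc
  have e1 : F 1 = X * Y := by
    simp [F]
  rw [e1] at h
  refine h.mono ?_
  rintro _ ⟨Q, hQ, rfl⟩
  have hQ' : IsUnit Q.det := isUnit_iff_ne_zero.2 hQ
  have hQu : IsUnit Q := (Matrix.isUnit_iff_isUnit_det Q).2 hQ'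
  have hQu' : IsUnit Q⁻¹ := (Matrix.isUnit_nonsing_inv_iff).2 hQu
  exact (((hX.mul (hQu.map (algebraMap ℂ A).mapMatrix)).mul hY).mul
    (hQu'.map (algebraMap ℂ A).mapMatrix))

theorem joinedIn_reindex {X : Matrix n n A} (hX : IsUnit X) (σ : n ≃ n) :
    JoinedIn {w : Matrix n n A | IsUnit w} X (Matrix.reindex σ σ X) := by
  let P : Matrix n n ℂ := (1 : Matrix n n ℂ).submatrix σ.symm id
  let R : Matrix n n ℂ := (1 : Matrix n n ℂ).submatrix id σ.symm
  have hPR : P * R = 1 := by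
    simp [P, R, ← Matrix.submatrix_mul (he₂ := Function.bijective_id)]
  have hR : P⁻¹ = R := Matrix.inv_eq_right_inv hPR
  have hP : P.det ≠ 0 := by
    intro h
    have := congrArg Matrix.det hPR
    simp [Matrix.det_mul, h] at this
  have h := joinedIn_conj isUnit_one hX P hP
  rw [one_mul, one_mul, hR] at h
  have e1 : P.map (algebraMap ℂ A) = (1 : Matrix n n A).submatrix σ.symm (Equiv.refl n) := by
    ext i j; by_cases h : σ.symm i = j <;> simp [P, Matrix.one_apply, h]
  have e2 : R.map (algebraMap ℂ A) = (1 : Matrix n n A).submatrix (Equiv.refl n) σ.symm := by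
    ext i j; by_cases h : i = σ.symm j <;> simp [R, Matrix.one_apply, h]
  rw [e1, e2, Matrix.one_submatrix_mul, Matrix.mul_submatrix_one] at h
  exact h

theorem StablyHomotopic.of_reindex {k l : ℕ} {X : Matrix n n A} (hX : IsUnit X) (α : n ≃ Fin k)
    (β : n ≃ Fin l) :
    StablyHomotopic (Matrix.reindex α α X) (Matrix.reindex β β X) := by
  obtain rfl : k = l := by
    have := Fintype.card_congr (α.symm.trans β)
    simpa using this
  have := joinedIn_reindex (isUnit_reindex hX α) (α.symm.trans β)
  rw [reindex_reindex, ← Equiv.trans_assoc, Equiv.self_trans_symm, Equiv.refl_trans] at this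
  exact .of_joinedIn this

theorem StablyHomotopic.dsum_left {k l m : ℕ} {u : Matrix (Fin k) (Fin k) A}
    {u' : Matrix (Fin l) (Fin l) A} {v : Matrix (Fin m) (Fin m) A} (hu : IsUnit u) (hu' : IsUnit u')
    (hv : IsUnit v) (h : StablyHomotopic u u') : StablyHomotopic (dsum u v) (dsum u' v) := by
  have key : ∀ {k N : ℕ} {u : Matrix (Fin k) (Fin k) A}, IsUnit u → k ≤ N →
      StablyHomotopic (dsum u v) (dsum (padTo N u) v) := by
    intro k N u hu hk
    obtain ⟨p, rfl⟩ := Nat.exists_eq_add_of_le hk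
    refine (StablyHomotopic.pad (isUnit_dsum hu hv) (Nat.le_add_right _ p)).trans ?_
    rw [padTo_add, padTo_add]
    obtain ⟨α, hα⟩ := dsum_dsum u v (1 : Matrix (Fin p) (Fin p) A)
    obtain ⟨β, hβ⟩ := dsum_dsum u (1 : Matrix (Fin p) (Fin p) A) v
    rw [hα, hβ]
    let γ : (Fin k ⊕ Fin m) ⊕ Fin p ≃ (Fin k ⊕ Fin p) ⊕ Fin m := (Equiv.sumAssoc _ _ _).trans
      (((Equiv.refl _).sumCongr (Equiv.sumComm _ _)).trans (Equiv.sumAssoc _ _ _).symm)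
    have e : blockSum (blockSum u (1 : Matrix (Fin p) (Fin p) A)) v =
        Matrix.reindex γ γ (blockSum (blockSum u v) (1 : Matrix (Fin p) (Fin p) A)) := by
      ext ((i | i) | i) ((j | j) | j) <;> simp [blockSum, γ]
    rw [e, reindex_reindex]
    exact .of_reindex (isUnit_blockSum (isUnit_blockSum hu hv) isUnit_one) _ _
  obtain ⟨N, h1, h2, h3⟩ := h
  refine (key hu h1).trans (.trans (.of_joinedIn ?_) (key hu' h2).symm)
  exact (h3.map (continuous_dsum_left v)).mono
    (by rintro _ ⟨w, hw, rfl⟩; exact isUnit_dsum hw hv)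

theorem StablyHomotopic.dsum_comm {k l : ℕ} {u : Matrix (Fin k) (Fin k) A}
    {v : Matrix (Fin l) (Fin l) A} (hu : IsUnit u) (hv : IsUnit v) :
    StablyHomotopic (dsum u v) (dsum v u) := by
  obtain ⟨α, hα⟩ := QDisk.dsum_comm u v
  rw [hα]
  exact .of_reindex (isUnit_blockSum hu hv) finSumFinEquiv α

theorem StablyHomotopic.dsum_inv {k : ℕ} {u v : Matrix (Fin k) (Fin k) A} (h : u * v = 1)
    (h' : v * u = 1) : StablyHomotopic (dsum u v) (0 : Matrix (Fin 0) (Fin 0) A) := by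
  have hu : IsUnit u := ⟨⟨u, v, h, h'⟩, rfl⟩
  have hv : IsUnit v := ⟨⟨v, u, h', h⟩, rfl⟩
  let P : Matrix (Fin k ⊕ Fin k) (Fin k ⊕ Fin k) ℂ := Matrix.fromBlocks 0 1 1 0
  have hPP : P * P = 1 := by simp [P, Matrix.fromBlocks_multiply, Matrix.fromBlocks_one]
  have hR : P⁻¹ = P := Matrix.inv_eq_right_inv hPP
  have hP : P.det ≠ 0 := by
    intro h
    have := congrArg Matrix.det hPP
    simp [Matrix.det_mul, h] at this
  have e1 : P.map (algebraMap ℂ A) = Matrix.fromBlocks 0 1 1 0 := by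
    simp [P, Matrix.fromBlocks_map]
  have hj := joinedIn_conj (isUnit_blockSum hu isUnit_one)
    (isUnit_blockSum hv (isUnit_one (M := Matrix (Fin k) (Fin k) A))) P hP
  rw [hR, e1, blockSum_mul, h, one_mul] at hj
  have e2 : blockSum u 1 * Matrix.fromBlocks 0 1 1 0 * blockSum v 1 *
      Matrix.fromBlocks 0 1 1 0 = blockSum u v := by
    simp [blockSum, Matrix.fromBlocks_multiply]
  rw [e2] at hj
  have hj' : JoinedIn {w : Matrix (Fin (k + k)) (Fin (k + k)) A | IsUnit w} (dsum 1 1) (dsum u v) :=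
    (hj.map (f := Matrix.reindex finSumFinEquiv finSumFinEquiv)
      (continuous_id.matrix_submatrix _ _)).mono
      (by rintro _ ⟨w, hw, rfl⟩; exact isUnit_reindex hw _)
  have e3 : (dsum 1 1 : Matrix (Fin (k + k)) (Fin (k + k)) A) = 1 := by
    simp [dsum, blockSum, Matrix.fromBlocks_one]
  have e4 : padTo (k + k) (0 : Matrix (Fin 0) (Fin 0) A) = 1 := by
    ext i j; simp [padTo, Matrix.one_apply]
  rw [e3, ← e4] at hj'
  have h0 : IsUnit (0 : Matrix (Fin 0) (Fin 0) A) := by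
    rw [Subsingleton.elim (0 : Matrix (Fin 0) (Fin 0) A) 1]; exact isUnit_one
  exact ((StablyHomotopic.pad h0 (Nat.zero_le _)).trans (.of_joinedIn hj')).symm

end Module

variable (A) in
/-- Invertible matrices over `A`, of all sizes. -/
structure InvMatrix where
  n : ℕ
  mat : Matrix (Fin n) (Fin n) A
  isUnit : IsUnit mat

variable (A) in
/-- The empty matrix, the unit of `GL_0(A)`. -/
def InvMatrix.empty : InvMatrix A :=
  ⟨0, 0, by rw [Subsingleton.elim (0 : Matrix (Fin 0) (Fin 0) A) 1]; exact isUnit_one⟩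

/-- The direct sum of invertible matrices. -/
def InvMatrix.dsum (u v : InvMatrix A) : InvMatrix A :=
  ⟨u.n + v.n, QDisk.dsum u.mat v.mat, isUnit_dsum u.isUnit v.isUnit⟩

instance InvMatrix.setoid [TopologicalSpace A] : Setoid (InvMatrix A) where
  r u v := StablyHomotopic u.mat v.mat
  iseqv := ⟨fun u => .refl u.isUnit, .symm, .trans⟩

variable (A) in
/-- `K₁(A)`, for an algebra `A` whose underlying vector space is topological: the stable homotopy
classes of invertible matrices, with the addition `[u] + [v] = [u ⊕ v]`. -/
def KOne [TopologicalSpace A] : Type u := Quotient (InvMatrix.setoid (A := A))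

/-- The class `[u]` in `K₁(A)` of an invertible matrix. -/
def KOne.mk [TopologicalSpace A] {n : ℕ} (u : Matrix (Fin n) (Fin n) A) (hu : IsUnit u) : KOne A :=
  Quotient.mk _ ⟨n, u, hu⟩

variable [Algebra ℂ A] [TopologicalSpace A] [ContinuousAdd A] [ContinuousSMul ℂ A]

instance : Add (KOne A) where
  add := Quotient.map₂ InvMatrix.dsum fun u u' h v v' h' =>
    (StablyHomotopic.dsum_left u.isUnit u'.isUnit v.isUnit h).trans
      ((StablyHomotopic.dsum_comm u'.isUnit v.isUnit).trans
        ((StablyHomotopic.dsum_left v.isUnit v'.isUnit u'.isUnit h').trans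
          (StablyHomotopic.dsum_comm v'.isUnit u'.isUnit)))

instance : Zero (KOne A) := ⟨Quotient.mk _ (InvMatrix.empty A)⟩

theorem KOne.add_comm' (x y : KOne A) : x + y = y + x := by
  obtain ⟨u⟩ := x
  obtain ⟨v⟩ := y
  exact Quotient.sound (StablyHomotopic.dsum_comm u.isUnit v.isUnit)

theorem KOne.zero_add' (x : KOne A) : 0 + x = x := by
  obtain ⟨u⟩ := x
  refine Quotient.sound ?_
  change StablyHomotopic (dsum (0 : Matrix (Fin 0) (Fin 0) A) u.mat) u.mat
  have := StablyHomotopic.of_reindex (isUnit_blockSum (InvMatrix.empty A).isUnit u.isUnit)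
    finSumFinEquiv (Equiv.emptySum (Fin 0) (Fin u.n))
  have e := blockSum_empty (0 : Matrix (Fin 0) (Fin 0) A) u.mat
  change StablyHomotopic _ (Matrix.reindex (Equiv.emptySum (Fin 0) (Fin u.n))
    (Equiv.emptySum (Fin 0) (Fin u.n)) (blockSum (0 : Matrix (Fin 0) (Fin 0) A) u.mat)) at this
  rw [← e] at this
  exact this

theorem KOne.exists_neg (x : KOne A) : ∃ y : KOne A, y + x = 0 := by
  obtain ⟨u⟩ := x
  obtain ⟨n, _, ⟨⟨u, v, h, h'⟩, rfl⟩⟩ := u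
  exact ⟨KOne.mk v ⟨⟨v, u, h', h⟩, rfl⟩, Quotient.sound (StablyHomotopic.dsum_inv h' h)⟩

instance : Neg (KOne A) := ⟨fun x => (KOne.exists_neg x).choose⟩

instance : AddCommGroup (KOne A) where
  add_assoc := by
    rintro ⟨u⟩ ⟨v⟩ ⟨w⟩
    refine Quotient.sound ?_
    change StablyHomotopic (dsum (dsum u.mat v.mat) w.mat) (dsum u.mat (dsum v.mat w.mat))
    obtain ⟨α, hα⟩ := dsum_dsum u.mat v.mat w.mat
    obtain ⟨β, hβ⟩ := dsum_dsum' u.mat v.mat w.mat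
    rw [hα, hβ]
    exact .of_reindex (isUnit_blockSum (isUnit_blockSum u.isUnit v.isUnit) w.isUnit) α β
  zero_add := KOne.zero_add'
  add_zero x := by rw [KOne.add_comm', KOne.zero_add']
  add_comm := KOne.add_comm'
  neg_add_cancel x := (KOne.exists_neg x).choose_spec
  nsmul := nsmulRec
  zsmul := zsmulRec

end KOne

end QDisk
end

open QDisk

/-!
An operator is smooth compact if and only if the norms of its columns and of the columns of its
adjoint decay rapidly (`isSmoothCompact_of_columnsDecay`), because the entries are bounded by both.
So bounds on matrix entries reduce to bounds on the vectors `c E_l`, and smooth compact operators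
absorb any bounded operator placed between two of them (`IsSmoothCompact.mul_mul`).

**Symbols.** The unit vectors `approxEigenvector` show that `‖f‖ ≤ ‖T(f) + c‖` (`norm_symbol_le`)
and that `f` vanishes nowhere when `T(f) + c` is invertible (`symbol_ne_zero`).

**Resolvents.** Let `a = T(g) + c` be in the smooth Toeplitz algebra, let `ζ - a` be invertible, and
`h = (ζ - g)⁻¹`. With the characters `e_m`,
`1 - (ζ - a) T(h) = ∑ ĥ(m) (a T(e_m) - T(g e_m))`.
The column `l` of `a T(e_m) - T(g e_m)` is the column `l + m` of `c`, or `l + m < 0`. As `ĥ` decays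
rapidly, so do the columns of `(ζ - a)⁻¹ - T(h)`, uniformly as long as `(ζ - a)⁻¹` and `h` remain
bounded (`resolvent_sub_decay`). At a single `ζ` this is inverse-closedness
(`exists_inverse_decomp`). Integrated over a contour, it gives the functional calculus
(`mem_smoothToeplitz_of_isHolomorphicCalculus`). Contours exist as boundaries of unions of squares
of a fine grid (`exists_contour_surrounds`).

**K-theory.** The smooth Toeplitz algebra is dense in the Toeplitz algebra (`denseRange_incl`) and
inverse-closed. By Schur complements both properties pass to matrices (`isUnit_of_isUnit_map`). So
equivalences of idempotents and segments of invertible matrices can be moved from the Toeplitz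
algebra into the smooth one. This gives the isomorphism in `K₁` (`exists_kOne_equiv`) and
injectivity on classes of idempotents (`MvN.of_map`). Surjectivity on these classes follows once
every idempotent matrix `e` is a limit of idempotent matrices over the smooth algebra
(`exists_idempotent_mem_nhds`). To obtain these without a functional calculus for matrices, apply
`idempotentNear x = (1 - (1 - 2x) (1 - 4w)^{-1/2}) / 2`, where `w = x - x²`, twice. For a matrix `x`
over the smooth algebra near `e` it first makes the symbol idempotent, which stays smooth because
this is an analytic function of its pointwise values. Then the entries of `w` are smooth compact,
so those of `(1 - 4w)^{-1/2} = 1 + 2w + w b w` are in the smooth algebra, even though nothing is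
known about the bounded matrix `b`.
-/

noncomputable section
open Filter Topology
namespace QDisk

/-! ### Toeplitz operators and smooth compact operators -/

section Operators
variable {H : Type*} [NormedAddCommGroup H] [InnerProductSpace ℂ H] [CompleteSpace H]
  (E : HilbertBasis ℕ ℂ H)

theorem ext_inner_basis {x y : H} (h : ∀ k, inner ℂ (E k) x = inner ℂ (E k) y) : x = y := by
  apply E.repr.injective
  ext k
  simpa [E.repr_apply_apply] using h k

theorem ext_coeff {a b : H →L[ℂ] H} (h : ∀ k l, coeff E a k l = coeff E b k l) : a = b := by
  have hd : Dense (Submodule.span ℂ (Set.range E) : Set H) := by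
    rw [Submodule.dense_iff_topologicalClosure_eq_top]
    exact E.dense_span
  refine ContinuousLinearMap.ext_on hd ?_
  rintro _ ⟨l, rfl⟩
  exact ext_inner_basis E fun k => h k l

theorem coeff_adjoint (a : H →L[ℂ] H) (k l : ℕ) :
    coeff E a.adjoint k l = (starRingEnd ℂ) (coeff E a l k) := by
  simp [coeff, ContinuousLinearMap.adjoint_inner_right]

theorem norm_coeff_le (a : H →L[ℂ] H) (k l : ℕ) : ‖coeff E a k l‖ ≤ ‖a (E l)‖ := by
  refine (norm_inner_le_norm _ _).trans ?_
  rw [E.orthonormal.1 k, one_mul]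

theorem norm_le_tsum_norm_inner {x : H} {b : ℕ → ℝ} (hb : Summable b)
    (h : ∀ k, ‖inner ℂ (E k) x‖ ≤ b k) : ‖x‖ ≤ ∑' k, b k := by
  have h1 := E.hasSum_repr x
  rw [← h1.tsum_eq]
  refine tsum_of_norm_bounded hb.hasSum fun k => ?_
  rw [norm_smul, E.orthonormal.1 k, mul_one, E.repr_apply_apply]
  exact h k

/-- The columns `a E_l` of the operator decay rapidly in norm. -/
def ColumnsDecay (a : H →L[ℂ] H) : Prop :=
  ∀ N : ℕ, ∃ C : ℝ, ∀ l : ℕ, (1 + l : ℝ) ^ N * ‖a (E l)‖ ≤ C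

variable {E}

theorem IsSmoothCompact.adjoint {c : H →L[ℂ] H} (hc : IsSmoothCompact E c) :
    IsSmoothCompact E c.adjoint := by
  intro M N
  obtain ⟨C, hC⟩ := hc N M
  refine ⟨C, fun k l => ?_⟩
  rw [coeff_adjoint, RCLike.norm_conj, mul_comm ((1 + k : ℝ) ^ M)]
  exact hC l k

theorem IsSmoothCompact.columnsDecay {c : H →L[ℂ] H} (hc : IsSmoothCompact E c) :
    ColumnsDecay E c := by
  intro N
  obtain ⟨C, hC⟩ := hc 2 N
  refine ⟨∑' k : ℕ, C * ((1 + k : ℝ) ^ 2)⁻¹, fun l => ?_⟩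
  have h1 : ‖((1 + l : ℝ) ^ N : ℂ) • c (E l)‖ ≤ _ :=
    norm_le_tsum_norm_inner E (summable_inv_sq.mul_left C) fun k => ?_
  · have e : ‖((1 + l : ℝ) ^ N : ℂ)‖ = (1 + l : ℝ) ^ N := by
      rw [← Complex.ofReal_pow, Complex.norm_real, Real.norm_of_nonneg (by positivity)]
    rwa [norm_smul, e] at h1
  · have e : ‖((1 + l : ℝ) ^ N : ℂ)‖ = (1 + l : ℝ) ^ N := by
      rw [← Complex.ofReal_pow, Complex.norm_real, Real.norm_of_nonneg (by positivity)]
    rw [inner_smul_right, norm_mul, e, ← div_eq_mul_inv, le_div_iff₀ (by positivity)]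
    calc _ = (1 + k : ℝ) ^ 2 * (1 + l : ℝ) ^ N * ‖coeff E c k l‖ := by rw [coeff]; ring
      _ ≤ C := hC k l

/-- If `x ≤ C p⁻²` and `x ≤ D q⁻²` then `p q x ≤ max C D`. -/
theorem mul_mul_le_max {p q x C D : ℝ} (hp : 0 ≤ p) (hq : 0 ≤ q) (hx : 0 ≤ x)
    (h1 : p ^ 2 * x ≤ C) (h2 : q ^ 2 * x ≤ D) : p * q * x ≤ max C D := by
  rcases le_total p q with h | h
  · refine le_trans ?_ (h2.trans (le_max_right _ _))
    rw [sq]; gcongr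
  · refine le_trans ?_ (h1.trans (le_max_left _ _))
    rw [sq]; gcongr

/-- Rapid decay of rows and columns separately implies joint rapid decay. -/
theorem isSmoothCompact_of_columnsDecay {c : H →L[ℂ] H} (h : ColumnsDecay E c)
    (h' : ColumnsDecay E c.adjoint) : IsSmoothCompact E c := by
  intro M N
  obtain ⟨C, hC⟩ := h' (M * 2)
  obtain ⟨D, hD⟩ := h (N * 2)
  refine ⟨max C D, fun k l => mul_mul_le_max (by positivity) (by positivity) (norm_nonneg _) ?_ ?_⟩
  · rw [← pow_mul]
    refine le_trans ?_ (hC k)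
    gcongr
    rw [← RCLike.norm_conj, ← coeff_adjoint]
    exact norm_coeff_le E _ _ _
  · rw [← pow_mul]
    refine le_trans ?_ (hD l)
    gcongr
    exact norm_coeff_le E _ _ _

/-- Smooth compact operators absorb an arbitrary bounded operator between two of them. -/
theorem IsSmoothCompact.mul_mul {c d : H →L[ℂ] H} (hc : IsSmoothCompact E c)
    (hd : IsSmoothCompact E d) (b : H →L[ℂ] H) : IsSmoothCompact E (c * b * d) := by
  -- bounded operators on the left do not affect the decay of columns
  have key : ∀ {c d : H →L[ℂ] H}, IsSmoothCompact E d → ColumnsDecay E (c * d) := by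
    intro c d hd N
    obtain ⟨C, hC⟩ := hd.columnsDecay N
    refine ⟨‖c‖ * C, fun l => ?_⟩
    calc (1 + l : ℝ) ^ N * ‖c (d (E l))‖ ≤ (1 + l : ℝ) ^ N * (‖c‖ * ‖d (E l)‖) := by
          gcongr; exact c.le_opNorm _
      _ = ‖c‖ * ((1 + l : ℝ) ^ N * ‖d (E l)‖) := by ring
      _ ≤ _ := by gcongr; exact hC l
  refine isSmoothCompact_of_columnsDecay (key hd) ?_
  have : (c * b * d).adjoint = (d.adjoint * b.adjoint) * c.adjoint := by
    simp only [← ContinuousLinearMap.star_eq_adjoint, star_mul, mul_assoc]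
  rw [this]
  exact key hc.adjoint

variable (E)

theorem inner_toeplitzOp (f : C(UnitAddCircle, ℂ)) (k l : ℕ) :
    inner ℂ (E k) (toeplitzOp E f (E l)) = fourierCoeff f ((k : ℤ) - l) :=
  coeff_toeplitzOp E f k l

theorem fourierCoeff_mul_fourier (f : C(UnitAddCircle, ℂ)) (m n : ℤ) :
    fourierCoeff (f * fourier m : C(UnitAddCircle, ℂ)) n = fourierCoeff f (n - m) := by
  simp only [fourierCoeff]
  congr 1
  ext x
  simp only [ContinuousMap.mul_apply, smul_eq_mul]
  rw [show -(n - m) = -n + m by ring, fourier_add]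
  ring

/-- `T(f e_m) E_l = T(f) E_{l+m}`. -/
theorem toeplitzOp_mul_fourier_apply (f : C(UnitAddCircle, ℂ)) {m : ℤ} {l l' : ℕ}
    (h : (l : ℤ) + m = l') :
    toeplitzOp E (f * fourier m) (E l) = toeplitzOp E f (E l') := by
  refine ext_inner_basis E fun k => ?_
  rw [inner_toeplitzOp, inner_toeplitzOp, fourierCoeff_mul_fourier]
  congr 1
  omega

theorem toeplitzOp_fourier_apply {m : ℤ} {l l' : ℕ} (h : (l : ℤ) + m = l') :
    toeplitzOp E (fourier m) (E l) = E l' := by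
  have := toeplitzOp_mul_fourier_apply E 1 h
  rwa [one_mul, toeplitzOp_one] at this

theorem toeplitzOp_fourier_apply_of_neg {m : ℤ} {l : ℕ} (h : (l : ℤ) + m < 0) :
    toeplitzOp E (fourier m) (E l) = 0 := by
  refine ext_inner_basis E fun k => ?_
  rw [inner_toeplitzOp, inner_zero_right, fourierCoeff_fourier, Pi.single_eq_of_ne]
  omega

theorem fourierCoeff_star (f : C(UnitAddCircle, ℂ)) (n : ℤ) :
    fourierCoeff (star f : C(UnitAddCircle, ℂ)) n = (starRingEnd ℂ) (fourierCoeff f (-n)) := by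
  simp only [fourierCoeff]
  rw [← integral_conj]
  congr 1
  ext x
  simp only [smul_eq_mul, map_mul, ContinuousMap.star_apply]
  rw [← fourier_neg, neg_neg]
  rfl

theorem toeplitzOp_adjoint (f : C(UnitAddCircle, ℂ)) :
    (toeplitzOp E f).adjoint = toeplitzOp E (star f) := by
  refine ext_coeff E fun k l => ?_
  rw [coeff_adjoint, coeff_toeplitzOp, coeff_toeplitzOp, fourierCoeff_star, neg_sub]

/-- Both the compression and the multiplication operator are contractive in the symbol; the
multiplication operator is the Hölder product with the class of `f` in `L^∞`. -/
theorem norm_toeplitzOp_le (f : C(UnitAddCircle, ℂ)) : ‖toeplitzOp E f‖ ≤ ‖f‖ := by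
  have h1 : ‖mulOp f‖ ≤ ‖f‖ := by
    refine (ContinuousLinearMap.le_opNorm _ _).trans ?_
    refine (mul_le_mul (ContinuousLinearMap.norm_holderL_le _) ((ContinuousMap.toLp (p := ⊤)
      (E := ℂ) (𝕜 := ℂ) (AddCircle.haarAddCircle (T := (1 : ℝ)))).le_opNorm f)
      (norm_nonneg _) (norm_nonneg _)).trans ?_
    have h2 := ContinuousMap.toLp_norm_le (p := ⊤) (E := ℂ) (𝕜 := ℂ)
      (μ := AddCircle.haarAddCircle (T := (1 : ℝ)))
    simp only [ENNReal.toReal_top, inv_zero, Real.rpow_zero] at h2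
    calc _ ≤ 1 * (1 * ‖f‖) := by
          gcongr
          exact ContinuousLinearMap.opNorm_mul_le ℂ ℂ
      _ = ‖f‖ := by ring
  have hJ : ‖(hardyEmbedding E).toContinuousLinearMap‖ ≤ 1 :=
    (hardyEmbedding E).norm_toContinuousLinearMap_le
  calc _ ≤ ‖(hardyEmbedding E).toContinuousLinearMap.adjoint‖ *
        (‖mulOp f‖ * ‖(hardyEmbedding E).toContinuousLinearMap‖) :=
        (ContinuousLinearMap.opNorm_comp_le _ _).trans
          (mul_le_mul_of_nonneg_left (ContinuousLinearMap.opNorm_comp_le _ _) (norm_nonneg _))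
    _ ≤ 1 * (‖f‖ * 1) := by
        rw [LinearIsometryEquiv.norm_map]
        gcongr
    _ = ‖f‖ := by ring

/-- The Toeplitz operator as a bounded linear function of its symbol. -/
def toeplitzCLM : C(UnitAddCircle, ℂ) →L[ℂ] (H →L[ℂ] H) :=
  LinearMap.mkContinuous
    { toFun := toeplitzOp E
      map_add' := toeplitzOp_add E
      map_smul' := toeplitzOp_smul E } 1 fun f => by
    rw [one_mul]; exact norm_toeplitzOp_le E f

theorem shift_apply (k : ℕ) : shift E (E k) = E (k + 1) :=
  isometryOf_apply E (E.orthonormal.comp _ (add_left_injective 1)) k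

theorem shift_eq_toeplitzOp : shift E = toeplitzOp E (fourier 1) := by
  refine ext_coeff E fun k l => ?_
  rw [coeff, coeff, shift_apply, toeplitzOp_fourier_apply E (l' := l + 1) (by push_cast; ring)]

theorem toeplitzOp_mul_fourier_one (f : C(UnitAddCircle, ℂ)) :
    toeplitzOp E (f * fourier 1) = toeplitzOp E f * shift E := by
  refine ext_coeff E fun k l => ?_
  rw [coeff, coeff, mul_apply_eq_comp, shift_apply,
    toeplitzOp_mul_fourier_apply E f (l' := l + 1) (by push_cast; ring)]

theorem fourier_zero_eq : fourier (T := (1 : ℝ)) 0 = 1 := by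
  ext x; exact fourier_zero

/-- The unit vectors `(n + 1)^{-1/2} ∑_{k ≤ n} e^{-2πikx} E_k`, approximate eigenvectors of every
Toeplitz operator `T(f)`, with eigenvalue `f x`. -/
def approxEigenvector (x : UnitAddCircle) (n : ℕ) : H :=
  ((√(n + 1 : ℝ))⁻¹ : ℂ) • ∑ k ∈ Finset.range (n + 1), fourier (-(k : ℤ)) x • E k

theorem norm_fourier_apply (m : ℤ) (x : UnitAddCircle) : ‖fourier m x‖ = 1 := by
  rw [fourier_apply, Circle.norm_coe]

theorem norm_inv_sqrt (n : ℕ) : ‖((√(n + 1 : ℝ))⁻¹ : ℂ)‖ = (√(n + 1 : ℝ))⁻¹ := by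
  rw [← Complex.ofReal_inv, Complex.norm_real, Real.norm_of_nonneg (by positivity)]

theorem tendsto_inv_sqrt : Tendsto (fun n : ℕ => (√(n + 1 : ℝ))⁻¹) atTop (𝓝 0) := by
  refine tendsto_inv_atTop_zero.comp (Real.tendsto_sqrt_atTop.comp ?_)
  exact tendsto_atTop_add_const_right _ _ tendsto_natCast_atTop_atTop

theorem norm_approxEigenvector (x : UnitAddCircle) (n : ℕ) : ‖approxEigenvector E x n‖ = 1 := by
  rw [approxEigenvector, norm_smul, norm_inv_sqrt]
  have h : ‖∑ k ∈ Finset.range (n + 1), fourier (-(k : ℤ)) x • E k‖ ^ 2 = n + 1 := by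
    have := E.orthonormal.inner_sum (fun k : ℕ => fourier (-(k : ℤ)) x)
      (fun k : ℕ => fourier (-(k : ℤ)) x) (Finset.range (n + 1))
    rw [inner_self_eq_norm_sq_to_K] at this
    have e : ∀ k : ℕ, (starRingEnd ℂ) (fourier (-(k : ℤ)) x) * fourier (-(k : ℤ)) x = 1 := by
      intro k
      rw [mul_comm, Complex.mul_conj, Complex.normSq_eq_norm_sq, norm_fourier_apply]; simp
    simp only [e, Finset.sum_const, Finset.card_range, nsmul_eq_mul, mul_one] at this
    apply Complex.ofReal_injective
    push_cast at this ⊢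
    exact this
  have h' : ‖∑ k ∈ Finset.range (n + 1), fourier (-(k : ℤ)) x • E k‖ = √(n + 1 : ℝ) := by
    rw [← h, Real.sqrt_sq (norm_nonneg _)]
  rw [h']
  exact inv_mul_cancel₀ (by positivity)

theorem tendsto_approxEigenvector_of_columnsDecay (x : UnitAddCircle) {c : H →L[ℂ] H}
    (hc : ColumnsDecay E c) : Tendsto (fun n => c (approxEigenvector E x n)) atTop (𝓝 0) := by
  obtain ⟨C, hC⟩ := hc 2
  have h1 : ∀ k : ℕ, ‖c (E k)‖ ≤ C * ((1 + k : ℝ) ^ 2)⁻¹ := fun k => by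
    rw [← div_eq_mul_inv, le_div_iff₀ (by positivity), mul_comm]
    exact hC k
  have hs := summable_inv_sq.mul_left C
  refine squeeze_zero_norm (a := fun n : ℕ => (√(n + 1 : ℝ))⁻¹ * ∑' k : ℕ, C * ((1 + k : ℝ) ^ 2)⁻¹)
    (fun n => ?_) (by simpa using tendsto_inv_sqrt.mul_const _)
  rw [approxEigenvector, map_smul, norm_smul, norm_inv_sqrt, map_sum]
  gcongr
  refine (norm_sum_le _ _).trans ((Finset.sum_le_sum fun k _ => ?_).trans
    (hs.sum_le_tsum _ fun k _ => (norm_nonneg _).trans (h1 k)))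
  rw [map_smul, norm_smul, norm_fourier_apply, one_mul]
  exact h1 k

/-- On the sum defining `approxEigenvector`, `U - e^{2πix}` telescopes to two boundary terms. -/
theorem tendsto_shift_approxEigenvector (x : UnitAddCircle) :
    Tendsto (fun n => shift E (approxEigenvector E x n) - fourier 1 x • approxEigenvector E x n)
      atTop (𝓝 0) := by
  refine squeeze_zero_norm (a := fun n : ℕ => (√(n + 1 : ℝ))⁻¹ * 2) (fun n => ?_)
    (by simpa using tendsto_inv_sqrt.mul_const _)
  have h : shift E (∑ k ∈ Finset.range (n + 1), fourier (-(k : ℤ)) x • E k) -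
      fourier 1 x • ∑ k ∈ Finset.range (n + 1), fourier (-(k : ℤ)) x • E k =
      fourier (-(n : ℤ)) x • E (n + 1) - fourier 1 x • E 0 := by
    rw [map_sum, Finset.smul_sum, Finset.sum_range_succ, Finset.sum_range_succ']
    have : ∀ k : ℕ, fourier 1 x • fourier (-((k + 1 : ℕ) : ℤ)) x • E (k + 1) =
        shift E (fourier (-(k : ℤ)) x • E k) := by
      intro k
      rw [map_smul, shift_apply, smul_smul, ← fourier_add]
      congr 2
      push_cast; ring_nf
    simp only [this, map_smul, shift_apply]
    simp
  rw [approxEigenvector, map_smul, smul_comm (fourier 1 x), ← smul_sub, norm_smul, norm_inv_sqrt, h]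
  gcongr
  refine (norm_sub_le _ _).trans ?_
  rw [norm_smul, norm_smul, norm_fourier_apply, norm_fourier_apply, E.orthonormal.1,
    E.orthonormal.1]
  norm_num

theorem tendsto_toeplitzOp_approxEigenvector (f : C(UnitAddCircle, ℂ)) (x : UnitAddCircle) :
    Tendsto (fun n => toeplitzOp E f (approxEigenvector E x n) - f x • approxEigenvector E x n)
      atTop (𝓝 0) := by
  set v := approxEigenvector E x with hv
  -- the functions with this property form a closed subspace, which contains the characters
  let S : Submodule ℂ C(UnitAddCircle, ℂ) :=
    { carrier := {f | Tendsto (fun n => toeplitzOp E f (v n) - f x • v n) atTop (𝓝 0)}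
      zero_mem' := by
        have : toeplitzOp E 0 = 0 := map_zero (toeplitzCLM E)
        simp [this]
      add_mem' := fun {f g} hf hg => by
        have := Tendsto.add hf hg
        rw [add_zero] at this
        refine this.congr fun n => ?_
        rw [toeplitzOp_add, add_apply, ContinuousMap.add_apply, add_smul]
        abel
      smul_mem' := fun z f hf => by
        have := Tendsto.const_smul hf z
        rw [smul_zero] at this
        refine this.congr fun n => ?_
        rw [toeplitzOp_smul, smul_apply, ContinuousMap.smul_apply, smul_sub,
          smul_eq_mul, mul_smul] }
  have hclosed : IsClosed (S : Set C(UnitAddCircle, ℂ)) := by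
    refine isClosed_of_closure_subset fun f hf => ?_
    change Tendsto _ _ _
    rw [NormedAddCommGroup.tendsto_atTop]
    intro ε hε
    obtain ⟨g, hg, hfg⟩ := Metric.mem_closure_iff.1 hf (ε / 4) (by positivity)
    obtain ⟨N, hN⟩ := NormedAddCommGroup.tendsto_atTop.1 hg (ε / 4) (by positivity)
    refine ⟨N, fun n hn => ?_⟩
    have h1 := hN n hn
    rw [dist_eq_norm] at hfg
    have h2 : ‖toeplitzOp E (f - g) (v n)‖ ≤ ‖f - g‖ := by
      refine (ContinuousLinearMap.le_opNorm _ _).trans ?_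
      rw [norm_approxEigenvector, mul_one]
      exact norm_toeplitzOp_le E _
    have h3 : ‖(f - g) x • v n‖ ≤ ‖f - g‖ := by
      rw [norm_smul, norm_approxEigenvector, mul_one]
      exact (f - g).norm_coe_le_norm x
    have e : toeplitzOp E f (v n) - f x • v n - 0 = toeplitzOp E (f - g) (v n) - (f - g) x • v n +
        (toeplitzOp E g (v n) - g x • v n - 0) := by
      have : toeplitzOp E (f - g) = toeplitzOp E f - toeplitzOp E g := map_sub (toeplitzCLM E) f g
      rw [this, sub_apply, ContinuousMap.sub_apply, sub_smul]
      abel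
    rw [e]
    calc _ ≤ ‖f - g‖ + ‖f - g‖ + ε / 4 :=
          (norm_add_le _ _).trans (add_le_add ((norm_sub_le _ _).trans (add_le_add h2 h3)) h1.le)
      _ < ε := by linarith
  have hchar : ∀ m : ℤ, fourier m ∈ S := by
    have hsh : Tendsto (fun n => shift E (v n) - fourier 1 x • v n) atTop (𝓝 0) :=
      tendsto_shift_approxEigenvector E x
    intro m
    induction m using Int.induction_on with
    | zero =>
      change Tendsto _ _ _
      rw [fourier_zero_eq, toeplitzOp_one]
      simp
    | succ m ih =>
      have h1 := (((toeplitzOp E (fourier m)).continuous.tendsto 0).comp hsh).add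
        (Tendsto.const_smul ih (fourier 1 x))
      rw [map_zero, smul_zero, add_zero] at h1
      refine h1.congr fun n => ?_
      have e : fourier ((m : ℤ) + 1) = fourier (T := (1 : ℝ)) m * fourier 1 := by
        ext y; exact fourier_add
      rw [e, toeplitzOp_mul_fourier_one, ContinuousMap.mul_apply, mul_apply_eq_comp,
        Function.comp_apply, map_sub, map_smul, smul_sub, smul_smul, mul_comm (fourier 1 x)]
      abel
    | pred m ih =>
      -- `T(e_{-m})` is `T(e_{-m-1}) U`, and `U v` is close to `e^{2πix} v`
      have h1 := ((((toeplitzOp E (fourier (-m - 1))).continuous.tendsto 0).comp hsh).neg.add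
        ih).const_smul (fourier (-1) x)
      rw [map_zero, neg_zero, zero_add, smul_zero] at h1
      refine h1.congr fun n => ?_
      have e : fourier (-(m : ℤ)) = fourier (T := (1 : ℝ)) (-m - 1) * fourier 1 := by
        ext y
        rw [ContinuousMap.mul_apply, ← fourier_add]
        congr 2; ring_nf
      have e2 : fourier (-1) x * fourier 1 x = 1 := by
        rw [← fourier_add]; simp
      rw [e, toeplitzOp_mul_fourier_one, ContinuousMap.mul_apply, mul_apply_eq_comp,
        Function.comp_apply, map_sub, map_smul, neg_sub, sub_add_sub_cancel, smul_sub, smul_smul,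
        smul_smul, e2, one_smul, mul_comm (fourier (-1) x), mul_assoc, mul_comm (fourier 1 x), e2,
        mul_one]
  have htop : (Submodule.span ℂ (Set.range (@fourier 1))).topologicalClosure ≤ S :=
    Submodule.topologicalClosure_minimal _
      (Submodule.span_le.2 (Set.range_subset_iff.2 hchar)) hclosed
  rw [span_fourier_closure_eq_top] at htop
  exact htop (Submodule.mem_top (x := f))

variable {E}

theorem tendsto_approxEigenvector {f : C(UnitAddCircle, ℂ)} {c : H →L[ℂ] H}
    (hc : IsSmoothCompact E c) (x : UnitAddCircle) :
    Tendsto (fun n => (toeplitzOp E f + c) (approxEigenvector E x n) -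
      f x • approxEigenvector E x n) atTop (𝓝 0) := by
  have := (tendsto_toeplitzOp_approxEigenvector E f x).add
    (tendsto_approxEigenvector_of_columnsDecay E x hc.columnsDecay)
  rw [add_zero] at this
  refine this.congr fun n => ?_
  rw [add_apply]
  abel

/-- The symbol map is contractive: along the approximate eigenvectors, `T(f) + c` acts as `f x`. -/
theorem norm_symbol_le {f : C(UnitAddCircle, ℂ)} {c : H →L[ℂ] H} (hc : IsSmoothCompact E c) :
    ‖f‖ ≤ ‖toeplitzOp E f + c‖ := by
  refine (ContinuousMap.norm_le _ (norm_nonneg _)).2 fun x => ?_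
  have h := (tendsto_approxEigenvector (f := f) hc x).norm
  rw [norm_zero] at h
  have h2 := h.const_add ‖toeplitzOp E f + c‖
  rw [add_zero] at h2
  refine ge_of_tendsto' h2 fun n => ?_
  set v := approxEigenvector E x n with hv
  have h3 : ‖f x • v‖ = ‖f x‖ := by rw [norm_smul, norm_approxEigenvector, mul_one]
  have h4 : ‖(toeplitzOp E f + c) v‖ ≤ ‖toeplitzOp E f + c‖ := by
    refine (ContinuousLinearMap.le_opNorm _ _).trans ?_
    rw [norm_approxEigenvector, mul_one]
  rw [← h3, norm_sub_rev]
  linarith [norm_sub_norm_le (f x • v) ((toeplitzOp E f + c) v)]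

/-- The symbol of an invertible operator vanishes nowhere: at a zero `x` of the symbol, the operator
maps the unit vectors `approxEigenvector E x n` to vectors tending to `0`. -/
theorem symbol_ne_zero {f : C(UnitAddCircle, ℂ)} {c : H →L[ℂ] H} (hc : IsSmoothCompact E c)
    (hu : IsUnit (toeplitzOp E f + c)) (x : UnitAddCircle) : f x ≠ 0 := by
  intro h0
  obtain ⟨u, hu⟩ := hu
  have h := tendsto_approxEigenvector (f := f) hc x
  simp only [h0, zero_smul, sub_zero, ← hu] at h
  have h1 := (((↑u⁻¹ : H →L[ℂ] H).continuous.tendsto 0).comp h).norm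
  rw [map_zero, norm_zero] at h1
  have h2 : ∀ n, ‖(↑u⁻¹ : H →L[ℂ] H) ((u : H →L[ℂ] H) (approxEigenvector E x n))‖ = 1 := by
    intro n
    rw [← mul_apply_eq_comp, Units.inv_mul, one_apply_eq_self, norm_approxEigenvector]
  simp only [Function.comp_def, h2] at h1
  exact one_ne_zero (tendsto_nhds_unique tendsto_const_nhds h1)

variable (E)

theorem shift_mem : shift E ∈ toeplitzAlgebra E := StarAlgebra.elemental.self_mem ℂ _

/-- Toeplitz operators with continuous symbol belong to the Toeplitz algebra. -/
theorem toeplitzOp_mem (f : C(UnitAddCircle, ℂ)) : toeplitzOp E f ∈ toeplitzAlgebra E := by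
  have hpos : ∀ m : ℕ, toeplitzOp E (fourier m) ∈ toeplitzAlgebra E := by
    intro m
    induction m with
    | zero => rw [Nat.cast_zero, fourier_zero_eq, toeplitzOp_one]; exact one_mem _
    | succ m ih =>
      have e : fourier ((m + 1 : ℕ) : ℤ) = fourier (T := (1 : ℝ)) m * fourier 1 := by
        ext y; push_cast; exact fourier_add
      rw [e, toeplitzOp_mul_fourier_one]
      exact mul_mem ih (shift_mem E)
  have hchar : ∀ m : ℤ, toeplitzOp E (fourier m) ∈ toeplitzAlgebra E := by
    intro m
    obtain ⟨n, rfl | rfl⟩ := m.eq_nat_or_neg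
    · exact hpos n
    · have := star_mem (hpos n)
      rw [ContinuousLinearMap.star_eq_adjoint, toeplitzOp_adjoint] at this
      convert! this using 2
      ext y
      exact fourier_neg
  have hclosed : IsClosed ((toeplitzAlgebra E : Set (H →L[ℂ] H))) :=
    StarAlgebra.elemental.isClosed ℂ (shift E)
  have hsp : (Submodule.span ℂ (Set.range (@fourier 1))).topologicalClosure ≤
      Submodule.comap (toeplitzCLM E : C(UnitAddCircle, ℂ) →ₗ[ℂ] (H →L[ℂ] H))
        (toeplitzAlgebra E).toSubalgebra.toSubmodule :=
    Submodule.topologicalClosure_minimal _ (Submodule.span_le.2 (Set.range_subset_iff.2 hchar))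
      (hclosed.preimage (toeplitzCLM E).continuous)
  rw [span_fourier_closure_eq_top] at hsp
  exact hsp (Submodule.mem_top (x := f))

theorem isSmooth_fourier (m : ℤ) : IsSmooth (fourier m) := by
  unfold IsSmooth
  simp only [fourier_coe_apply]
  have : ContDiff ℝ ((⊤ : ℕ∞) : WithTop ℕ∞) (fun x : ℝ => (x : ℂ)) := Complex.ofRealCLM.contDiff
  fun_prop

/-- The smooth Toeplitz algebra is dense in the Toeplitz algebra, because it contains `U` and
`U^*`. -/
theorem denseRange_incl : DenseRange (incl E) := by
  let B : Subalgebra ℂ (H →L[ℂ] H) := (smoothToeplitz E).map (toeplitzAlgebra E).subtype.toAlgHom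
  have hU : ∀ m : ℤ, toeplitzOp E (fourier m) ∈ B := fun m =>
    ⟨⟨_, toeplitzOp_mem E (fourier m)⟩, ⟨fourier m, 0, isSmooth_fourier m, isSmoothCompact_zero E,
      (add_zero _).symm⟩, rfl⟩
  have h1 : (StarAlgebra.adjoin ℂ {shift E}).toSubalgebra ≤ B := by
    rw [StarAlgebra.adjoin_toSubalgebra]
    refine Algebra.adjoin_le ?_
    rintro _ (rfl | h)
    · rw [shift_eq_toeplitzOp]; exact hU 1
    · rw [Set.mem_star, Set.mem_singleton_iff, star_eq_iff_star_eq] at h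
      rw [SetLike.mem_coe, ← h, shift_eq_toeplitzOp, ContinuousLinearMap.star_eq_adjoint,
        toeplitzOp_adjoint]
      convert! hU (-1) using 2
      ext y
      exact fourier_neg.symm
  intro a
  have h2 : (a : H →L[ℂ] H) ∈ closure (StarAlgebra.adjoin ℂ {shift E} : Set (H →L[ℂ] H)) := a.2
  rw [Metric.mem_closure_iff] at h2 ⊢
  intro ε hε
  obtain ⟨b, hb, hab⟩ := h2 ε hε
  obtain ⟨b', hb', rfl⟩ := h1 hb
  exact ⟨b', ⟨⟨b', hb'⟩, rfl⟩, hab⟩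

end Operators

/-! ### Resolvents of elements of the smooth Toeplitz algebra -/

section Resolvent
variable {H : Type*} [NormedAddCommGroup H] [InnerProductSpace ℂ H] [CompleteSpace H]

theorem IsSmooth.of_mul_eq_one {f h : C(UnitAddCircle, ℂ)} (hf : IsSmooth f)
    (hfh : ∀ x, h x * f x = 1) : IsSmooth h := by
  have h1 : (fun x : ℝ => h (x : UnitAddCircle)) = fun x : ℝ => (f (x : UnitAddCircle))⁻¹ := by
    ext x
    exact eq_inv_of_mul_eq_one_left (hfh x)
  rw [IsSmooth, h1]
  exact ContDiff.inv hf fun x h0 => by simpa [h0] using hfh x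

theorem fourierCoeffOn_add {F G : ℝ → ℂ} (hF : Continuous F) (hG : Continuous G) (n : ℤ) :
    fourierCoeffOn (zero_lt_one' ℝ) (fun x => F x + G x) n =
      fourierCoeffOn (zero_lt_one' ℝ) F n + fourierCoeffOn (zero_lt_one' ℝ) G n := by
  simp only [fourierCoeffOn_eq_integral]
  rw [← smul_add, ← intervalIntegral.integral_add]
  · simp only [smul_add]
  all_goals
    refine Continuous.intervalIntegrable ?_ _ _
    have := (map_continuous (fourier (T := (1 : ℝ) - 0) (-n))).comp
      (AddCircle.continuous_mk' ((1 : ℝ) - 0))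
    exact this.smul ‹_›

theorem norm_fourierCoeffOn_le {F : ℝ → ℂ} {C : ℝ} (hF : ∀ x ∈ Set.Icc (0 : ℝ) 1, ‖F x‖ ≤ C)
    (n : ℤ) : ‖fourierCoeffOn (zero_lt_one' ℝ) F n‖ ≤ C := by
  rw [fourierCoeffOn_eq_integral]
  simp only [sub_zero, div_one, one_smul]
  refine (intervalIntegral.norm_integral_le_of_norm_le_const (C := C) ?_).trans (by simp)
  intro x hx
  rw [Set.uIoc_of_le zero_le_one] at hx
  rw [norm_smul, fourier_apply, Circle.norm_coe, one_mul]
  exact hF x ⟨hx.1.le, hx.2⟩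

theorem norm_fourierCoeffOn_le_of_hasDerivAt {F F' : ℝ → ℂ} (hF : ∀ x, HasDerivAt F (F' x) x)
    (hF' : Continuous F') (hp : F 1 = F 0) (n : ℤ) :
    |(n : ℝ)| * ‖fourierCoeffOn (zero_lt_one' ℝ) F n‖ ≤
      ‖fourierCoeffOn (zero_lt_one' ℝ) F' n‖ := by
  by_cases hn : n = 0
  · subst hn; simp
  rw [fourierCoeffOn_of_hasDerivAt (zero_lt_one' ℝ) (f := F) (f' := F') hn
      (fun x _ => hF x) (hF'.intervalIntegrable _ _), hp]
  simp only [sub_self, mul_zero, sub_zero, zero_sub, Complex.ofReal_one, Complex.ofReal_zero,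
    one_mul]
  rw [norm_mul, norm_neg, norm_div]
  have hn' : 0 < |(n : ℝ)| := by positivity
  have : ‖-2 * (Real.pi : ℂ) * Complex.I * (n : ℂ)‖ = 2 * Real.pi * |(n : ℝ)| := by
    simp [abs_of_pos Real.pi_pos]
  rw [this, norm_one]
  have h2 : 1 ≤ 2 * Real.pi := by linarith [Real.pi_gt_three]
  calc _ = ‖fourierCoeffOn (zero_lt_one' ℝ) F' n‖ / (2 * Real.pi) := by field_simp
    _ ≤ _ := div_le_self (norm_nonneg _) h2

/-- The Fourier coefficients of `p (ζ - g)^{-j}` decay rapidly, uniformly in `ζ` as long as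
`(ζ - g)⁻¹` is bounded. The induction on the order of decay uses
`(p h^j)' = p' h^j + j p g' h^{j+1}` for `h = (ζ - g)⁻¹`. -/
theorem fourierCoeffOn_mul_inv_pow_decay {g : C(UnitAddCircle, ℂ)} (hg : IsSmooth g)
    (B : ℝ) (M : ℕ) : ∀ (p : ℝ → ℂ) (j : ℕ), ContDiff ℝ ((⊤ : ℕ∞) : WithTop ℕ∞) p →
      Function.Periodic p 1 → ∃ C : ℝ, ∀ (ζ : ℂ) (h : C(UnitAddCircle, ℂ)), ‖h‖ ≤ B →
        (∀ x, h x * (ζ - g x) = 1) → ∀ n : ℤ, |(n : ℝ)| ^ M *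
          ‖fourierCoeffOn (zero_lt_one' ℝ) (fun x => p x * h (x : UnitAddCircle) ^ j) n‖ ≤ C := by
  induction M with
  | zero =>
    intro p j hp _
    obtain ⟨C, hC⟩ := (isCompact_Icc (a := (0 : ℝ)) (b := 1)).exists_bound_of_continuousOn
      hp.continuous.continuousOn
    refine ⟨C * B ^ j, fun ζ h hh _ n => ?_⟩
    rw [pow_zero, one_mul]
    refine norm_fourierCoeffOn_le (fun x hx => ?_) n
    rw [norm_mul, norm_pow]
    have h1 := hC x hx
    have h2 := (h.norm_coe_le_norm x).trans hh
    have h0 : 0 ≤ C := (norm_nonneg _).trans h1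
    gcongr
  | succ M ih =>
    intro p j hp hper
    have hp' : ContDiff ℝ ((⊤ : ℕ∞) : WithTop ℕ∞) (deriv p) := (contDiff_infty_iff_deriv.1 hp).2
    have hg' : ContDiff ℝ ((⊤ : ℕ∞) : WithTop ℕ∞) (deriv fun x : ℝ => g (x : UnitAddCircle)) :=
      (contDiff_infty_iff_deriv.1 hg).2
    have hper' : ∀ q : ℝ → ℂ, Function.Periodic q 1 → Function.Periodic (deriv q) 1 := by
      intro q hq x
      have h : q = fun y => q (y + 1) := funext fun y => (hq y).symm
      conv_rhs => rw [h]
      rw [deriv_comp_add_const]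
    obtain ⟨C, hC⟩ := ih (deriv p) j hp' (hper' p hper)
    obtain ⟨D, hD⟩ := ih (fun x => j * p x * deriv (fun x : ℝ => g (x : UnitAddCircle)) x) (j + 1)
      ((contDiff_const.mul hp).mul hg') (fun x => by
        simp only [hper x, hper' (fun x : ℝ => g (x : UnitAddCircle)) (fun x => by simp) x])
    refine ⟨C + D, fun ζ h hh hgh n => ?_⟩
    have hcont : Continuous fun x : ℝ => h (x : UnitAddCircle) :=
      (map_continuous h).comp (AddCircle.continuous_mk' 1)
    have hh' : ∀ x : ℝ, HasDerivAt (fun x : ℝ => h (x : UnitAddCircle))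
        (deriv (fun x : ℝ => g (x : UnitAddCircle)) x * h (x : UnitAddCircle) ^ 2) x := by
      intro x
      have e : (fun x : ℝ => h (x : UnitAddCircle)) = fun x : ℝ => (ζ - g (x : UnitAddCircle))⁻¹ :=
        funext fun x => eq_inv_of_mul_eq_one_left (hgh x)
      have h0 : ζ - g (x : UnitAddCircle) ≠ 0 := fun h0 => by simpa [h0] using hgh x
      have hd : HasDerivAt (fun x : ℝ => g (x : UnitAddCircle))
        (deriv (fun x : ℝ => g (x : UnitAddCircle)) x) x :=
        (ContDiff.differentiable hg (by simp) x).hasDerivAt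
      have := (hd.const_sub ζ).inv h0
      rw [e, congrFun e x]
      convert! this using 1
      field_simp
    have hF : ∀ x : ℝ, HasDerivAt (fun x : ℝ => p x * h (x : UnitAddCircle) ^ j)
        (deriv p x * h (x : UnitAddCircle) ^ j +
          (j * p x * deriv (fun x : ℝ => g (x : UnitAddCircle)) x) *
            h (x : UnitAddCircle) ^ (j + 1)) x := by
      intro x
      convert! ((hp.differentiable (by simp) x).hasDerivAt).mul ((hh' x).pow j) using 1
      cases j with
      | zero => simp
      | succ j => simp only [Nat.add_sub_cancel, Pi.pow_apply]; push_cast; ring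
    have c1 : Continuous fun x : ℝ => deriv p x * h (x : UnitAddCircle) ^ j :=
      hp'.continuous.mul (hcont.pow j)
    have c2 : Continuous fun x : ℝ => (j * p x * deriv (fun x : ℝ => g (x : UnitAddCircle)) x) *
            h (x : UnitAddCircle) ^ (j + 1) :=
      ((continuous_const.mul hp.continuous).mul hg'.continuous).mul (hcont.pow _)
    have h1 := norm_fourierCoeffOn_le_of_hasDerivAt hF (c1.add c2)
      (by
        have h1 := hper 0
        have h2 : ((1 : ℝ) : UnitAddCircle) = ((0 : ℝ) : UnitAddCircle) := by simp
        rw [zero_add] at h1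
        rw [h1, h2]) n
    rw [fourierCoeffOn_add c1 c2] at h1
    calc _ = |(n : ℝ)| ^ M * (|(n : ℝ)| *
          ‖fourierCoeffOn (zero_lt_one' ℝ) (fun x => p x * h (x : UnitAddCircle) ^ j) n‖) := by ring
      _ ≤ |(n : ℝ)| ^ M * (_ + _) :=
        mul_le_mul_of_nonneg_left (h1.trans (norm_add_le _ _)) (by positivity)
      _ ≤ C + D := by
        rw [mul_add]
        exact add_le_add (hC ζ h hh hgh n) (hD ζ h hh hgh n)

/-- The Fourier coefficients of `(ζ - g)⁻¹` decay rapidly, uniformly in `ζ` as long as `(ζ - g)⁻¹`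
is bounded. -/
theorem fourierCoeff_inv_decay {g : C(UnitAddCircle, ℂ)} (hg : IsSmooth g) (B : ℝ)
    (N : ℕ) : ∃ C : ℝ, ∀ (ζ : ℂ) (h : C(UnitAddCircle, ℂ)), ‖h‖ ≤ B →
        (∀ x, h x * (ζ - g x) = 1) → ∀ n : ℤ, (1 + |(n : ℝ)|) ^ N * ‖fourierCoeff h n‖ ≤ C := by
  obtain ⟨C, hC⟩ := fourierCoeffOn_mul_inv_pow_decay hg B N (fun _ => 1) 1 contDiff_const
    (fun _ => rfl)
  obtain ⟨D, hD⟩ := fourierCoeffOn_mul_inv_pow_decay hg B 0 (fun _ => 1) 1 contDiff_const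
    (fun _ => rfl)
  refine ⟨2 ^ N * (C + D), fun ζ h hh hgh n => ?_⟩
  have h1 := hC ζ h hh hgh n
  have h2 := hD ζ h hh hgh n
  simp only [one_mul, pow_one, pow_zero] at h1 h2
  rw [← fourierCoeff_eq_On] at h1 h2
  have h3 : (1 + |(n : ℝ)|) ^ N ≤ 2 ^ N * (|(n : ℝ)| ^ N + 1) := by
    refine (add_pow_le zero_le_one (abs_nonneg _) N).trans ?_
    rw [one_pow, add_comm]
    gcongr
    · norm_num
    · omega
  calc _ ≤ 2 ^ N * (|(n : ℝ)| ^ N + 1) * ‖fourierCoeff h n‖ := by gcongr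
    _ = 2 ^ N * (|(n : ℝ)| ^ N * ‖fourierCoeff h n‖ + ‖fourierCoeff h n‖) := by ring
    _ ≤ _ := by gcongr

theorem summable_int_inv_sq : Summable (fun m : ℤ => ((1 + |(m : ℝ)|) ^ 2)⁻¹) := by
  refine Summable.of_nat_of_neg ?_ ?_
  · simpa using summable_inv_sq
  · simpa using summable_inv_sq

variable (E : HilbertBasis ℕ ℂ H)

/-- The columns of `a T(e_m) - T(g e_m)`, for `a = T(g) + c`: the column `l` is the column `l + m`
of `c` if `l + m ≥ 0`, and otherwise `|m| > l`. -/
theorem exists_norm_mul_fourier_sub_le (g : C(UnitAddCircle, ℂ)) {c : H →L[ℂ] H}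
    (hc : ColumnsDecay E c) (N : ℕ) : ∃ K : ℝ, 0 ≤ K ∧ ∀ (m : ℤ) (l : ℕ), (1 + l : ℝ) ^ N *
      ‖((toeplitzOp E g + c) * toeplitzOp E (fourier m) - toeplitzOp E (g * fourier m)) (E l)‖ ≤
        K * (1 + |(m : ℝ)|) ^ N := by
  obtain ⟨C, hC⟩ := hc N
  have hC0 : 0 ≤ C := le_trans (by positivity) (hC 0)
  refine ⟨C + ‖g‖, by positivity, fun m l => ?_⟩
  rw [sub_apply, mul_apply_eq_comp]
  have hm0 : 0 ≤ |(m : ℝ)| := abs_nonneg _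
  rcases le_or_gt 0 ((l : ℤ) + m) with h | h
  · obtain ⟨l', hl'⟩ := Int.eq_ofNat_of_zero_le h
    rw [toeplitzOp_fourier_apply E hl', toeplitzOp_mul_fourier_apply E g hl', add_apply,
      add_sub_cancel_left]
    have h1 : (l : ℝ) = l' - m := by
      have := congrArg (Int.cast (R := ℝ)) hl'
      push_cast at this
      linarith
    have h2 : (1 + l : ℝ) ≤ (1 + l') * (1 + |(m : ℝ)|) := by
      have := neg_abs_le (m : ℝ)
      have : 0 ≤ (l' : ℝ) * |(m : ℝ)| := by positivity
      linarith
    calc (1 + l : ℝ) ^ N * ‖c (E l')‖ ≤ ((1 + l') * (1 + |(m : ℝ)|)) ^ N * ‖c (E l')‖ := by gcongr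
      _ = (1 + l' : ℝ) ^ N * ‖c (E l')‖ * (1 + |(m : ℝ)|) ^ N := by rw [mul_pow]; ring
      _ ≤ (C + ‖g‖) * (1 + |(m : ℝ)|) ^ N := by
        gcongr
        linarith [hC l', norm_nonneg g]
  · rw [toeplitzOp_fourier_apply_of_neg E h, map_zero, zero_sub, norm_neg]
    have h1 : ‖toeplitzOp E (g * fourier m) (E l)‖ ≤ ‖g‖ := by
      refine (ContinuousLinearMap.le_opNorm _ _).trans ?_
      rw [E.orthonormal.1 l, mul_one]
      refine (norm_toeplitzOp_le E _).trans ((norm_mul_le _ _).trans ?_)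
      rw [fourier_norm, mul_one]
    have h2 : (1 + l : ℝ) ≤ 1 + |(m : ℝ)| := by
      have h3 : ((l : ℤ) : ℝ) + m < 0 := by exact_mod_cast h
      push_cast at h3
      linarith [neg_abs_le (m : ℝ)]
    calc _ ≤ (1 + |(m : ℝ)|) ^ N * ‖g‖ := by gcongr
      _ ≤ (C + ‖g‖) * (1 + |(m : ℝ)|) ^ N := by
        rw [mul_comm]; gcongr; linarith

/-- Let `a = T(g) + c`, where the columns of `c` decay rapidly, and `h = (ζ - g)⁻¹`. The columns of
`(ζ - a)⁻¹ - T(h)` decay rapidly, with bounds in terms of those of `(ζ - a)⁻¹` and `h`. The reason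
is that `1 - (ζ - a) T(h) = ∑ ĥ(m) (a T(e_m) - T(g e_m))`. -/
theorem exists_resolvent_columns_le (g : C(UnitAddCircle, ℂ)) {c : H →L[ℂ] H}
    (hc : ColumnsDecay E c) (N : ℕ) : ∃ K : ℝ, 0 ≤ K ∧
      ∀ (ζ : ℂ) (h : C(UnitAddCircle, ℂ)) (R : H →L[ℂ] H) (D : ℝ), (∀ x, h x * (ζ - g x) = 1) →
        R * (algebraMap ℂ _ ζ - (toeplitzOp E g + c)) = 1 →
        (∀ m : ℤ, (1 + |(m : ℝ)|) ^ (N + 2) * ‖fourierCoeff h m‖ ≤ D) →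
        ∀ l : ℕ, (1 + l : ℝ) ^ N * ‖(R - toeplitzOp E h) (E l)‖ ≤ ‖R‖ * (D * K) := by
  obtain ⟨K, hK0, hK⟩ := exists_norm_mul_fourier_sub_le E g hc N
  have hs0 : 0 ≤ ∑' m : ℤ, ((1 + |(m : ℝ)|) ^ 2)⁻¹ := tsum_nonneg fun m => by positivity
  refine ⟨K * ∑' m : ℤ, ((1 + |(m : ℝ)|) ^ 2)⁻¹, by positivity, fun ζ h R D hgh hR hD l => ?_⟩
  have hsum : Summable (fourierCoeff h) := by
    refine Summable.of_norm_bounded (summable_int_inv_sq.mul_left D) fun m => ?_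
    rw [← div_eq_mul_inv, le_div_iff₀ (by positivity), mul_comm]
    refine le_trans ?_ (hD m)
    gcongr
    · linarith [abs_nonneg (m : ℝ)]
    · omega
  set a := toeplitzOp E g + c with ha
  have h1 := hasSum_fourier_series_of_summable hsum
  have h2 := (toeplitzCLM E).hasSum h1
  have h3 := (toeplitzCLM E).hasSum (h1.mul_left g)
  have h4 := (h2.mul_left a).sub h3
  have e1 : a * toeplitzCLM E h - toeplitzCLM E (g * h) =
      1 - (algebraMap ℂ _ ζ - a) * toeplitzOp E h := by
    change a * toeplitzOp E h - toeplitzOp E (g * h) = _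
    have : (1 : C(UnitAddCircle, ℂ)) = ζ • h - g * h := by
      ext x
      have := hgh x
      simp only [ContinuousMap.one_apply, ContinuousMap.sub_apply, ContinuousMap.smul_apply,
        ContinuousMap.mul_apply, smul_eq_mul]
      rw [← this]; ring
    have e : (1 : H →L[ℂ] H) = ζ • toeplitzOp E h - toeplitzOp E (g * h) := by
      rw [← toeplitzOp_one E, this]
      exact map_sub (toeplitzCLM E) (ζ • h) (g * h) |>.trans (by
        rw [map_smul]; rfl)
    rw [e, sub_mul, Algebra.algebraMap_eq_smul_one, smul_mul_assoc, one_mul]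
    abel
  rw [e1] at h4
  have h5 := (ContinuousLinearMap.apply ℂ H (E l)).hasSum h4
  have h6 : (1 + l : ℝ) ^ N * ‖(1 - (algebraMap ℂ _ ζ - a) * toeplitzOp E h) (E l)‖ ≤
      D * (K * ∑' m : ℤ, ((1 + |(m : ℝ)|) ^ 2)⁻¹) := by
    have h7 := h5.const_smul (((1 + l : ℝ) ^ N : ℝ) : ℂ)
    have hn : ∀ y : H, ‖(((1 + l : ℝ) ^ N : ℝ) : ℂ) • y‖ = (1 + l : ℝ) ^ N * ‖y‖ := fun y => by
      rw [norm_smul, Complex.norm_real, Real.norm_of_nonneg (by positivity)]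
    have h8 := (hn _).symm.trans (congrArg norm h7.tsum_eq.symm)
    refine h8.le.trans ?_
    rw [← mul_assoc, ← tsum_mul_left]
    refine tsum_of_norm_bounded (summable_int_inv_sq.mul_left _).hasSum fun m => ?_
    rw [hn]
    have e2 : (ContinuousLinearMap.apply ℂ H (E l))
        (a * (toeplitzCLM E (fourierCoeff h m • fourier m)) -
          toeplitzCLM E (g * fourierCoeff h m • fourier m)) = fourierCoeff h m •
        ((a * toeplitzOp E (fourier m) - toeplitzOp E (g * fourier m)) (E l)) := by
      rw [mul_smul_comm, map_smul, map_smul, mul_smul_comm, ← smul_sub, map_smul]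
      rfl
    refine (congrArg (fun y : H => (1 + l : ℝ) ^ N * ‖y‖) e2).le.trans ?_
    simp only [norm_smul]
    rw [← div_eq_mul_inv, le_div_iff₀ (by positivity)]
    calc _ = ‖fourierCoeff h m‖ * (1 + |(m : ℝ)|) ^ 2 * ((1 + l : ℝ) ^ N *
          ‖(a * toeplitzOp E (fourier m) - toeplitzOp E (g * fourier m)) (E l)‖) := by ring
      _ ≤ ‖fourierCoeff h m‖ * (1 + |(m : ℝ)|) ^ 2 * (K * (1 + |(m : ℝ)|) ^ N) := by
          exact mul_le_mul_of_nonneg_left (hK m l) (by positivity)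
      _ = (1 + |(m : ℝ)|) ^ (N + 2) * ‖fourierCoeff h m‖ * K := by ring
      _ ≤ D * K := by gcongr; exact hD m
  have e3 : R - toeplitzOp E h = R * (1 - (algebraMap ℂ _ ζ - a) * toeplitzOp E h) := by
    rw [mul_sub, mul_one, ← mul_assoc, hR, one_mul]
  rw [e3, mul_apply_eq_comp]
  calc _ ≤ (1 + l : ℝ) ^ N *
        (‖R‖ * ‖(1 - (algebraMap ℂ _ ζ - a) * toeplitzOp E h) (E l)‖) := by
        gcongr; exact R.le_opNorm _
    _ = ‖R‖ * ((1 + l : ℝ) ^ N * ‖(1 - (algebraMap ℂ _ ζ - a) * toeplitzOp E h) (E l)‖) := by ring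
    _ ≤ _ := by gcongr

/-- For `a = T(g) + c` in the smooth Toeplitz algebra, the matrix of `(ζ - a)⁻¹ - T((ζ - g)⁻¹)`
decays rapidly, uniformly in `ζ` as long as `(ζ - a)⁻¹` and `(ζ - g)⁻¹` are bounded. -/
theorem resolvent_sub_decay {g : C(UnitAddCircle, ℂ)} (hg : IsSmooth g) {c : H →L[ℂ] H}
    (hc : IsSmoothCompact E c) (B : ℝ) (M N : ℕ) : ∃ C : ℝ, ∀ (ζ : ℂ)
      (h : C(UnitAddCircle, ℂ)) (R : H →L[ℂ] H), ‖h‖ ≤ B → ‖R‖ ≤ B → (∀ x, h x * (ζ - g x) = 1) →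
        R * (algebraMap ℂ _ ζ - (toeplitzOp E g + c)) = 1 →
        (algebraMap ℂ _ ζ - (toeplitzOp E g + c)) * R = 1 →
        ∀ k l : ℕ, (1 + k : ℝ) ^ M * (1 + l : ℝ) ^ N * ‖coeff E (R - toeplitzOp E h) k l‖ ≤ C := by
  rcases lt_or_ge B 0 with hB | hB
  · exact ⟨0, fun ζ h R hh => absurd ((norm_nonneg h).trans hh) (not_le.2 hB)⟩
  obtain ⟨D, hD⟩ := fourierCoeff_inv_decay hg B (N * 2 + 2)
  obtain ⟨D', hD'⟩ := fourierCoeff_inv_decay hg B (M * 2 + 2)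
  obtain ⟨K, hK0, hK⟩ := exists_resolvent_columns_le E g hc.columnsDecay (N * 2)
  obtain ⟨K', hK0', hK'⟩ := exists_resolvent_columns_le E (star g) hc.adjoint.columnsDecay (M * 2)
  refine ⟨max (B * (D' * K')) (B * (D * K)), fun ζ h R hh hRB hgh hR hR' k l => ?_⟩
  have hD0 : 0 ≤ D := le_trans (by positivity) (hD ζ h hh hgh 0)
  have hD0' : 0 ≤ D' := le_trans (by positivity) (hD' ζ h hh hgh 0)
  refine mul_mul_le_max (by positivity) (by positivity) (norm_nonneg _) ?_ ?_
  · have h1 := hK' (star ζ) (star h) R.adjoint D' (fun x => by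
      have := congrArg star (hgh x)
      simpa using this) (by
      have := congrArg star hR'
      rwa [star_mul, star_one, star_sub, star_add, ← algebraMap_star_comm,
        ContinuousLinearMap.star_eq_adjoint, ContinuousLinearMap.star_eq_adjoint,
        ContinuousLinearMap.star_eq_adjoint, toeplitzOp_adjoint] at this) (fun m => by
      rw [fourierCoeff_star, RCLike.norm_conj]
      have := hD' ζ h hh hgh (-m)
      rwa [Int.cast_neg, abs_neg] at this) k
    rw [← pow_mul, ← RCLike.norm_conj, ← coeff_adjoint]
    calc _ ≤ (1 + k : ℝ) ^ (M * 2) * ‖(R - toeplitzOp E h).adjoint (E k)‖ := by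
          gcongr; exact norm_coeff_le E _ _ _
      _ ≤ ‖R.adjoint‖ * (D' * K') := by
          rw [map_sub, toeplitzOp_adjoint]; exact h1
      _ ≤ _ := by rw [LinearIsometryEquiv.norm_map]; gcongr
  · rw [← pow_mul]
    calc _ ≤ (1 + l : ℝ) ^ (N * 2) * ‖(R - toeplitzOp E h) (E l)‖ := by
          gcongr; exact norm_coeff_le E _ _ _
      _ ≤ ‖R‖ * (D * K) := hK ζ h R D hgh hR (hD ζ h hh hgh) l
      _ ≤ _ := by gcongr

variable {E}

/-- The inverse of an invertible `T(f) + c` is `T(1/f) + b`, with `b` smooth compact. -/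
theorem exists_inverse_decomp {f : C(UnitAddCircle, ℂ)} {c : H →L[ℂ] H} (hf : IsSmooth f)
    (hc : IsSmoothCompact E c) (hu : IsUnit (toeplitzOp E f + c)) :
    ∃ (g : C(UnitAddCircle, ℂ)) (b : H →L[ℂ] H),
      (∀ x, f x ≠ 0 ∧ g x = 1 / f x) ∧ IsSmooth g ∧ IsSmoothCompact E b ∧
        Ring.inverse (toeplitzOp E f + c) = toeplitzOp E g + b := by
  have hf0 := symbol_ne_zero hc hu
  let g : C(UnitAddCircle, ℂ) := ⟨fun x => (f x)⁻¹, (map_continuous f).inv₀ hf0⟩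
  have hgf : ∀ x, g x * f x = 1 := fun x => inv_mul_cancel₀ (hf0 x)
  refine ⟨g, Ring.inverse (toeplitzOp E f + c) - toeplitzOp E g,
    fun x => ⟨hf0 x, (one_div _).symm⟩, hf.of_mul_eq_one hgf, fun M N => ?_, by abel⟩
  have hR := Ring.inverse_mul_cancel _ hu
  have hR' := Ring.mul_inverse_cancel _ hu
  set R := Ring.inverse (toeplitzOp E f + c)
  -- the resolvent at `0` of `-(T(f) + c)`
  obtain ⟨C, hC⟩ := resolvent_sub_decay E (hf.smul (-1)) (hc.smul (-1)) (max ‖g‖ ‖R‖) M N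
  have e : algebraMap ℂ (H →L[ℂ] H) 0 - (toeplitzOp E ((-1 : ℂ) • f) + (-1 : ℂ) • c) =
      toeplitzOp E f + c := by
    rw [toeplitzOp_smul, map_zero]; simp [add_comm]
  exact ⟨C, hC 0 g R (le_max_left _ _) (le_max_right _ _) (fun x => by simpa using hgf x)
    (by rw [e]; exact hR) (by rw [e]; exact hR')⟩

end Resolvent

/-! ### Contour integrals -/

section ContourIntegrals
variable {A : Type*} [NormedAddCommGroup A] [NormedSpace ℂ A]

namespace Contour
variable (Γ : Contour)

theorem continuousOn_derivWithin (i : Fin Γ.n) :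
    ContinuousOn (derivWithin (Γ.arc i) (Set.Icc 0 1)) (Set.Icc 0 1) :=
  (Γ.contDiffOn i).continuousOn_derivWithin (uniqueDiffOn_Icc zero_lt_one) le_rfl

theorem arc_mem_image (i : Fin Γ.n) {t : ℝ} (ht : t ∈ Set.Icc (0 : ℝ) 1) :
    Γ.arc i t ∈ Γ.image :=
  Set.mem_iUnion.2 ⟨i, t, ht, rfl⟩

theorem isCompact_image : IsCompact Γ.image :=
  isCompact_iUnion fun i => isCompact_Icc.image_of_continuousOn (Γ.contDiffOn i).continuousOn

variable {Γ}

theorem continuousOn_integrand {F : ℂ → A} (hF : ContinuousOn F Γ.image) (i : Fin Γ.n) :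
    ContinuousOn (fun t => derivWithin (Γ.arc i) (Set.Icc 0 1) t • F (Γ.arc i t))
      (Set.Icc 0 1) :=
  (Γ.continuousOn_derivWithin i).smul
    (hF.comp (Γ.contDiffOn i).continuousOn fun _ ht => Γ.arc_mem_image i ht)

theorem intervalIntegrable_integrand {F : ℂ → A} (hF : ContinuousOn F Γ.image) (i : Fin Γ.n) :
    IntervalIntegrable (fun t => derivWithin (Γ.arc i) (Set.Icc 0 1) t • F (Γ.arc i t))
      volume 0 1 := by
  refine ContinuousOn.intervalIntegrable ?_
  rw [Set.uIcc_of_le zero_le_one]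
  exact continuousOn_integrand hF i

theorem integral_sub {F G : ℂ → A} (hF : ContinuousOn F Γ.image) (hG : ContinuousOn G Γ.image) :
    Γ.integral (fun ζ => F ζ - G ζ) = Γ.integral F - Γ.integral G := by
  rw [integral, integral, integral, ← Finset.sum_sub_distrib]
  refine Finset.sum_congr rfl fun i _ => ?_
  rw [← intervalIntegral.integral_sub (intervalIntegrable_integrand hF i)
    (intervalIntegrable_integrand hG i)]
  simp only [smul_sub]

theorem map_integral {A' : Type*} [NormedAddCommGroup A'] [NormedSpace ℂ A'] [CompleteSpace A]
    [CompleteSpace A'] (L : A →L[ℂ] A') {F : ℂ → A} (hF : ContinuousOn F Γ.image) :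
    L (Γ.integral F) = Γ.integral fun ζ => L (F ζ) := by
  rw [integral, integral, map_sum]
  refine Finset.sum_congr rfl fun i _ => ?_
  rw [← L.intervalIntegral_comp_comm (intervalIntegrable_integrand hF i)]
  simp only [map_smul]

variable (Γ) in
theorem exists_norm_integral_le : ∃ K : ℝ, 0 ≤ K ∧ ∀ (F : ℂ → A) (C : ℝ),
    (∀ ζ ∈ Γ.image, ‖F ζ‖ ≤ C) → ‖Γ.integral F‖ ≤ K * C := by
  choose B hB using fun i => isCompact_Icc.exists_bound_of_continuousOn
    (Γ.continuousOn_derivWithin i)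
  have hB0 : ∀ i, 0 ≤ B i := fun i => (norm_nonneg _).trans (hB i 0 (by simp))
  refine ⟨∑ i, B i, Finset.sum_nonneg fun i _ => hB0 i, fun F C hC => ?_⟩
  rw [integral, Finset.sum_mul]
  refine (norm_sum_le _ _).trans (Finset.sum_le_sum fun i _ => ?_)
  refine (intervalIntegral.norm_integral_le_of_norm_le_const (C := B i * C) fun t ht => ?_).trans
    (by simp)
  rw [Set.uIoc_of_le zero_le_one] at ht
  have ht' : t ∈ Set.Icc (0 : ℝ) 1 := ⟨ht.1.le, ht.2⟩
  rw [norm_smul]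
  exact mul_le_mul (hB i t ht') (hC _ (Γ.arc_mem_image i ht')) (norm_nonneg _) (hB0 i)

theorem integral_congr {F G : ℂ → A} (h : ∀ ζ ∈ Γ.image, F ζ = G ζ) :
    Γ.integral F = Γ.integral G := by
  refine Finset.sum_congr rfl fun i _ => intervalIntegral.integral_congr fun t ht => ?_
  rw [Set.uIcc_of_le zero_le_one] at ht
  simp only [h _ (Γ.arc_mem_image i ht)]

/-- The Cauchy transform of a continuous density on a contour is holomorphic off the contour. -/
theorem differentiableAt_integral_mul_inv {φ : ℂ → ℂ} (hφ : ContinuousOn φ Γ.image) {w : ℂ}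
    (hw : w ∉ Γ.image) :
    DifferentiableAt ℂ (fun w => Γ.integral fun ζ => φ ζ * (ζ - w)⁻¹) w := by
  obtain ⟨r, hr, hrw⟩ := Metric.isOpen_iff.1 Γ.isCompact_image.isClosed.isOpen_compl w hw
  have hdist : ∀ v ∈ Metric.ball w (r / 2), ∀ ζ ∈ Γ.image, r / 2 ≤ ‖ζ - v‖ := by
    intro v hv ζ hζ
    have h1 : r ≤ dist ζ w := not_lt.1 fun h => hrw h hζ
    have h2 := dist_triangle ζ v w
    rw [Metric.mem_ball] at hv
    rw [← dist_eq_norm]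
    linarith
  have hne : ∀ v ∈ Metric.ball w (r / 2), ∀ ζ ∈ Γ.image, ζ - v ≠ 0 := by
    intro v hv ζ hζ h0
    have := hdist v hv ζ hζ
    rw [h0, norm_zero] at this
    linarith
  have hcont : ∀ v ∈ Metric.ball w (r / 2), ContinuousOn (fun ζ => φ ζ * (ζ - v)⁻¹) Γ.image :=
    fun v hv => hφ.mul ((continuousOn_id.sub continuousOn_const).inv₀ (hne v hv))
  have hmem := Metric.ball_mem_nhds w (half_pos hr)
  obtain ⟨C, hC⟩ := Γ.isCompact_image.exists_bound_of_continuousOn hφ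
  refine DifferentiableAt.fun_sum fun i _ => ?_
  obtain ⟨B, hB⟩ := isCompact_Icc.exists_bound_of_continuousOn (Γ.continuousOn_derivWithin i)
  have hw' := Metric.mem_ball_self (x := w) (half_pos hr)
  have h2 : ContinuousOn (fun ζ => φ ζ * ((ζ - w)⁻¹) ^ 2) Γ.image :=
    hφ.mul (((continuousOn_id.sub continuousOn_const).inv₀ (hne w hw')).pow 2)
  refine (intervalIntegral.hasDerivAt_integral_of_dominated_loc_of_deriv_le
    (s := Metric.ball w (r / 2))
    (F' := fun v t => derivWithin (Γ.arc i) (Set.Icc 0 1) t •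
      (φ (Γ.arc i t) * ((Γ.arc i t - v)⁻¹) ^ 2)) (bound := fun _ => B * (C * ((r / 2)⁻¹) ^ 2))
    hmem ?_ (intervalIntegrable_integrand (hcont w hw') i)
    (intervalIntegrable_iff.1 (intervalIntegrable_integrand h2 i)).aestronglyMeasurable ?_
    intervalIntegrable_const ?_).2.differentiableAt
  · filter_upwards [hmem] with v hv
    exact (intervalIntegrable_iff.1
      (intervalIntegrable_integrand (hcont v hv) i)).aestronglyMeasurable
  · refine ae_of_all _ fun t ht v hv => ?_
    rw [Set.uIoc_of_le zero_le_one] at ht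
    have ht' : t ∈ Set.Icc (0 : ℝ) 1 := ⟨ht.1.le, ht.2⟩
    have h1 := hB t ht'
    have h3 := hC _ (Γ.arc_mem_image i ht')
    have h4 := hdist v hv _ (Γ.arc_mem_image i ht')
    have hB0 := (norm_nonneg _).trans h1
    have hC0 := (norm_nonneg _).trans h3
    rw [norm_smul, norm_mul, norm_pow, norm_inv]
    gcongr
  · refine ae_of_all _ fun t ht v hv => ?_
    rw [Set.uIoc_of_le zero_le_one] at ht
    have h0 := hne v hv _ (Γ.arc_mem_image i ⟨ht.1.le, ht.2⟩)
    have h1 := (((hasDerivAt_id v).const_sub (Γ.arc i t)).inv h0).const_mul (φ (Γ.arc i t))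
    have h3 := h1.const_smul (derivWithin (Γ.arc i) (Set.Icc 0 1) t)
    convert! h3 using 1
    simp [div_eq_mul_inv]

theorem continuousAt_index {z : ℂ} (hz : z ∉ Γ.image) : ContinuousAt Γ.index z := by
  have := (differentiableAt_integral_mul_inv (φ := fun _ => 1) continuousOn_const hz).continuousAt
  simp only [one_mul] at this
  exact continuousAt_const.mul this

end Contour

/-- The integral of `(ζ - z)⁻¹` along the segment from `s` to `e`. -/
def segIntegral (z s e : ℂ) : ℂ := ∫ t in (0 : ℝ)..1, (e - s) * (s + t * (e - s) - z)⁻¹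

theorem segIntegral_reverse (z s e : ℂ) : segIntegral z e s = -segIntegral z s e := by
  unfold segIntegral
  rw [← intervalIntegral.integral_neg]
  have := intervalIntegral.integral_comp_sub_left (a := (0 : ℝ)) (b := 1)
    (fun t : ℝ => (s - e) * (e + t * (s - e) - z)⁻¹) 1
  rw [sub_self, sub_zero] at this
  rw [← this]
  refine intervalIntegral.integral_congr fun t _ => ?_
  push_cast
  rw [← neg_mul, neg_sub]
  congr 2
  ring

/-- When multiplication by `c` moves the segment, seen from `z`, into the right half plane, the
principal logarithm of `c (ζ - z)` is an antiderivative of `(ζ - z)⁻¹` along it. -/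
theorem segIntegral_eq_log_sub_log {z s e c : ℂ} (hs : 0 < (c * (s - z)).re)
    (he : 0 < (c * (e - z)).re) :
    segIntegral z s e = Complex.log (c * (e - z)) - Complex.log (c * (s - z)) := by
  have hc : c ≠ 0 := by rintro rfl; simp at hs
  have hre : ∀ t ∈ Set.uIcc (0 : ℝ) 1, 0 < (c * (s + t * (e - s) - z)).re := by
    intro t ht
    rw [Set.uIcc_of_le zero_le_one] at ht
    have e1 : c * (s + t * (e - s) - z) = ((1 - t : ℝ) : ℂ) * (c * (s - z)) + t * (c * (e - z)) := by
      push_cast; ring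
    rw [e1, Complex.add_re, Complex.re_ofReal_mul, Complex.re_ofReal_mul]
    rcases eq_or_lt_of_le ht.1 with h | h
    · subst h; simpa using hs
    · exact add_pos_of_nonneg_of_pos (mul_nonneg (by linarith [ht.2]) hs.le) (mul_pos h he)
  have hne : ∀ t ∈ Set.uIcc (0 : ℝ) 1, s + t * (e - s) - z ≠ 0 := fun t ht h0 => by
    have := hre t ht
    simp [h0] at this
  have hd : ∀ t ∈ Set.uIcc (0 : ℝ) 1, HasDerivAt
      (fun t : ℝ => Complex.log (c * (s + t * (e - s) - z)))
      ((e - s) * (s + t * (e - s) - z)⁻¹) t := by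
    intro t ht
    have h1 : HasDerivAt (fun t : ℝ => c * (s + t * (e - s) - z)) (c * (1 * (e - s))) t :=
      ((((Complex.ofRealCLM.hasDerivAt (x := t)).mul_const (e - s)).const_add s).sub_const
        z).const_mul c
    convert! h1.clog_real (Or.inl (hre t ht)) using 1
    field_simp [hne t ht]
  have := intervalIntegral.integral_eq_sub_of_hasDerivAt hd (ContinuousOn.intervalIntegrable
    (continuousOn_const.mul (ContinuousOn.inv₀ (by fun_prop) hne)))
  rw [segIntegral, this]
  simp

theorem log_sub_log_neg_I_mul {w : ℂ} (h1 : 0 < w.re) (h2 : 0 < w.im) :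
    Complex.log w - Complex.log (-Complex.I * w) = Real.pi / 2 * Complex.I := by
  have h3 : 0 < (-Complex.I * w).re := by simpa using h2
  have h0 : -Complex.I * w ≠ 0 := fun h => by simp [h] at h3
  have h4 := abs_lt.1 (Complex.abs_arg_lt_pi_div_two_iff.2 (Or.inl h3))
  have h5 := abs_lt.1 (Complex.abs_arg_lt_pi_div_two_iff.2 (Or.inl h1))
  have e : w = Complex.I * (-Complex.I * w) := by
    rw [← mul_assoc, mul_neg, Complex.I_mul_I]; ring
  have h6 : Complex.log (Complex.I * (-Complex.I * w)) =
      Complex.log Complex.I + Complex.log (-Complex.I * w) := by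
    refine Complex.log_mul Complex.I_ne_zero h0 ?_
    rw [Complex.arg_I]
    exact ⟨by linarith [h4.1, Real.pi_pos], by linarith [h4.2]⟩
  rw [← e, Complex.log_I] at h6
  rw [h6]; ring

/-! ### Grid contours -/

/-- The vertices of the unit square, in counterclockwise order. -/
def vertexOffset : Fin 4 → ℤ × ℤ := ![(0, 0), (1, 0), (1, 1), (0, 1)]

/-- The direction of the square adjacent along the edge from the vertex `d` to `d + 1`, where
`3 + 1 = 0`. -/
def edgeNormal : Fin 4 → ℤ × ℤ := ![(0, -1), (1, 0), (0, 1), (-1, 0)]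

/-- The point of the grid of mesh `δ` with integer coordinates `q`. -/
def gridPoint (δ : ℝ) (q : ℤ × ℤ) : ℂ := ⟨q.1 * δ, q.2 * δ⟩

/-- The vertex number `d` of the square with lower left corner `q`. -/
def gridVertex (δ : ℝ) (q : ℤ × ℤ) (d : Fin 4) : ℂ := gridPoint δ (q + vertexOffset d)

/-- The closed square with lower left corner `q`. -/
def closedCell (δ : ℝ) (q : ℤ × ℤ) : Set ℂ :=
  Set.Icc (q.1 * δ) ((q.1 + 1) * δ) ×ℂ Set.Icc (q.2 * δ) ((q.2 + 1) * δ)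

/-- The open square with lower left corner `q`. -/
def openCell (δ : ℝ) (q : ℤ × ℤ) : Set ℂ :=
  Set.Ioo (q.1 * δ) ((q.1 + 1) * δ) ×ℂ Set.Ioo (q.2 * δ) ((q.2 + 1) * δ)

/-- The same edge with the opposite orientation, as an edge of the adjacent square. -/
def oppositeEdge (e : (ℤ × ℤ) × Fin 4) : (ℤ × ℤ) × Fin 4 := (e.1 + edgeNormal e.2, e.2 + 2)

theorem oppositeEdge_oppositeEdge (e : (ℤ × ℤ) × Fin 4) : oppositeEdge (oppositeEdge e) = e := by
  obtain ⟨q, d⟩ := e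
  have h1 : edgeNormal d + edgeNormal (d + 2) = 0 := by revert d; decide
  have h2 : d + 2 + 2 = d := by revert d; decide
  simp only [oppositeEdge, add_assoc q, h1, h2, add_zero]

theorem gridVertex_oppositeEdge (δ : ℝ) (e : (ℤ × ℤ) × Fin 4) :
    gridVertex δ (oppositeEdge e).1 (oppositeEdge e).2 = gridVertex δ e.1 (e.2 + 1) := by
  obtain ⟨q, d⟩ := e
  have h1 : edgeNormal d + vertexOffset (d + 2) = vertexOffset (d + 1) := by revert d; decide
  simp only [oppositeEdge, gridVertex, add_assoc q, h1]

theorem gridVertex_oppositeEdge' (δ : ℝ) (e : (ℤ × ℤ) × Fin 4) :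
    gridVertex δ (oppositeEdge e).1 ((oppositeEdge e).2 + 1) = gridVertex δ e.1 e.2 := by
  rw [← gridVertex_oppositeEdge, oppositeEdge_oppositeEdge]

/-- The edges of squares in `S` which are not edges of two squares in `S`. -/
def boundaryEdges (S : Finset (ℤ × ℤ)) : Finset ((ℤ × ℤ) × Fin 4) :=
  (S ×ˢ Finset.univ).filter fun e => (oppositeEdge e).1 ∉ S

/-- Edges of two adjacent squares cancel. -/
theorem sum_boundaryEdges {G : Type*} [AddCommGroup G] (S : Finset (ℤ × ℤ))
    (w : (ℤ × ℤ) × Fin 4 → G) (hw : ∀ e, w (oppositeEdge e) = -w e) :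
    ∑ e ∈ boundaryEdges S, w e = ∑ q ∈ S, ∑ d, w (q, d) := by
  rw [← Finset.sum_product', ← Finset.sum_filter_add_sum_filter_not (S ×ˢ Finset.univ)
    (fun e => (oppositeEdge e).1 ∉ S), boundaryEdges, left_eq_add]
  refine Finset.sum_involution (fun e _ => oppositeEdge e) (fun e _ => by rw [hw, add_neg_cancel])
    (fun e _ _ h => ?_) (fun e he => ?_) (fun e _ => oppositeEdge_oppositeEdge e)
  · have : ∀ d : Fin 4, d + 2 ≠ d := by decide
    exact this e.2 (congrArg Prod.snd h)
  · simp only [Finset.mem_filter, Finset.mem_product, Finset.mem_univ, and_true, not_not,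
      oppositeEdge_oppositeEdge] at he ⊢
    exact he.symm

/-- The boundary of a union of squares of the grid, as a contour. -/
def gridContour (δ : ℝ) (S : Finset (ℤ × ℤ)) : Contour where
  n := (boundaryEdges S).card
  arc i t :=
    let e := ((boundaryEdges S).equivFin.symm i).1
    gridVertex δ e.1 e.2 + t * (gridVertex δ e.1 (e.2 + 1) - gridVertex δ e.1 e.2)
  contDiffOn i := by
    have : ContDiff ℝ 1 (fun x : ℝ => (x : ℂ)) := Complex.ofRealCLM.contDiff
    exact ContDiff.contDiffOn (by fun_prop)
  closed := by
    classical
    ext z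
    -- the number of edges starting at `z` minus that of edges ending at `z`
    let w : (ℤ × ℤ) × Fin 4 → ℤ := fun e =>
      (if z = gridVertex δ e.1 e.2 then 1 else 0) - if z = gridVertex δ e.1 (e.2 + 1) then 1 else 0
    have h := sum_boundaryEdges S w fun e => by
      simp only [w]
      rw [gridVertex_oppositeEdge, gridVertex_oppositeEdge']
      ring
    have h0 : ∀ q, ∑ d, w (q, d) = 0 := fun q => by
      simp only [w, Finset.sum_sub_distrib]
      rw [sub_eq_zero]
      exact (Equiv.sum_comp (Equiv.addRight (1 : Fin 4)) fun d =>
        if z = gridVertex δ q d then (1 : ℤ) else 0).symm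
    simp only [h0, Finset.sum_const_zero] at h
    simp only [w, Finset.sum_sub_distrib, sub_eq_zero] at h
    rw [← Finset.sum_coe_sort, ← Finset.sum_coe_sort (boundaryEdges S)] at h
    rw [← (boundaryEdges S).equivFin.symm.sum_comp, ← (boundaryEdges S).equivFin.symm.sum_comp] at h
    simp only [Complex.ofReal_zero, zero_mul, add_zero, Complex.ofReal_one, one_mul,
      add_sub_cancel]
    rw [Multiset.count_map, Multiset.count_map, ← Finset.filter_val, ← Finset.filter_val,
      Finset.card_val, Finset.card_val, Finset.card_filter, Finset.card_filter]
    exact_mod_cast h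

theorem gridContour_integral_inv (δ : ℝ) (S : Finset (ℤ × ℤ)) (z : ℂ) :
    (gridContour δ S).integral (fun ζ => (ζ - z)⁻¹) =
      ∑ q ∈ S, ∑ d, segIntegral z (gridVertex δ q d) (gridVertex δ q (d + 1)) := by
  rw [← sum_boundaryEdges S
    (fun e => segIntegral z (gridVertex δ e.1 e.2) (gridVertex δ e.1 (e.2 + 1))) fun e => by
      rw [gridVertex_oppositeEdge, gridVertex_oppositeEdge', segIntegral_reverse],
    ← Finset.sum_coe_sort, ← (boundaryEdges S).equivFin.symm.sum_comp]
  refine Finset.sum_congr rfl fun i _ => intervalIntegral.integral_congr fun t ht => ?_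
  rw [Set.uIcc_of_le zero_le_one] at ht
  set e := ((boundaryEdges S).equivFin.symm i).1
  have hd : HasDerivAt ((gridContour δ S).arc i)
      (1 * (gridVertex δ e.1 (e.2 + 1) - gridVertex δ e.1 e.2)) t :=
    ((Complex.ofRealCLM.hasDerivAt (x := t)).mul_const _).const_add _
  simp only
  rw [hd.hasDerivWithinAt.derivWithin (uniqueDiffOn_Icc zero_lt_one t ht), one_mul, smul_eq_mul]
  rfl

theorem gridVertex_re_im (δ : ℝ) (q : ℤ × ℤ) :
    ((gridVertex δ q 0).re = q.1 * δ ∧ (gridVertex δ q 0).im = q.2 * δ) ∧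
    ((gridVertex δ q 1).re = (q.1 + 1) * δ ∧ (gridVertex δ q 1).im = q.2 * δ) ∧
    ((gridVertex δ q 2).re = (q.1 + 1) * δ ∧ (gridVertex δ q 2).im = (q.2 + 1) * δ) ∧
    ((gridVertex δ q 3).re = q.1 * δ ∧ (gridVertex δ q 3).im = (q.2 + 1) * δ) := by
  simp [gridVertex, gridPoint, vertexOffset]

/-- A point outside a square is separated from it by a line parallel to a side, so one branch of
the logarithm serves all four edges. -/
theorem sum_segIntegral_eq_zero {δ : ℝ} (hδ : 0 < δ) {q : ℤ × ℤ} {z : ℂ}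
    (hz : z ∉ closedCell δ q) :
    ∑ d, segIntegral z (gridVertex δ q d) (gridVertex δ q (d + 1)) = 0 := by
  obtain ⟨⟨r0, i0⟩, ⟨r1, i1⟩, ⟨r2, i2⟩, ⟨r3, i3⟩⟩ := gridVertex_re_im δ q
  obtain ⟨c, hc⟩ : ∃ c : ℂ, ∀ d, 0 < (c * (gridVertex δ q d - z)).re := by
    have hz' : z.re < q.1 * δ ∨ (q.1 + 1) * δ < z.re ∨ z.im < q.2 * δ ∨ (q.2 + 1) * δ < z.im := by
      by_contra! h
      exact hz (Complex.mem_reProdIm.2 ⟨⟨h.1, h.2.1⟩, ⟨h.2.2.1, h.2.2.2⟩⟩)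
    rcases hz' with h | h | h | h
    · refine ⟨1, fun d => ?_⟩
      fin_cases d <;> simp [r0, r1, r2, r3] <;> nlinarith
    · refine ⟨-1, fun d => ?_⟩
      fin_cases d <;> simp [r0, r1, r2, r3] <;> nlinarith
    · refine ⟨-Complex.I, fun d => ?_⟩
      fin_cases d <;> simp [i0, i1, i2, i3] <;> nlinarith
    · refine ⟨Complex.I, fun d => ?_⟩
      fin_cases d <;> simp [i0, i1, i2, i3] <;> nlinarith
  simp only [segIntegral_eq_log_sub_log (hc _) (hc _), Finset.sum_sub_distrib]
  rw [sub_eq_zero]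
  exact Equiv.sum_comp (Equiv.addRight (1 : Fin 4)) fun d => Complex.log (c * (gridVertex δ q d - z))

theorem sum_segIntegral_eq_two_pi_I {δ : ℝ} {q : ℤ × ℤ} {z : ℂ} (hz : z ∈ openCell δ q) :
    ∑ d, segIntegral z (gridVertex δ q d) (gridVertex δ q (d + 1)) =
      2 * Real.pi * Complex.I := by
  obtain ⟨⟨r0, i0⟩, ⟨r1, i1⟩, ⟨r2, i2⟩, ⟨r3, i3⟩⟩ := gridVertex_re_im δ q
  obtain ⟨⟨h1, h2⟩, ⟨h3, h4⟩⟩ := Complex.mem_reProdIm.1 hz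
  rw [Fin.sum_univ_four]
  change segIntegral z (gridVertex δ q 0) (gridVertex δ q 1) +
    segIntegral z (gridVertex δ q 1) (gridVertex δ q 2) +
    segIntegral z (gridVertex δ q 2) (gridVertex δ q 3) +
    segIntegral z (gridVertex δ q 3) (gridVertex δ q 0) = _
  set a := gridVertex δ q 0
  set b := gridVertex δ q 1
  set c := gridVertex δ q 2
  set d := gridVertex δ q 3
  rw [segIntegral_eq_log_sub_log (c := Complex.I) (s := a) (e := b) (by simp; linarith)
      (by simp; linarith),
    segIntegral_eq_log_sub_log (c := 1) (s := b) (e := c) (by simp; linarith) (by simp; linarith),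
    segIntegral_eq_log_sub_log (c := -Complex.I) (s := c) (e := d) (by simp; linarith)
      (by simp; linarith),
    segIntegral_eq_log_sub_log (c := -1) (s := d) (e := a) (by simp; linarith)
      (by simp; linarith)]
  -- at each vertex the branches of the logarithm on the adjacent edges differ by `πi/2`
  have k1 := log_sub_log_neg_I_mul (w := Complex.I * (b - z)) (by simp; linarith)
    (by simp; linarith)
  have k2 := log_sub_log_neg_I_mul (w := 1 * (c - z)) (by simp; linarith) (by simp; linarith)
  have k3 := log_sub_log_neg_I_mul (w := -Complex.I * (d - z)) (by simp; linarith)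
    (by simp; linarith)
  have k4 := log_sub_log_neg_I_mul (w := -1 * (a - z)) (by simp; linarith) (by simp; linarith)
  rw [show -Complex.I * (Complex.I * (b - z)) = 1 * (b - z) by
    rw [← mul_assoc, neg_mul, Complex.I_mul_I, neg_neg]] at k1
  rw [show -Complex.I * (1 * (c - z)) = -Complex.I * (c - z) by ring] at k2
  rw [show -Complex.I * (-Complex.I * (d - z)) = -1 * (d - z) by
    rw [← mul_assoc, neg_mul_neg, Complex.I_mul_I]] at k3
  rw [show -Complex.I * (-1 * (a - z)) = Complex.I * (a - z) by ring] at k4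
  linear_combination k1 + k2 + k3 + k4

theorem gridContour_index_eq_zero {δ : ℝ} (hδ : 0 < δ) {S : Finset (ℤ × ℤ)} {z : ℂ}
    (hz : ∀ q ∈ S, z ∉ closedCell δ q) : (gridContour δ S).index z = 0 := by
  rw [Contour.index, gridContour_integral_inv,
    Finset.sum_eq_zero fun q hq => sum_segIntegral_eq_zero hδ (hz q hq), mul_zero]

theorem eq_of_mem_openCell_of_mem_closedCell {δ : ℝ} (hδ : 0 < δ) {q q' : ℤ × ℤ} {z : ℂ}
    (h : z ∈ openCell δ q) (h' : z ∈ closedCell δ q') : q' = q := by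
  obtain ⟨⟨h1, h2⟩, ⟨h3, h4⟩⟩ := Complex.mem_reProdIm.1 h
  obtain ⟨⟨h5, h6⟩, ⟨h7, h8⟩⟩ := Complex.mem_reProdIm.1 h'
  have key : ∀ {i j : ℤ} {x : ℝ}, i * δ < x → x ≤ (j + 1) * δ → i ≤ j := by
    intro i j x ha hb
    have : (i : ℝ) < j + 1 := lt_of_mul_lt_mul_right (ha.trans_le hb) hδ.le
    have : i < j + 1 := by exact_mod_cast this
    omega
  have key' : ∀ {i j : ℤ} {x : ℝ}, i * δ ≤ x → x < (j + 1) * δ → i ≤ j := by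
    intro i j x ha hb
    have : (i : ℝ) < j + 1 := lt_of_mul_lt_mul_right (ha.trans_lt hb) hδ.le
    have : i < j + 1 := by exact_mod_cast this
    omega
  exact Prod.ext (le_antisymm (key' h5 h2) (key h1 h6)) (le_antisymm (key' h7 h4) (key h3 h8))

theorem gridContour_index_eq_one {δ : ℝ} (hδ : 0 < δ) {S : Finset (ℤ × ℤ)} {q : ℤ × ℤ} (hq : q ∈ S)
    {z : ℂ} (hz : z ∈ openCell δ q) : (gridContour δ S).index z = 1 := by
  rw [Contour.index, gridContour_integral_inv, Finset.sum_eq_single_of_mem q hq fun q' _ hne =>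
    sum_segIntegral_eq_zero hδ fun h => hne (eq_of_mem_openCell_of_mem_closedCell hδ hz h),
    sum_segIntegral_eq_two_pi_I hz, inv_mul_cancel₀ Complex.two_pi_I_ne_zero]

theorem exists_mem_closedCell {δ : ℝ} (hδ : 0 < δ) (z : ℂ) : ∃ q, z ∈ closedCell δ q := by
  refine ⟨(⌊z.re / δ⌋, ⌊z.im / δ⌋), Complex.mem_reProdIm.2 ⟨⟨?_, ?_⟩, ⟨?_, ?_⟩⟩⟩
  · exact (le_div_iff₀ hδ).1 (Int.floor_le _)
  · exact (div_le_iff₀ hδ).1 (Int.lt_floor_add_one _).le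
  · exact (le_div_iff₀ hδ).1 (Int.floor_le _)
  · exact (div_le_iff₀ hδ).1 (Int.lt_floor_add_one _).le

theorem dist_le_of_mem_closedCell {δ : ℝ} {q : ℤ × ℤ} {z w : ℂ}
    (hz : z ∈ closedCell δ q) (hw : w ∈ closedCell δ q) : dist z w ≤ 2 * δ := by
  obtain ⟨⟨h1, h2⟩, ⟨h3, h4⟩⟩ := Complex.mem_reProdIm.1 hz
  obtain ⟨⟨h5, h6⟩, ⟨h7, h8⟩⟩ := Complex.mem_reProdIm.1 hw
  rw [dist_eq_norm]
  refine (Complex.norm_le_abs_re_add_abs_im _).trans ?_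
  rw [Complex.sub_re, Complex.sub_im]
  have : |z.re - w.re| ≤ δ := abs_le.2 ⟨by linarith, by linarith⟩
  have : |z.im - w.im| ≤ δ := abs_le.2 ⟨by linarith, by linarith⟩
  linarith

theorem segment_mem_closedCell {δ : ℝ} (hδ : 0 < δ) (q : ℤ × ℤ) (d : Fin 4) {t : ℝ}
    (ht : t ∈ Set.Icc (0 : ℝ) 1) : gridVertex δ q d +
      t * (gridVertex δ q (d + 1) - gridVertex δ q d) ∈ closedCell δ q := by
  have hv : ∀ d, gridVertex δ q d ∈ closedCell δ q := by
    obtain ⟨⟨r0, i0⟩, ⟨r1, i1⟩, ⟨r2, i2⟩, ⟨r3, i3⟩⟩ := gridVertex_re_im δ q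
    intro d
    refine Complex.mem_reProdIm.2 ?_
    fin_cases d <;> simp [r0, r1, r2, r3, i0, i1, i2, i3, hδ, mul_le_mul_iff_left₀]
  have hconv : Convex ℝ (closedCell δ q) := by
    exact ((convex_Icc _ _).is_linear_preimage Complex.reLm.isLinear).inter
      ((convex_Icc _ _).is_linear_preimage Complex.imLm.isLinear)
  have := hconv.add_smul_sub_mem (hv d) (hv (d + 1)) ht
  rwa [Complex.real_smul] at this

/-- A compact set is surrounded by a contour in every open neighbourhood. -/
theorem exists_contour_surrounds {K Ω : Set ℂ} (hK : IsCompact K) (hΩ : IsOpen Ω) (hKΩ : K ⊆ Ω) :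
    ∃ Γ : Contour, Γ.Surrounds K Ω := by
  obtain ⟨ε, hε, hεΩ⟩ := hK.exists_cthickening_subset_open hΩ hKΩ
  set δ := ε / 2 with hδdef
  have hδ : 0 < δ := by positivity
  have hfin : {q | (closedCell δ q ∩ K).Nonempty}.Finite := by
    obtain ⟨R, hR⟩ := hK.isBounded.exists_norm_le
    refine ((Set.finite_Icc (⌊-R / δ⌋ - 1) ⌈R / δ⌉).prod
      (Set.finite_Icc (⌊-R / δ⌋ - 1) ⌈R / δ⌉)).subset ?_
    rintro q ⟨z, hz, hzK⟩
    obtain ⟨⟨h1, h2⟩, ⟨h3, h4⟩⟩ := Complex.mem_reProdIm.1 hz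
    have hre := abs_le.1 ((Complex.abs_re_le_norm z).trans (hR z hzK))
    have him := abs_le.1 ((Complex.abs_im_le_norm z).trans (hR z hzK))
    have key : ∀ (j : ℤ) (x : ℝ), -R ≤ x ∧ x ≤ R → j * δ ≤ x → x ≤ (j + 1) * δ →
        j ∈ Set.Icc (⌊-R / δ⌋ - 1) ⌈R / δ⌉ := by
      intro j x hx ha hb
      constructor
      · have : -R / δ ≤ j + 1 := (div_le_iff₀ hδ).2 (hx.1.trans hb)
        have h := (Int.floor_le _).trans this
        have : ⌊-R / δ⌋ ≤ j + 1 := by exact_mod_cast h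
        omega
      · have : (j : ℝ) ≤ R / δ := (le_div_iff₀ hδ).2 (ha.trans hx.2)
        have h := this.trans (Int.le_ceil _)
        exact_mod_cast h
    exact ⟨key _ _ hre h1 h2, key _ _ him h3 h4⟩
  set S := hfin.toFinset with hS
  have hmem : ∀ q, q ∈ S ↔ (closedCell δ q ∩ K).Nonempty := fun q => by simp [hS]
  -- the diameter of the squares is at most `2δ = ε`
  have hcell : ∀ q ∈ S, closedCell δ q ⊆ Ω := by
    intro q hq z hz
    obtain ⟨w, hw, hwK⟩ := (hmem q).1 hq
    refine hεΩ (Metric.mem_cthickening_of_dist_le z w ε K hwK ?_)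
    have := dist_le_of_mem_closedCell hz hw
    linarith
  -- a boundary edge also belongs to a square outside `S`, which does not meet `K`
  have himage : (gridContour δ S).image ⊆ Ω \ K := by
    intro z hz
    obtain ⟨i, t, ht, rfl⟩ := Set.mem_iUnion.1 hz
    set e := (boundaryEdges S).equivFin.symm i with he
    have h1 := Finset.mem_filter.1 e.2
    refine ⟨hcell _ (Finset.mem_product.1 h1.1).1 (segment_mem_closedCell hδ _ _ ht),
      fun hK' => h1.2 ((hmem _).2 ⟨_, ?_, hK'⟩)⟩
    have h2 := segment_mem_closedCell hδ (oppositeEdge e.1).1 (oppositeEdge e.1).2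
      (t := 1 - t) ⟨by linarith [ht.2], by linarith [ht.1]⟩
    rw [gridVertex_oppositeEdge, gridVertex_oppositeEdge'] at h2
    convert! h2 using 1
    simp only [gridContour, ← he]
    push_cast
    ring
  refine ⟨gridContour δ S, himage, fun z hz => ?_, fun z hz => ?_⟩
  -- a point of `K` may lie on an edge inside the union, so the index there is obtained as a limit
  -- from the interior of an adjacent square
  · obtain ⟨q, hq⟩ := exists_mem_closedCell hδ z
    have hqS : q ∈ S := (hmem q).2 ⟨z, hq, hz⟩
    have hcl : z ∈ closure (openCell δ q) := by
      have hlt : ∀ j : ℤ, (j : ℝ) * δ ≠ (j + 1) * δ := fun j => by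
        intro h; linarith
      rw [openCell, Complex.closure_reProdIm, closure_Ioo (hlt _), closure_Ioo (hlt _)]
      exact hq
    have := mem_closure_iff_nhdsWithin_neBot.1 hcl
    have h1 : Tendsto (gridContour δ S).index (𝓝[openCell δ q] z) (𝓝 _) :=
      (Contour.continuousAt_index fun h => (himage h).2 hz).tendsto.mono_left nhdsWithin_le_nhds
    refine tendsto_nhds_unique h1 (tendsto_const_nhds.congr' ?_)
    filter_upwards [self_mem_nhdsWithin] with w hw
    exact (gridContour_index_eq_one hδ hqS hw).symm
  · exact gridContour_index_eq_zero hδ fun q hq h => hz (hcell q hq h)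

end ContourIntegrals

/-! ### Inverses and holomorphic functional calculus in the smooth Toeplitz algebra -/

theorem continuousOn_resolvent {A : Type*} [NormedRing A] [NormedAlgebra ℂ A] [CompleteSpace A]
    {a : A} {s : Set ℂ} (hs : ∀ ζ ∈ s, IsUnit (algebraMap ℂ A ζ - a)) :
    ContinuousOn (resolvent a) s := by
  intro ζ hζ
  obtain ⟨u, hu⟩ := hs ζ hζ
  refine ContinuousAt.continuousWithinAt ?_
  have h1 := NormedRing.inverse_continuousAt u
  rw [hu] at h1
  exact ContinuousAt.comp (g := Ring.inverse) (f := fun ζ => algebraMap ℂ A ζ - a) h1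
    ((algebraMapCLM ℂ A).continuous.sub continuous_const).continuousAt

section
variable {H : Type*} [NormedAddCommGroup H] [InnerProductSpace ℂ H] [CompleteSpace H]
  (E : HilbertBasis ℕ ℂ H)

/-- The inclusion of the Toeplitz algebra in the bounded operators. -/
def toeplitzInclusion : toeplitzAlgebra E →L[ℂ] (H →L[ℂ] H) :=
  LinearMap.mkContinuous
    { toFun := fun a => a, map_add' := fun _ _ => rfl, map_smul' := fun _ _ => rfl } 1
    fun a => (one_mul ‖(a : H →L[ℂ] H)‖).ge

/-- Matrix coefficients as bounded linear functionals. -/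
def coeffCLM (k l : ℕ) : (H →L[ℂ] H) →L[ℂ] ℂ :=
  (innerSL ℂ (E k)).comp (ContinuousLinearMap.apply ℂ H (E l))

variable {E}

theorem isUnit_coe {a : toeplitzAlgebra E} (ha : IsUnit a) : IsUnit (a : H →L[ℂ] H) :=
  ha.map (toeplitzAlgebra E).subtype

theorem coe_inverse {a : toeplitzAlgebra E} (ha : IsUnit a) :
    ((Ring.inverse a : toeplitzAlgebra E) : H →L[ℂ] H) = Ring.inverse (a : H →L[ℂ] H) := by
  refine left_inv_eq_right_inv (a := (a : H →L[ℂ] H)) ?_ (Ring.mul_inverse_cancel _ (isUnit_coe ha))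
  rw [← MulMemClass.coe_mul, Ring.inverse_mul_cancel _ ha]
  rfl

/-- The smooth Toeplitz algebra is inverse-closed. -/
theorem inverse_mem_smoothToeplitz {a : toeplitzAlgebra E} (ha : a ∈ smoothToeplitz E)
    (hu : IsUnit a) : Ring.inverse a ∈ smoothToeplitz E := by
  obtain ⟨f, c, hf, hc, hac⟩ := ha
  have hu' := isUnit_coe hu
  rw [hac] at hu'
  obtain ⟨g, b, -, hg, hb, h⟩ := exists_inverse_decomp hf hc hu'
  exact ⟨g, b, hg, hb, by rw [coe_inverse hu, hac, h]⟩

/-- If `ζ - a` is invertible, then so is `ζ - g`, for the symbol `g` of `a`. -/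
theorem resolvent_symbol_mul {a : toeplitzAlgebra E} {g : C(UnitAddCircle, ℂ)} {c : H →L[ℂ] H}
    (hc : IsSmoothCompact E c) (hac : (a : H →L[ℂ] H) = toeplitzOp E g + c) {ζ : ℂ}
    (hζ : IsUnit (algebraMap ℂ _ ζ - a)) : IsUnit (algebraMap ℂ C(UnitAddCircle, ℂ) ζ - g) ∧
      ∀ x, resolvent g ζ x * (ζ - g x) = 1 := by
  have h1 : IsUnit (toeplitzOp E (algebraMap ℂ C(UnitAddCircle, ℂ) ζ + (-1 : ℂ) • g) +
      (-1 : ℂ) • c) := by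
    convert! isUnit_coe hζ using 1
    rw [toeplitzOp_add, toeplitzOp_smul, AddSubgroupClass.coe_sub, hac,
      Algebra.algebraMap_eq_smul_one, toeplitzOp_smul, toeplitzOp_one, Algebra.algebraMap_eq_smul_one]
    simp only [neg_smul, one_smul, SetLike.val_smul, OneMemClass.coe_one]
    abel
  have h2 := symbol_ne_zero (hc.smul (-1)) h1
  have h3 : IsUnit (algebraMap ℂ C(UnitAddCircle, ℂ) ζ - g) := by
    rw [ContinuousMap.isUnit_iff_forall_ne_zero]
    intro x
    have := h2 x
    simpa [sub_eq_add_neg] using this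
  refine ⟨h3, fun x => ?_⟩
  have := congrArg (fun F : C(UnitAddCircle, ℂ) => F x) (Ring.inverse_mul_cancel _ h3)
  exact this

/-- Matrix coefficients are bounded linear functionals, so they commute with contour integrals. -/
theorem coeff_contourIntegral_sub {Γ : Contour} {R : ℂ → toeplitzAlgebra E}
    {h : ℂ → C(UnitAddCircle, ℂ)} (hR : ContinuousOn R Γ.image) (hh : ContinuousOn h Γ.image)
    (z : ℂ) (k l : ℕ) :
    coeff E ((z • Γ.integral R : toeplitzAlgebra E) - toeplitzOp E (z • Γ.integral h)) k l =
      z * Γ.integral fun ζ => coeff E (R ζ - toeplitzOp E (h ζ)) k l := by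
  have h1 : coeff E (Γ.integral R : toeplitzAlgebra E) k l =
      Γ.integral fun ζ => coeff E (R ζ : H →L[ℂ] H) k l :=
    Contour.map_integral ((coeffCLM E k l).comp (toeplitzInclusion E)) hR
  have h2 : coeff E (toeplitzOp E (Γ.integral h)) k l =
      Γ.integral fun ζ => coeff E (toeplitzOp E (h ζ)) k l :=
    Contour.map_integral ((coeffCLM E k l).comp (toeplitzCLM E)) hh
  have h3 : Γ.integral (fun ζ => coeff E (R ζ : H →L[ℂ] H) k l - coeff E (toeplitzOp E (h ζ)) k l) =
      _ := Contour.integral_sub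
    (((coeffCLM E k l).comp (toeplitzInclusion E)).continuous.comp_continuousOn hR)
    (((coeffCLM E k l).comp (toeplitzCLM E)).continuous.comp_continuousOn hh)
  simp only [coeff_sub]
  rw [h3, ← h1, ← h2, mul_sub, toeplitzOp_smul, SetLike.val_smul, coeff_smul, coeff_smul]

/-- Cauchy integrals over the resolvents of an element of the smooth Toeplitz algebra remain in
it. -/
theorem mem_smoothToeplitz_of_isHolomorphicCalculus {a : toeplitzAlgebra E}
    (ha : a ∈ smoothToeplitz E) {Ω : Set ℂ} {f : ℂ → ℂ} (hf : DifferentiableOn ℂ f Ω)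
    {b : toeplitzAlgebra E} (hb : IsHolomorphicCalculus a Ω f b) : b ∈ smoothToeplitz E := by
  obtain ⟨g, c, hg, hc, hac⟩ := ha
  obtain ⟨Γ, hΓ, rfl⟩ := hb
  have hunit : ∀ ζ ∈ Γ.image, IsUnit (algebraMap ℂ (toeplitzAlgebra E) ζ - a) := fun ζ hζ =>
    spectrum.notMem_iff.1 (hΓ.image_subset hζ).2
  have hsymb := fun ζ hζ => resolvent_symbol_mul hc hac (hunit ζ hζ)
  have hfc : ContinuousOn f Γ.image := hf.continuousOn.mono fun ζ hζ => (hΓ.image_subset hζ).1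
  have hRc := continuousOn_resolvent hunit
  have hgc := continuousOn_resolvent fun ζ hζ => (hsymb ζ hζ).1
  have hne : ∀ ζ ∈ Γ.image, ∀ x, ζ - g x ≠ 0 := fun ζ hζ x h0 => by
    simpa [h0] using (hsymb ζ hζ).2 x
  -- the symbol of `f(a)` is `f ∘ g`, written as a Cauchy integral
  set F : C(UnitAddCircle, ℂ) := (2 * Real.pi * Complex.I : ℂ)⁻¹ •
    Γ.integral fun ζ => f ζ • resolvent g ζ with hF
  have hFx : ∀ x, F x = (2 * Real.pi * Complex.I : ℂ)⁻¹ *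
      Γ.integral fun ζ => f ζ * (ζ - g x)⁻¹ := by
    intro x
    have h1 := Contour.map_integral (ContinuousMap.evalCLM ℂ x) (hfc.smul hgc)
    rw [hF, ContinuousMap.smul_apply, smul_eq_mul]
    congr 1
    refine h1.trans (Contour.integral_congr fun ζ hζ => ?_)
    rw [← eq_inv_of_mul_eq_one_left ((hsymb ζ hζ).2 x)]
    rfl
  -- `F` is the composition of `g` with a function holomorphic off the contour
  have hFs : IsSmooth F := by
    have hopen := Γ.isCompact_image.isClosed.isOpen_compl
    have h1 : DifferentiableOn ℂ (fun w => (2 * Real.pi * Complex.I : ℂ)⁻¹ *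
        Γ.integral fun ζ => f ζ * (ζ - w)⁻¹) Γ.imageᶜ := fun w hw =>
      ((Contour.differentiableAt_integral_mul_inv hfc hw).const_mul _).differentiableWithinAt
    have h2 := (h1.contDiffOn (n := ((⊤ : ℕ∞) : WithTop ℕ∞)) hopen).restrict_scalars ℝ
    have h3 := h2.comp (t := Γ.imageᶜ) (s := Set.univ) (contDiffOn_univ.2 hg) fun x _ h =>
      hne _ h x (sub_self _)
    rw [IsSmooth]
    simp only [hFx]
    exact contDiffOn_univ.1 h3
  refine ⟨F, _, hFs, ?_, (add_sub_cancel (toeplitzOp E F) _).symm⟩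
  intro M N
  obtain ⟨B₁, hB₁⟩ := Γ.isCompact_image.exists_bound_of_continuousOn hRc
  obtain ⟨B₂, hB₂⟩ := Γ.isCompact_image.exists_bound_of_continuousOn hgc
  obtain ⟨B₃, hB₃⟩ := Γ.isCompact_image.exists_bound_of_continuousOn hfc
  obtain ⟨C, hC⟩ := resolvent_sub_decay E hg hc (max B₁ B₂) M N
  obtain ⟨K, hK0, hK⟩ := Γ.exists_norm_integral_le (A := ℂ)
  refine ⟨‖(2 * Real.pi * Complex.I : ℂ)⁻¹‖ * (K * (B₃ * C)), fun k l => ?_⟩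
  have hC' : ∀ ζ ∈ Γ.image, (1 + k : ℝ) ^ M * (1 + l : ℝ) ^ N *
      ‖coeff E ((resolvent a ζ : toeplitzAlgebra E) - toeplitzOp E (resolvent g ζ)) k l‖ ≤ C := by
    intro ζ hζ
    have e : ((algebraMap ℂ (toeplitzAlgebra E) ζ - a : toeplitzAlgebra E) : H →L[ℂ] H) =
        algebraMap ℂ _ ζ - (toeplitzOp E g + c) := by
      rw [AddSubgroupClass.coe_sub, hac]; rfl
    have h1 := congrArg (fun b : toeplitzAlgebra E => (b : H →L[ℂ] H))
      (Ring.inverse_mul_cancel _ (hunit ζ hζ))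
    have h2 := congrArg (fun b : toeplitzAlgebra E => (b : H →L[ℂ] H))
      (Ring.mul_inverse_cancel _ (hunit ζ hζ))
    simp only [MulMemClass.coe_mul, e] at h1 h2
    exact hC ζ _ _ ((hB₂ ζ hζ).trans (le_max_right _ _)) ((hB₁ ζ hζ).trans (le_max_left _ _))
      (hsymb ζ hζ).2 h1 h2 k l
  have hcoeff : coeff E (((2 * Real.pi * Complex.I : ℂ)⁻¹ • Γ.integral fun ζ => f ζ • resolvent a ζ :
      toeplitzAlgebra E) - toeplitzOp E F) k l = (2 * Real.pi * Complex.I : ℂ)⁻¹ *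
      Γ.integral fun ζ => f ζ * coeff E ((resolvent a ζ : toeplitzAlgebra E) -
        toeplitzOp E (resolvent g ζ)) k l := by
    refine (coeff_contourIntegral_sub (hfc.smul hRc) (hfc.smul hgc) _ k l).trans ?_
    congr 1
    refine Contour.integral_congr fun ζ _ => ?_
    simp only [Pi.smul_apply', toeplitzOp_smul, SetLike.val_smul, ← smul_sub, coeff_smul]
  rw [hcoeff, norm_mul]
  have hw : (0 : ℝ) < (1 + k : ℝ) ^ M * (1 + l : ℝ) ^ N := by positivity
  have h4 := hK (fun ζ => f ζ * coeff E ((resolvent a ζ : toeplitzAlgebra E) -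
        toeplitzOp E (resolvent g ζ)) k l) (B₃ * C / ((1 + k : ℝ) ^ M * (1 + l : ℝ) ^ N))
    fun ζ hζ => by
      rw [norm_mul, le_div_iff₀ hw, mul_assoc, mul_comm ‖coeff E _ k l‖]
      have hB0 := (norm_nonneg _).trans (hB₃ ζ hζ)
      exact mul_le_mul (hB₃ ζ hζ) (hC' ζ hζ) (by positivity) hB0
  rw [← mul_div_assoc, le_div_iff₀ hw] at h4
  rw [mul_left_comm]
  exact mul_le_mul_of_nonneg_left ((mul_comm _ _).trans_le h4) (norm_nonneg _)

theorem exists_isHolomorphicCalculus (a : toeplitzAlgebra E) {Ω : Set ℂ} (f : ℂ → ℂ)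
    (hΩ : IsOpen Ω) (ha : spectrum ℂ a ⊆ Ω) : ∃ b, IsHolomorphicCalculus a Ω f b := by
  obtain ⟨Γ, hΓ⟩ := exists_contour_surrounds (spectrum.isCompact a) hΩ ha
  exact ⟨_, Γ, hΓ, rfl⟩

end

/-! ### Matrices over dense inverse-closed subalgebras -/

section Matrices
universe u v
variable {B : Type v} [Ring B]
variable {m n : Type*} [Fintype m] [Fintype n] [DecidableEq m] [DecidableEq n]

/-- A block matrix is invertible if its top left block and the Schur complement of this block are:
it is their block sum, multiplied by triangular matrices. -/
theorem isUnit_fromBlocks_of_schur {a : Matrix m m B} {b : Matrix m n B} {c : Matrix n m B}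
    {d : Matrix n n B} {a' : Matrix m m B} (h : a * a' = 1) (h' : a' * a = 1)
    (hs : IsUnit (d - c * a' * b)) : IsUnit (Matrix.fromBlocks a b c d) := by
  have e : Matrix.fromBlocks a b c d = Matrix.fromBlocks 1 0 (c * a') 1 *
      Matrix.fromBlocks a 0 0 (d - c * a' * b) * Matrix.fromBlocks 1 (a' * b) 0 1 := by
    simp only [Matrix.fromBlocks_multiply, Matrix.one_mul, Matrix.zero_mul, Matrix.mul_zero,
      Matrix.mul_one, add_zero, zero_add]
    congr 1
    · rw [← Matrix.mul_assoc, h, Matrix.one_mul]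
    · rw [Matrix.mul_assoc, h', Matrix.mul_one]
    · rw [Matrix.mul_assoc c a' a, h', Matrix.mul_one, ← Matrix.mul_assoc, add_sub_cancel]
  have lower : ∀ x : Matrix n m B, IsUnit (Matrix.fromBlocks (1 : Matrix m m B) 0 x 1) :=
    fun x => isUnit_iff_exists.2 ⟨Matrix.fromBlocks 1 0 (-x) 1,
      by rw [Matrix.fromBlocks_multiply]; simp, by rw [Matrix.fromBlocks_multiply]; simp⟩
  have upper : ∀ x : Matrix m n B, IsUnit (Matrix.fromBlocks (1 : Matrix m m B) x 0 1) :=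
    fun x => isUnit_iff_exists.2 ⟨Matrix.fromBlocks 1 (-x) 0 1,
      by rw [Matrix.fromBlocks_multiply]; simp, by rw [Matrix.fromBlocks_multiply]; simp⟩
  rw [e]
  exact ((lower _).mul (isUnit_blockSum ⟨⟨a, a', h, h'⟩, rfl⟩ hs)).mul (upper _)

/-- Similar idempotents are equivalent. -/
theorem MvN.of_isUnit {e f w : Matrix n n B} (hf : IsIdempotentElem f)
    (hw : IsUnit w) (h : e * w = w * f) : MvN e f := by
  obtain ⟨⟨w, w', h1, h2⟩, rfl⟩ := hw
  simp only at h
  refine ⟨w * f, f * w', ?_, ?_⟩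
  · rw [← mul_assoc, mul_assoc w, hf.eq, ← h, mul_assoc, h1, mul_one]
  · rw [← mul_assoc, mul_assoc f, h2, mul_one, hf.eq]

/-- If `x : f → e` and `y : e → f` are morphisms of idempotents such that `x y` and `y x` are
invertible, then `e` and `f` are equivalent. -/
theorem MvN.of_isUnit_mul_add {e : Matrix m m B} {f : Matrix n n B} (he : IsIdempotentElem e)
    (hf : IsIdempotentElem f) {x : Matrix m n B} {y : Matrix n m B} (hex : e * x = x)
    (hxf : x * f = x) (hfy : f * y = y) (hye : y * e = y) (hz : IsUnit (x * y + (1 - e))) (hw : IsUnit (y * x + (1 - f))) :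
    MvN e f := by
  obtain ⟨⟨z, z', h1, h2⟩, hz⟩ := hz
  simp only at hz
  -- `z = x y + (1 - e)` commutes with `e`, and `z⁻¹ x` and `y` give the equivalence
  have ze : z * e = x * y := by
    rw [hz, add_mul, sub_mul, one_mul, he.eq, sub_self, add_zero, Matrix.mul_assoc, hye]
  have ez : e * z = x * y := by
    rw [hz, mul_add, mul_sub, mul_one, he.eq, sub_self, add_zero, ← Matrix.mul_assoc, hex]
  have ez' : e * z' = z' * e := by
    calc e * z' = z' * (z * e) * z' := by rw [← mul_assoc, h2, one_mul]
      _ = z' * (e * z) * z' := by rw [ze, ez]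
      _ = z' * e := by rw [mul_assoc, mul_assoc, h1, mul_one]
  refine ⟨z' * x, y, ?_, hw.mul_left_cancel ?_⟩
  · rw [Matrix.mul_assoc, ← ze, ← mul_assoc, h2, one_mul]
  · have h3 : (1 - f) * y = 0 := by rw [Matrix.sub_mul, Matrix.one_mul, hfy, sub_self]
    calc (y * x + (1 - f)) * (y * (z' * x)) = y * (x * y) * z' * x + (1 - f) * y * (z' * x) := by
          rw [Matrix.add_mul]; simp only [Matrix.mul_assoc]
      _ = y * (e * z) * z' * x := by rw [h3, Matrix.zero_mul, add_zero, ez]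
      _ = y * x := by
          rw [Matrix.mul_assoc y, mul_assoc e, h1, mul_one, hye]
      _ = (y * x + (1 - f)) * f := by
          rw [Matrix.add_mul, Matrix.mul_assoc, hxf, sub_mul, one_mul, hf.eq, sub_self, add_zero]

end Matrices

section SpectralInvariance
universe u v
variable {A : Type u} [NormedRing A] [CompleteSpace A] {B : Type v} [Ring B] {i : B →+* A}
variable {m n : Type*} [Fintype m] [Fintype n] [DecidableEq m] [DecidableEq n]

theorem denseRange_matrix_map (hd : DenseRange i) :
    DenseRange (fun W : Matrix m n B => W.map i) :=
  DenseRange.piMap fun _ => DenseRange.piMap fun _ => hd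

variable (i m) in
/-- Matrices over `B` whose image in the matrices over `A` is close to the identity are
invertible over `B`. -/
def UnitsNearOne : Prop :=
  ∀ᶠ Z in 𝓝 (1 : Matrix m m A), ∀ W : Matrix m m B, W.map i = Z → IsUnit W

/-- The Schur complement of the top left entry reduces the size of the matrix by one. -/
theorem UnitsNearOne.sum (hu : ∀ b, IsUnit (i b) → IsUnit b) (hn : UnitsNearOne i n) :
    UnitsNearOne i (Fin 1 ⊕ n) := by
  let c : A → Matrix (Fin 1) (Fin 1) A := fun a _ _ => Ring.inverse a
  have c11 : Continuous fun Z : Matrix (Fin 1 ⊕ n) (Fin 1 ⊕ n) A => Z (Sum.inl 0) (Sum.inl 0) :=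
    continuous_id.matrix_elem _ _
  have c12 : Continuous (Matrix.toBlocks₁₂ : Matrix (Fin 1 ⊕ n) (Fin 1 ⊕ n) A → _) :=
    continuous_id.matrix_submatrix Sum.inl Sum.inr
  have c21 : Continuous (Matrix.toBlocks₂₁ : Matrix (Fin 1 ⊕ n) (Fin 1 ⊕ n) A → _) :=
    continuous_id.matrix_submatrix Sum.inr Sum.inl
  have c22 : Continuous (Matrix.toBlocks₂₂ : Matrix (Fin 1 ⊕ n) (Fin 1 ⊕ n) A → _) :=
    continuous_id.matrix_submatrix Sum.inr Sum.inr
  have e1 : (1 : Matrix (Fin 1 ⊕ n) (Fin 1 ⊕ n) A) = Matrix.fromBlocks 1 0 0 1 :=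
    Matrix.fromBlocks_one.symm
  have hinv : ContinuousAt (fun Z : Matrix (Fin 1 ⊕ n) (Fin 1 ⊕ n) A =>
      c (Z (Sum.inl 0) (Sum.inl 0))) 1 := by
    refine continuousAt_pi.2 fun _ => continuousAt_pi.2 fun _ => ?_
    refine ContinuousAt.comp (g := Ring.inverse) ?_ c11.continuousAt
    simpa using NormedRing.inverse_continuousAt (1 : Aˣ)
  have hS : ContinuousAt (fun Z : Matrix (Fin 1 ⊕ n) (Fin 1 ⊕ n) A =>
      Z.toBlocks₂₂ - Z.toBlocks₂₁ * c (Z (Sum.inl 0) (Sum.inl 0)) * Z.toBlocks₁₂) 1 := by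
    have hmul : Continuous fun p : (Matrix n n A × Matrix n (Fin 1) A) ×
        (Matrix (Fin 1) (Fin 1) A × Matrix (Fin 1) n A) => p.1.1 - p.1.2 * p.2.1 * p.2.2 :=
      continuous_fst.fst.sub
        ((continuous_fst.snd.matrix_mul continuous_snd.fst).matrix_mul continuous_snd.snd)
    exact (hmul.tendsto _).comp ((c22.continuousAt.prodMk c21.continuousAt).prodMk
      (hinv.prodMk c12.continuousAt))
  have h1 : ∀ᶠ Z in 𝓝 (1 : Matrix (Fin 1 ⊕ n) (Fin 1 ⊕ n) A), IsUnit (Z (Sum.inl 0) (Sum.inl 0)) :=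
    (c11.tendsto' 1 1 (by simp)).eventually (Units.isOpen.mem_nhds isUnit_one)
  have hS1 : (1 : Matrix (Fin 1 ⊕ n) (Fin 1 ⊕ n) A).toBlocks₂₂ -
      (1 : Matrix (Fin 1 ⊕ n) (Fin 1 ⊕ n) A).toBlocks₂₁ *
      c ((1 : Matrix (Fin 1 ⊕ n) (Fin 1 ⊕ n) A) (Sum.inl 0) (Sum.inl 0)) *
      (1 : Matrix (Fin 1 ⊕ n) (Fin 1 ⊕ n) A).toBlocks₁₂ = 1 := by
    rw [e1, Matrix.toBlocks_fromBlocks₂₂, Matrix.toBlocks_fromBlocks₁₂, Matrix.mul_zero, sub_zero]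
  have h2 := (hS1 ▸ hS.tendsto).eventually hn
  filter_upwards [h1, h2] with Z h1 h2 W hW
  subst hW
  obtain ⟨⟨b, b', hb, hb'⟩, hbW⟩ := hu _ h1
  simp only at hbW
  let a' : Matrix (Fin 1) (Fin 1) B := fun _ _ => b'
  rw [← Matrix.fromBlocks_toBlocks W]
  refine isUnit_fromBlocks_of_schur (a' := a') ?_ ?_ (h2 _ ?_)
  · ext p q
    rw [Subsingleton.elim p 0, Subsingleton.elim q 0]
    rw [Matrix.mul_apply, Fin.sum_univ_one, Matrix.one_apply_eq]
    exact (congrArg (· * b') hbW.symm).trans hb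
  · ext p q
    rw [Subsingleton.elim p 0, Subsingleton.elim q 0]
    rw [Matrix.mul_apply, Fin.sum_univ_one, Matrix.one_apply_eq]
    exact (congrArg (b' * ·) hbW.symm).trans hb'
  have h4 : c (W.map i (Sum.inl 0) (Sum.inl 0)) = a'.map i := by
    ext p q
    have k1 : i b * i b' = 1 := by rw [← map_mul, hb, map_one]
    have k2 : i b' * i b = 1 := by rw [← map_mul, hb', map_one]
    change Ring.inverse (i (W (Sum.inl 0) (Sum.inl 0))) = i b'
    rw [← hbW]
    exact Ring.inverse_unit (⟨i b, i b', k1, k2⟩ : Aˣ)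
  rw [h4, Matrix.map_sub _ (map_sub i), Matrix.map_mul, Matrix.map_mul]
  rfl

theorem UnitsNearOne.reindex (hm : UnitsNearOne i m) (σ : m ≃ n) : UnitsNearOne i n := by
  have h := ((continuous_id.matrix_submatrix σ σ).tendsto' (1 : Matrix n n A) 1
    (by simp)).eventually hm
  filter_upwards [h] with Z h W hW
  have := isUnit_reindex (h (W.submatrix σ σ) (by rw [← hW]; rfl)) σ
  simpa using this

theorem unitsNearOne (hu : ∀ b, IsUnit (i b) → IsUnit b) (N : ℕ) : UnitsNearOne i (Fin N) := by
  induction N with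
  | zero =>
    refine Eventually.of_forall fun Z W _ => ?_
    rw [Subsingleton.elim W 1]; exact isUnit_one
  | succ N ih =>
    exact (UnitsNearOne.sum hu ih).reindex (finSumFinEquiv.trans (finCongr (Nat.add_comm 1 N)))

theorem eventually_isUnit_matrix (A : Type*) [NormedRing A] [CompleteSpace A] (N : ℕ) :
    ∀ᶠ Z in 𝓝 (1 : Matrix (Fin N) (Fin N) A), IsUnit Z := by
  filter_upwards [unitsNearOne (i := RingHom.id A) (fun _ h => h) N] with Z h
  exact h Z (by ext; rfl)

theorem isOpen_isUnit_matrix (A : Type*) [NormedRing A] [CompleteSpace A] (N : ℕ) :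
    IsOpen {w : Matrix (Fin N) (Fin N) A | IsUnit w} := by
  refine isOpen_iff_mem_nhds.2 ?_
  rintro _ ⟨u, rfl⟩
  have h := ((continuous_const_mul (↑u⁻¹ : Matrix (Fin N) (Fin N) A)).tendsto' ↑u 1
    u.inv_mul).eventually (eventually_isUnit_matrix A N)
  filter_upwards [h] with Z h
  simpa using u.isUnit.mul h

/-- A dense inverse-closed subalgebra of a Banach algebra remains inverse-closed after passing to
matrices. If `W` over the subalgebra is close to the inverse of `X`, then `X W` and `W X` are close
to the identity and thus invertible over the subalgebra. -/
theorem isUnit_of_isUnit_map (hd : DenseRange i) (hu : ∀ b, IsUnit (i b) → IsUnit b) {N : ℕ}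
    {X : Matrix (Fin N) (Fin N) B} (hX : IsUnit (X.map i)) : IsUnit X := by
  obtain ⟨⟨X', Y, h1, h2⟩, hXX⟩ := hX
  simp only at hXX
  subst hXX
  have hden := denseRange_matrix_map (m := Fin N) (n := Fin N) hd
  have hN := unitsNearOne hu N
  have k1 := ((continuous_const_mul (X.map i)).tendsto' Y 1 h1).eventually hN
  have k2 := ((continuous_mul_const (X.map i)).tendsto' Y 1 h2).eventually hN
  obtain ⟨W, hW1, hW2⟩ := hden.exists_mem_open isOpen_interior
    ⟨Y, mem_interior_iff_mem_nhds.2 (k1.and k2)⟩ |>.imp fun W hW => interior_subset hW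
  obtain ⟨u, hu⟩ := hW1 (X * W) Matrix.map_mul
  obtain ⟨v, hv⟩ := hW2 (W * X) Matrix.map_mul
  refine isUnit_iff_exists_and_exists.2 ⟨⟨W * (u⁻¹).val, ?_⟩, ⟨(v⁻¹).val * W, ?_⟩⟩
  · rw [← mul_assoc, ← hu, Units.mul_inv]
  · rw [mul_assoc, ← hv, Units.inv_mul]

/-- Idempotent matrices over a dense inverse-closed subalgebra which are equivalent over the whole
algebra are equivalent over the subalgebra: approximations `x₀`, `y₀` of the matrices `x`, `y` implementing
the equivalence satisfy the conditions of `MvN.of_isUnit_mul_add` after compression by `e`, `f`. -/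
theorem MvN.of_map (hd : DenseRange i) (hu : ∀ b, IsUnit (i b) → IsUnit b) {k l : ℕ}
    {e : Matrix (Fin k) (Fin k) B} {f : Matrix (Fin l) (Fin l) B} (he : IsIdempotentElem e)
    (hf : IsIdempotentElem f) (h : MvN (e.map i) (f.map i)) : MvN e f := by
  obtain ⟨x, y, hxy, hyx⟩ := h
  have he' : e.map i * e.map i = e.map i := by rw [← Matrix.map_mul, he.eq]
  have hf' : f.map i * f.map i = f.map i := by rw [← Matrix.map_mul, hf.eq]
  have hx := denseRange_matrix_map (m := Fin k) (n := Fin l) hd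
  have hy := denseRange_matrix_map (m := Fin l) (n := Fin k) hd
  have c1 : Continuous fun p : Matrix (Fin k) (Fin l) A × Matrix (Fin l) (Fin k) A =>
      (e.map i * p.1 * f.map i) * (f.map i * p.2 * e.map i) + (1 - e.map i) := by
    fun_prop
  have c2 : Continuous fun p : Matrix (Fin k) (Fin l) A × Matrix (Fin l) (Fin k) A =>
      (f.map i * p.2 * e.map i) * (e.map i * p.1 * f.map i) + (1 - f.map i) := by
    fun_prop
  have ex : e.map i * x = x * f.map i := by rw [← hxy, ← hyx, Matrix.mul_assoc]
  have fy : f.map i * y = y * e.map i := by rw [← hxy, ← hyx, Matrix.mul_assoc]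
  have v1 : (e.map i * x * f.map i) * (f.map i * y * e.map i) + (1 - e.map i) = 1 := by
    rw [ex, fy, Matrix.mul_assoc x, hf', Matrix.mul_assoc y, he', ← fy, Matrix.mul_assoc x,
      ← Matrix.mul_assoc (f.map i), hf', ← Matrix.mul_assoc, ← ex, Matrix.mul_assoc, hxy, he',
      add_sub_cancel]
  have v2 : (f.map i * y * e.map i) * (e.map i * x * f.map i) + (1 - f.map i) = 1 := by
    rw [ex, fy, Matrix.mul_assoc x, hf', Matrix.mul_assoc y, he', ← ex, Matrix.mul_assoc y,
      ← Matrix.mul_assoc (e.map i), he', ← Matrix.mul_assoc, ← fy, Matrix.mul_assoc, hyx, hf',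
      add_sub_cancel]
  have k1 := (c1.tendsto' (x, y) 1 v1).eventually (unitsNearOne hu k)
  have k2 := (c2.tendsto' (x, y) 1 v2).eventually (unitsNearOne hu l)
  obtain ⟨⟨x₀, y₀⟩, hW1, hW2⟩ := (hx.prodMap hy).exists_mem_open isOpen_interior
    ⟨(x, y), mem_interior_iff_mem_nhds.2 (k1.and k2)⟩ |>.imp fun W hW => interior_subset hW
  have m1 : ∀ W : Matrix (Fin k) (Fin k) B, (1 - W).map i = 1 - W.map i :=
    fun W => (map_sub i.mapMatrix 1 W).trans (by rw [map_one]; rfl)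
  have m2 : ∀ W : Matrix (Fin l) (Fin l) B, (1 - W).map i = 1 - W.map i :=
    fun W => (map_sub i.mapMatrix 1 W).trans (by rw [map_one]; rfl)
  refine MvN.of_isUnit_mul_add he hf (x := e * x₀ * f) (y := f * y₀ * e) ?_ ?_ ?_ ?_
    (hW1 _ ?_) (hW2 _ ?_)
  · rw [← Matrix.mul_assoc, ← Matrix.mul_assoc, he.eq]
  · rw [Matrix.mul_assoc, hf.eq]
  · rw [← Matrix.mul_assoc, ← Matrix.mul_assoc, hf.eq]
  · rw [Matrix.mul_assoc, he.eq]
  · rw [Matrix.map_add _ (map_add i), m1]; simp only [Matrix.map_mul]; rfl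
  · rw [Matrix.map_add _ (map_add i), m2]; simp only [Matrix.map_mul]; rfl

/-- Idempotents `f` close to a given one `e` are equivalent to it: `f e + (1 - f) (1 - e)` is close
to the identity and intertwines the two. -/
theorem eventually_mvN {N : ℕ} {e : Matrix (Fin N) (Fin N) A} (he : IsIdempotentElem e) :
    ∀ᶠ f in 𝓝 e, IsIdempotentElem f → MvN f e := by
  have c : Continuous fun f : Matrix (Fin N) (Fin N) A => f * e + (1 - f) * (1 - e) := by fun_prop
  have h2 := (c.tendsto' e 1 (by rw [he.one_sub.eq, he.eq]; abel)).eventually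
    (eventually_isUnit_matrix A N)
  filter_upwards [h2] with f h hf
  refine MvN.of_isUnit he h ?_
  have hf' := hf.eq
  have he' := he.eq
  simp only [mul_add, mul_sub, sub_mul, add_mul, mul_one, one_mul, mul_assoc, he',
    ← mul_assoc f f, hf']
  abel

end SpectralInvariance

/-! ### Maps induced in K-theory -/

section KZeroMap
universe u v
variable {A : Type u} [Ring A] {B : Type v} [Ring B] (i : B →+* A)

theorem dsum_map {m n : ℕ} (e : Matrix (Fin m) (Fin m) B) (f : Matrix (Fin n) (Fin n) B) :
    (dsum e f).map i = dsum (e.map i) (f.map i) := by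
  have h := Matrix.fromBlocks_map e 0 0 f i
  rw [Matrix.map_zero _ (map_zero i), Matrix.map_zero _ (map_zero i)] at h
  rw [dsum, dsum, blockSum, blockSum, ← h]
  rfl

theorem MvN.map {m n : Type*} [Fintype m] [Fintype n] {e : Matrix m m B} {f : Matrix n n B}
    (h : MvN e f) : MvN (e.map i) (f.map i) := by
  obtain ⟨x, y, h1, h2⟩ := h
  exact ⟨x.map i, y.map i, by rw [← Matrix.map_mul, h1], by rw [← Matrix.map_mul, h2]⟩

/-- The image of an idempotent matrix under a homomorphism. -/
def IdemMatrix.map (e : IdemMatrix B) : IdemMatrix A :=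
  ⟨e.n, i.mapMatrix e.mat, e.idem.map i.mapMatrix⟩

/-- The homomorphism of monoids of idempotent classes induced by a homomorphism of rings. -/
def IdemClass.map : IdemClass B →+ IdemClass A where
  toFun := Quotient.map (IdemMatrix.map i) fun _ _ h => MvN.map i h
  map_zero' := congrArg (Quotient.mk _) (by
    simp only [IdemMatrix.map, map_zero])
  map_add' := by
    rintro ⟨e⟩ ⟨f⟩
    refine congrArg (Quotient.mk _) (?_ : IdemMatrix.map i (e.dsum f) =
      (IdemMatrix.map i e).dsum (IdemMatrix.map i f))
    simp only [IdemMatrix.map, IdemMatrix.dsum]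
    congr 1
    exact dsum_map i _ _

/-- A homomorphism inducing a bijection of idempotent classes induces an isomorphism in `K₀`. -/
theorem exists_kZero_equiv (h : Function.Bijective (IdemClass.map i)) :
    ∃ φ : KZero B ≃+ KZero A, ∀ (n : ℕ) (e : Matrix (Fin n) (Fin n) B) (he : IsIdempotentElem e),
      φ (KZero.mk e he) = KZero.mk (i.mapMatrix e) (he.map i.mapMatrix) := by
  let σ := AddEquiv.ofBijective (IdemClass.map i) h
  let F : KZero B →+ KZero A := Algebra.GrothendieckAddGroup.lift
    (Algebra.GrothendieckAddGroup.of.comp σ.toAddMonoidHom)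
  let G : KZero A →+ KZero B := Algebra.GrothendieckAddGroup.lift
    (Algebra.GrothendieckAddGroup.of.comp σ.symm.toAddMonoidHom)
  have hF : ∀ x, F (Algebra.GrothendieckAddGroup.of x) = Algebra.GrothendieckAddGroup.of (σ x) :=
    fun x => DFunLike.congr_fun (Algebra.GrothendieckAddGroup.lift.symm_apply_apply _) x
  have hG : ∀ x, G (Algebra.GrothendieckAddGroup.of x) =
      Algebra.GrothendieckAddGroup.of (σ.symm x) :=
    fun x => DFunLike.congr_fun (Algebra.GrothendieckAddGroup.lift.symm_apply_apply _) x
  have h1 : G.comp F = AddMonoidHom.id _ := by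
    refine Algebra.GrothendieckAddGroup.lift.symm.injective (AddMonoidHom.ext fun x => ?_)
    change G (F (Algebra.GrothendieckAddGroup.of x)) = Algebra.GrothendieckAddGroup.of x
    rw [hF, hG, AddEquiv.symm_apply_apply]
  have h2 : F.comp G = AddMonoidHom.id _ := by
    refine Algebra.GrothendieckAddGroup.lift.symm.injective (AddMonoidHom.ext fun x => ?_)
    change F (G (Algebra.GrothendieckAddGroup.of x)) = Algebra.GrothendieckAddGroup.of x
    rw [hG, hF, AddEquiv.apply_symm_apply]
  exact ⟨AddMonoidHom.toAddEquiv F G h1 h2, fun n e he => hF _⟩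

end KZeroMap

section KZeroBanach
universe u v
variable {A : Type u} [NormedRing A] [CompleteSpace A] {B : Type v} [Ring B] {i : B →+* A}

/-- A dense inverse-closed subalgebra of a Banach algebra whose idempotent matrices are dense in
those of the algebra has the same `K₀`. -/
theorem bijective_idemClass_map (hd : DenseRange i) (hu : ∀ b, IsUnit (i b) → IsUnit b)
    (hlift : ∀ (n : ℕ) (e : Matrix (Fin n) (Fin n) A), IsIdempotentElem e → ∀ U ∈ 𝓝 e,
      ∃ e' : Matrix (Fin n) (Fin n) B, IsIdempotentElem e' ∧ e'.map i ∈ U) :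
    Function.Bijective (IdemClass.map i) := by
  constructor
  · rintro ⟨e⟩ ⟨f⟩ h
    have h' : MvN (e.mat.map i) (f.mat.map i) := Quotient.exact h
    exact Quotient.sound (MvN.of_map hd hu e.idem f.idem h')
  · rintro ⟨e⟩
    obtain ⟨e', he', h⟩ := hlift e.n e.mat e.idem _ (eventually_mvN e.idem)
    exact ⟨Quotient.mk _ ⟨e.n, e', he'⟩, Quotient.sound (h (he'.map i.mapMatrix))⟩

end KZeroBanach

section KOneMap
universe u v
variable {A : Type u} [NormedRing A] [NormedAlgebra ℂ A] [CompleteSpace A]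
  {B : Type v} [Ring B] [Algebra ℂ B] [TopologicalSpace B] [ContinuousAdd B] [ContinuousSMul ℂ B]
  {j : B →ₐ[ℂ] A}

theorem padTo_map {n : ℕ} (N : ℕ) (u : Matrix (Fin n) (Fin n) B) :
    (padTo N u).map j = padTo N (u.map j) := by
  ext p q
  simp only [padTo, Matrix.map_apply]
  split_ifs <;> simp

theorem StablyHomotopic.map (hj : Continuous j) {m n : ℕ} {u : Matrix (Fin m) (Fin m) B}
    {v : Matrix (Fin n) (Fin n) B} (h : StablyHomotopic u v) :
    StablyHomotopic (u.map j) (v.map j) := by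
  obtain ⟨N, h1, h2, h3⟩ := h
  refine ⟨N, h1, h2, ?_⟩
  rw [← padTo_map, ← padTo_map]
  refine (h3.map (f := fun w : Matrix (Fin N) (Fin N) B => w.map j)
    (continuous_id.matrix_map hj)).mono ?_
  rintro _ ⟨w, hw, rfl⟩
  exact hw.map j.toRingHom.mapMatrix

/-- If every matrix of a segment is invertible over the algebra, then the segment is a path of
invertible matrices over the subalgebra. -/
theorem joinedIn_segment (hd : DenseRange j) (hu : ∀ b, IsUnit (j b) → IsUnit b) {N : ℕ}
    {V W : Matrix (Fin N) (Fin N) B}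
    (h : ∀ t ∈ Set.Icc (0 : ℝ) 1, IsUnit (V.map j + (t : ℂ) • (W.map j - V.map j))) :
    JoinedIn {w : Matrix (Fin N) (Fin N) B | IsUnit w} V W := by
  refine JoinedIn.ofLine (f := fun t : ℝ => V + (t : ℂ) • (W - V)) ?_ (by simp) (by simp) ?_
  · exact (continuous_const.add (Complex.continuous_ofReal.smul continuous_const)).continuousOn
  · rintro _ ⟨t, ht, rfl⟩
    refine isUnit_of_isUnit_map (i := j.toRingHom) hd hu ?_
    convert! h t ht using 1
    ext p q
    change j (V p q + (t : ℂ) • (W p q - V p q)) = _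
    rw [map_add, map_smul, map_sub]
    rfl

section
attribute [local instance] Matrix.normedAddCommGroup Matrix.normedSpace

/-- An invertible matrix has a neighbourhood, a ball in the entrywise norm, in which all segments
consist of invertible matrices. -/
theorem exists_open_segment_isUnit {N : ℕ} {Z : Matrix (Fin N) (Fin N) A} (hZ : IsUnit Z) :
    ∃ U : Set (Matrix (Fin N) (Fin N) A), IsOpen U ∧ Z ∈ U ∧ ∀ V ∈ U, ∀ W ∈ U,
      ∀ t ∈ Set.Icc (0 : ℝ) 1, IsUnit (V + (t : ℂ) • (W - V)) := by
  obtain ⟨ε, hε, h⟩ := Metric.isOpen_iff.1 (isOpen_isUnit_matrix A N) Z hZ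
  refine ⟨Metric.ball Z ε, Metric.isOpen_ball, Metric.mem_ball_self hε, fun V hV W hW t ht => ?_⟩
  refine h ?_
  have := (convex_ball Z ε).add_smul_sub_mem hV hW ht
  simpa using this

end

/-- Along a path of invertible matrices over the algebra, the invertible matrices over the
subalgebra near the path stay in one path component: nearby ones are joined by segments. -/
theorem joinedIn_of_map (hd : DenseRange j) (hu : ∀ b, IsUnit (j b) → IsUnit b) {N : ℕ}
    {X Y : Matrix (Fin N) (Fin N) B}
    (h : JoinedIn {w : Matrix (Fin N) (Fin N) A | IsUnit w} (X.map j) (Y.map j)) :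
    JoinedIn {w : Matrix (Fin N) (Fin N) B | IsUnit w} X Y := by
  obtain ⟨γ, hγ⟩ := h
  let S : Set (Matrix (Fin N) (Fin N) B) := {w | IsUnit w}
  -- the truth of `P` is locally constant along the path, and `P` holds at `0`
  let P : unitInterval → Prop := fun t => ∀ᶠ Z in 𝓝 (γ t), ∀ W, W.map j = Z → JoinedIn S X W
  have hden := denseRange_matrix_map (m := Fin N) (n := Fin N) (i := j.toRingHom) hd
  have hP : IsLocallyConstant P := by
    refine IsLocallyConstant.iff_eventually_eq _ |>.2 fun t₀ => ?_
    obtain ⟨U, hUo, hU, hseg⟩ := exists_open_segment_isUnit (hγ t₀)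
    have key : ∀ t, γ t ∈ U → (P t ↔ ∀ W, W.map j ∈ U → JoinedIn S X W) := by
      intro t ht
      constructor
      · intro h W hW
        obtain ⟨W₀, h1, h2⟩ := hden.exists_mem_open isOpen_interior
          ⟨γ t, mem_interior_iff_mem_nhds.2 (inter_mem h (hUo.mem_nhds ht))⟩ |>.imp
            fun W hW => interior_subset hW
        exact (h1 W₀ rfl).trans (joinedIn_segment hd hu (hseg _ h2 _ hW))
      · intro h
        filter_upwards [hUo.mem_nhds ht] with Z hZ W hW
        exact h W (hW ▸ hZ)
    filter_upwards [γ.continuous.continuousAt.eventually_mem (hUo.mem_nhds hU)] with t ht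
    exact propext ((key t ht).trans (key t₀ hU).symm)
  have h0 : P 0 := by
    obtain ⟨U, hUo, hU, hseg⟩ := exists_open_segment_isUnit (hγ 0)
    filter_upwards [hUo.mem_nhds hU] with Z hZ W hW
    rw [γ.source] at hU
    exact joinedIn_segment hd hu (hseg _ hU _ (hW ▸ hZ))
  have h1 : P 1 := (hP.apply_eq_of_preconnectedSpace 0 1) ▸ h0
  exact h1.self_of_nhds Y γ.target.symm

/-- A dense inverse-closed subalgebra of a Banach algebra, with a finer vector space topology, has
the same `K₁`. -/
theorem exists_kOne_equiv (hd : DenseRange j) (hu : ∀ b, IsUnit (j b) → IsUnit b)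
    (hj : Continuous j) :
    ∃ ψ : KOne B ≃+ KOne A, ∀ (n : ℕ) (u : Matrix (Fin n) (Fin n) B) (hu : IsUnit u),
      ψ (KOne.mk u hu) = KOne.mk (j.toRingHom.mapMatrix u) (hu.map j.toRingHom.mapMatrix) := by
  let F : KOne B →+ KOne A := AddMonoidHom.mk' (Quotient.map
    (fun u : InvMatrix B => (⟨u.n, j.toRingHom.mapMatrix u.mat, u.isUnit.map j.toRingHom.mapMatrix⟩ :
      InvMatrix A)) fun _ _ h => StablyHomotopic.map hj h) (by
    rintro ⟨u⟩ ⟨v⟩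
    refine congrArg (Quotient.mk _) ?_
    simp only [InvMatrix.dsum]
    congr 1
    exact dsum_map j.toRingHom _ _)
  have hF : Function.Bijective F := by
    constructor
    · rintro ⟨u⟩ ⟨v⟩ h
      obtain ⟨N, h1, h2, h3⟩ : StablyHomotopic (u.mat.map j) (v.mat.map j) := Quotient.exact h
      rw [← padTo_map, ← padTo_map] at h3
      exact Quotient.sound ⟨N, h1, h2, joinedIn_of_map hd hu h3⟩
    · rintro ⟨u⟩
      have hden := denseRange_matrix_map (m := Fin u.n) (n := Fin u.n) (i := j.toRingHom) hd
      obtain ⟨U, hUo, hU, hseg⟩ := exists_open_segment_isUnit u.isUnit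
      obtain ⟨W, hW⟩ := hden.exists_mem_open hUo ⟨u.mat, hU⟩
      have hWu : IsUnit W := isUnit_of_isUnit_map (i := j.toRingHom) hd hu (by
        simpa using hseg _ hW _ hW 0 (by simp))
      refine ⟨KOne.mk W hWu, Quotient.sound (StablyHomotopic.of_joinedIn ?_)⟩
      refine JoinedIn.ofLine (f := fun t : ℝ => W.map j + (t : ℂ) • (u.mat - W.map j)) ?_
        (by simp) (by simp) ?_
      · exact (continuous_const.add
          (Complex.continuous_ofReal.smul continuous_const)).continuousOn
      · rintro _ ⟨t, ht, rfl⟩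
        exact hseg _ hW _ hU t ht
  exact ⟨AddEquiv.ofBijective F hF, fun n u hu => rfl⟩

end KOneMap

/-! ### The power series of (1 - 4w)^{-1/2} -/

/-- The generating function `F` of the central binomial coefficients satisfies `(1 - 4X) F' = 2F`,
so that the derivative of `(1 - 4X) F²` vanishes. -/
theorem one_sub_four_mul_centralBinom_sq :
    (1 - PowerSeries.C (4 : ℚ) * PowerSeries.X) *
      (PowerSeries.mk fun k => (k.centralBinom : ℚ)) ^ 2 = 1 := by
  set F := PowerSeries.mk fun k => (k.centralBinom : ℚ) with hF
  have h1 : (1 - PowerSeries.C (4 : ℚ) * PowerSeries.X) * PowerSeries.derivative ℚ F =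
      PowerSeries.C 2 * F := by
    ext n
    rw [sub_mul, one_mul, mul_assoc, map_sub, PowerSeries.coeff_C_mul, PowerSeries.coeff_C_mul,
      PowerSeries.coeff_derivative, hF, PowerSeries.coeff_mk, PowerSeries.coeff_mk]
    have h := Nat.succ_mul_centralBinom_succ n
    have h' : ((n : ℚ) + 1) * (n + 1).centralBinom = 2 * (2 * n + 1) * n.centralBinom := by
      exact_mod_cast h
    cases n with
    | zero => simp at h' ⊢; linarith
    | succ n =>
      rw [PowerSeries.coeff_succ_X_mul, PowerSeries.coeff_derivative, PowerSeries.coeff_mk]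
      push_cast at h' ⊢
      linear_combination h'
  refine PowerSeries.derivative.ext ?_ (by simp [hF])
  rw [PowerSeries.derivative_one, Derivation.leibniz, PowerSeries.derivative_pow, map_sub,
    PowerSeries.derivative_one, Derivation.leibniz, PowerSeries.derivative_X,
    PowerSeries.derivative_C]
  simp only [smul_eq_mul]
  have e : PowerSeries.C (4 : ℚ) = PowerSeries.C 2 + PowerSeries.C 2 := by
    rw [← map_add]; norm_num
  have e2 : PowerSeries.C (2 : ℚ) = 2 := map_ofNat _ 2
  rw [e2] at e h1
  rw [e] at h1 ⊢
  push_cast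
  linear_combination (2 * F) * h1

/-- The coefficients of `(1 - 4X)⁻¹`, as the square of the generating function of the central
binomial coefficients. -/
theorem sum_centralBinom_mul (n : ℕ) :
    ∑ p ∈ Finset.HasAntidiagonal.antidiagonal n, p.1.centralBinom * p.2.centralBinom = 4 ^ n := by
  have h : ∀ n, PowerSeries.coeff n ((PowerSeries.mk fun k => (k.centralBinom : ℚ)) ^ 2) = 4 ^ n := by
    intro n
    have h1 := one_sub_four_mul_centralBinom_sq
    induction n with
    | zero => simp
    | succ n ih =>
      have h2 := congrArg (PowerSeries.coeff (n + 1)) h1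
      rw [sub_mul, one_mul, mul_assoc, map_sub, PowerSeries.coeff_C_mul,
        PowerSeries.coeff_succ_X_mul, ih, PowerSeries.coeff_one, if_neg n.succ_ne_zero] at h2
      rw [pow_succ (4 : ℚ)]
      linear_combination h2
  have h2 := h n
  rw [pow_two, PowerSeries.coeff_mul] at h2
  simp only [PowerSeries.coeff_mk] at h2
  exact_mod_cast h2

section Banach
universe u
variable {R : Type u} [NormedRing R] [NormedAlgebra ℂ R]

/-- The power series `(1 - 4w)^{-1/2} = ∑ binom(2k, k) w^k`. -/
def invSqrtOneSub (w : R) : R := ∑' k : ℕ, (k.centralBinom : ℂ) • w ^ k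

theorem centralBinom_le (k : ℕ) : k.centralBinom ≤ 4 ^ k := by
  exact (Nat.choose_le_two_pow _ _).trans (by rw [pow_mul]; norm_num)

variable [CompleteSpace R]

theorem norm_four_smul_lt {w : R} (hw : ‖w‖ < 1 / 4) : ‖(4 : ℂ) • w‖ < 1 := by
  rw [norm_smul]; norm_num; linarith

theorem norm_centralBinom_smul_pow_le (w : R) (k : ℕ) :
    ‖(k.centralBinom : ℂ) • w ^ k‖ ≤ ‖((4 : ℂ) • w) ^ k‖ := by
  rw [smul_pow, norm_smul, norm_smul, Complex.norm_natCast]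
  refine mul_le_mul_of_nonneg_right ?_ (norm_nonneg _)
  rw [norm_pow, Complex.norm_ofNat]
  exact_mod_cast centralBinom_le k

theorem summable_norm_centralBinom_smul_pow {w : R} (hw : ‖w‖ < 1 / 4) :
    Summable fun k : ℕ => ‖(k.centralBinom : ℂ) • w ^ k‖ :=
  .of_nonneg_of_le (fun _ => norm_nonneg _) (norm_centralBinom_smul_pow_le w)
    (summable_norm_geometric_of_norm_lt_one (norm_four_smul_lt hw))

theorem invSqrtOneSub_mul_self {w : R} (hw : ‖w‖ < 1 / 4) :
    (1 - (4 : ℂ) • w) * (invSqrtOneSub w * invSqrtOneSub w) = 1 := by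
  have hs := summable_norm_centralBinom_smul_pow hw
  have h : invSqrtOneSub w * invSqrtOneSub w = ∑' n : ℕ, ((4 : ℂ) • w) ^ n := by
    rw [invSqrtOneSub, tsum_mul_tsum_eq_tsum_sum_antidiagonal_of_summable_norm hs hs]
    refine tsum_congr fun n => ?_
    have h1 : ∀ p ∈ Finset.HasAntidiagonal.antidiagonal n, ((p.1.centralBinom : ℂ) • w ^ p.1) *
        ((p.2.centralBinom : ℂ) • w ^ p.2) =
        ((p.1.centralBinom * p.2.centralBinom : ℕ) : ℂ) • w ^ n := by
      intro p hp
      rw [smul_mul_smul_comm, ← pow_add, Finset.HasAntidiagonal.mem_antidiagonal.1 hp, Nat.cast_mul]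
    rw [Finset.sum_congr rfl h1, ← Finset.sum_smul, ← Nat.cast_sum, sum_centralBinom_mul, smul_pow]
    norm_num
  rw [h]
  exact mul_neg_geom_series _ (norm_four_smul_lt hw)

theorem commute_invSqrtOneSub {w x : R} (hw : ‖w‖ < 1 / 4) (h : Commute x w) :
    Commute x (invSqrtOneSub w) := by
  have hs := (summable_norm_centralBinom_smul_pow hw).of_norm
  rw [invSqrtOneSub, Commute, SemiconjBy, ← hs.tsum_mul_left, ← hs.tsum_mul_right]
  exact tsum_congr fun k => ((h.pow_right k).smul_right _).eq

/-- The power series from order two on, with a factor `w` extracted on either side: for `w` smooth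
compact, the sum is then smooth compact whatever `b` is. -/
theorem exists_invSqrtOneSub_eq {w : R} (hw : ‖w‖ < 1 / 4) :
    ∃ b : R, invSqrtOneSub w = 1 + (2 : ℂ) • w + w * b * w := by
  have hs := (summable_norm_centralBinom_smul_pow hw).of_norm
  have hs2 : Summable fun k : ℕ => ((k + 2).centralBinom : ℂ) • w ^ k := by
    refine Summable.of_norm_bounded
      ((summable_norm_geometric_of_norm_lt_one (norm_four_smul_lt hw)).mul_left 16) fun k => ?_
    rw [smul_pow, norm_smul, norm_smul, Complex.norm_natCast, ← mul_assoc]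
    refine mul_le_mul_of_nonneg_right ?_ (norm_nonneg _)
    rw [norm_pow, Complex.norm_ofNat]
    have h : ((k + 2).centralBinom : ℝ) ≤ 4 ^ (k + 2) := by exact_mod_cast centralBinom_le _
    exact h.trans (by rw [pow_add]; norm_num [mul_comm])
  refine ⟨∑' k : ℕ, ((k + 2).centralBinom : ℂ) • w ^ k, ?_⟩
  rw [invSqrtOneSub, ← hs.sum_add_tsum_nat_add 2, Finset.sum_range_succ, Finset.sum_range_one,
    ← hs2.tsum_mul_left, ← (hs2.mul_left w).tsum_mul_right]
  congr 1
  · simp [Nat.centralBinom, Nat.choose]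
  · refine tsum_congr fun k => ?_
    rw [mul_smul_comm, smul_mul_assoc, ← pow_succ', ← pow_succ]

theorem map_invSqrtOneSub {S : Type*} [NormedRing S] [NormedAlgebra ℂ S] (φ : R →ₐ[ℂ] S)
    (hφ : Continuous φ) {w : R} (hw : ‖w‖ < 1 / 4) :
    φ (invSqrtOneSub w) = invSqrtOneSub (φ w) := by
  rw [invSqrtOneSub, Summable.map_tsum (summable_norm_centralBinom_smul_pow hw).of_norm φ hφ]
  simp [invSqrtOneSub]

theorem analyticAt_invSqrtOneSub {w : R} (hw : ‖w‖ < 1 / 4) :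
    AnalyticAt ℂ (invSqrtOneSub : R → R) w := by
  let p := FormalMultilinearSeries.ofScalars R (𝕜 := ℂ) fun k => (k.centralBinom : ℂ)
  have hr : ((1 / 4 : NNReal) : ENNReal) ≤ p.radius := by
    refine p.le_radius_of_eventually_le 1 ?_
    filter_upwards [eventually_gt_atTop 0] with n hn
    have h1 := FormalMultilinearSeries.ofScalars_norm_le R (fun k => (k.centralBinom : ℂ)) n hn
    rw [Complex.norm_natCast] at h1
    have h2 : (n.centralBinom : ℝ) ≤ 4 ^ n := by exact_mod_cast centralBinom_le n
    calc ‖p n‖ * ((1 / 4 : NNReal) : ℝ) ^ n ≤ 4 ^ n * ((1 / 4 : NNReal) : ℝ) ^ n := by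
          gcongr; exact h1.trans h2
      _ = 1 := by rw [← mul_pow]; norm_num
  have h := p.hasFPowerSeriesOnBall (lt_of_lt_of_le (by norm_num) hr)
  have e : p.sum = (invSqrtOneSub : R → R) := by
    ext1 w
    exact FormalMultilinearSeries.ofScalars_sum_eq _ _
  rw [← e]
  refine h.analyticAt_of_mem (Metric.eball_subset_eball hr ?_)
  rw [Metric.eball_coe]
  simpa using hw

end Banach

/-! ### Idempotents near nearly idempotent elements -/

section IdempotentNear
universe u
variable {R : Type u} [NormedRing R] [NormedAlgebra ℂ R]

/-- The idempotent `(1 - (1 - 2x) / √((1 - 2x)²)) / 2` near an element `x` which is nearly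
idempotent; note that `(1 - 2x)² = 1 - 4(x - x²)`. -/
def idempotentNear (x : R) : R :=
  (2 : ℂ)⁻¹ • (1 - (1 - (2 : ℂ) • x) * invSqrtOneSub (x - x * x))

theorem invSqrtOneSub_zero : invSqrtOneSub (0 : R) = 1 := by
  rw [invSqrtOneSub, tsum_eq_single 0 fun k hk => by rw [zero_pow hk, smul_zero]]
  simp

theorem idempotentNear_of_isIdempotentElem {e : R} (he : IsIdempotentElem e) :
    idempotentNear e = e := by
  rw [idempotentNear, he.eq, sub_self, invSqrtOneSub_zero, mul_one, sub_sub_cancel,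
    inv_smul_smul₀ two_ne_zero]

theorem idempotentNear_sub (x : R) :
    idempotentNear x - x = (2 : ℂ)⁻¹ • ((1 - (2 : ℂ) • x) * (1 - invSqrtOneSub (x - x * x))) := by
  rw [idempotentNear, mul_sub, mul_one]
  module

variable [CompleteSpace R]

theorem isIdempotentElem_idempotentNear {x : R} (hx : ‖x - x * x‖ < 1 / 4) :
    IsIdempotentElem (idempotentNear x) := by
  have hc : Commute (1 - (2 : ℂ) • x) (invSqrtOneSub (x - x * x)) :=
    commute_invSqrtOneSub hx ((Commute.one_left _).sub_left
      (((Commute.refl x).sub_right ((Commute.refl x).mul_right (Commute.refl x))).smul_left _))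
  have hsq : (1 - (2 : ℂ) • x) * (1 - (2 : ℂ) • x) = 1 - (4 : ℂ) • (x - x * x) := by
    simp only [sub_mul, mul_sub, one_mul, mul_one, smul_mul_smul_comm, smul_sub]
    module
  set s := (1 - (2 : ℂ) • x) * invSqrtOneSub (x - x * x) with hs
  have hss : s * s = 1 := by
    rw [hs, hc.symm.mul_mul_mul_comm, hsq, invSqrtOneSub_mul_self hx]
  rw [idempotentNear, ← hs, IsIdempotentElem, smul_mul_smul_comm]
  simp only [sub_mul, mul_sub, one_mul, mul_one, hss]
  module

theorem map_idempotentNear {S : Type*} [NormedRing S] [NormedAlgebra ℂ S] (φ : R →ₐ[ℂ] S)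
    (hφ : Continuous φ) {x : R} (hx : ‖x - x * x‖ < 1 / 4) :
    φ (idempotentNear x) = idempotentNear (φ x) := by
  simp only [idempotentNear, map_smul, map_sub, map_mul, map_one, map_invSqrtOneSub φ hφ hx]

theorem analyticAt_idempotentNear {x : R} (hx : ‖x - x * x‖ < 1 / 4) :
    AnalyticAt ℂ (idempotentNear : R → R) x := by
  have h : AnalyticAt ℂ (fun x : R => x - x * x) x :=
    analyticAt_id.sub (analyticAt_id.mul analyticAt_id)
  have h2 : AnalyticAt ℂ (fun x : R => invSqrtOneSub (x - x * x)) x :=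
    (analyticAt_invSqrtOneSub hx).comp_of_eq h rfl
  have h3 : AnalyticAt ℂ (fun x : R => (2 : ℂ) • x) x :=
    (analyticAt_id (𝕜 := ℂ) (E := R)).const_smul (c := (2 : ℂ))
  have h4 : AnalyticAt ℂ (fun x : R => 1 - (1 - (2 : ℂ) • x) * invSqrtOneSub (x - x * x)) x :=
    analyticAt_const.sub ((analyticAt_const.sub h3).mul h2)
  exact h4.const_smul (c := (2 : ℂ)⁻¹)

theorem tendsto_idempotentNear {e : R} (he : IsIdempotentElem e) :
    Tendsto idempotentNear (𝓝 e) (𝓝 e) := by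
  have h := (analyticAt_idempotentNear (x := e) (by rw [he.eq]; simp)).continuousAt
  rwa [ContinuousAt, idempotentNear_of_isIdempotentElem he] at h

/-- The correction `idempotentNear x - x` tends to `0` with `x - x²` as long as `1 - 2x` remains
bounded; `x` need not converge. -/
theorem tendsto_idempotentNear_sub {α : Type*} {l : Filter α} {x : α → R} {b : α → ℝ} {B : ℝ}
    (hx : Tendsto (fun a => x a - x a * x a) l (𝓝 0)) (hb : ∀ a, ‖1 - (2 : ℂ) • x a‖ ≤ b a)
    (hB : Tendsto b l (𝓝 B)) : Tendsto (fun a => idempotentNear (x a) - x a) l (𝓝 0) := by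
  have h1 := (analyticAt_invSqrtOneSub (w := (0 : R)) (by simp)).continuousAt.tendsto.comp hx
  rw [invSqrtOneSub_zero] at h1
  have h2 := h1.const_sub 1
  rw [sub_self] at h2
  have h3 := hB.mul h2.norm
  rw [norm_zero, mul_zero] at h3
  have h4 : Tendsto (fun a => (1 - (2 : ℂ) • x a) * (1 - invSqrtOneSub (x a - x a * x a))) l (𝓝 0) :=
    squeeze_zero_norm (fun a => (norm_mul_le _ _).trans
      (mul_le_mul_of_nonneg_right (hb a) (norm_nonneg _))) h3
  have h5 := h4.const_smul (2 : ℂ)⁻¹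
  rw [smul_zero] at h5
  exact h5.congr fun a => (idempotentNear_sub _).symm

end IdempotentNear

section Matrices
attribute [local instance] Matrix.linftyOpNormedRing Matrix.linftyOpNormedAlgebra
variable {n : ℕ}

/-- The uniform structure of the operator norm for `ℓ^∞` on matrices is the product one. -/
theorem completeSpace_matrix (A : Type*) [NormedRing A] [CompleteSpace A] :
    @CompleteSpace (Matrix (Fin n) (Fin n) A)
      (@PseudoMetricSpace.toUniformSpace _ (@SeminormedRing.toPseudoMetricSpace _
        (@NormedRing.toSeminormedRing _ Matrix.linftyOpNormedRing))) :=
  inferInstanceAs (CompleteSpace (Fin n → Fin n → A))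

theorem norm_matrix_le {A B : Type*} [NormedRing A] [NormedRing B] {X : Matrix (Fin n) (Fin n) A}
    {Y : Matrix (Fin n) (Fin n) B} (h : ∀ p q, ‖X p q‖ ≤ ‖Y p q‖) : ‖X‖ ≤ ‖Y‖ := by
  rw [Matrix.linfty_opNorm_def, Matrix.linfty_opNorm_def]
  exact NNReal.coe_le_coe.2 (Finset.sup_mono_fun fun p _ => Finset.sum_le_sum fun q _ => h p q)

/-- For a matrix `X` of smooth functions, `idempotentNear X` is smooth: its value at `t` is an
analytic function of the complex matrix `X t`. -/
theorem isSmooth_idempotentNear {X : Matrix (Fin n) (Fin n) C(UnitAddCircle, ℂ)}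
    (hX : ∀ p q, IsSmooth (X p q)) (hn : ‖X - X * X‖ < 1 / 4) (p q : Fin n) :
    IsSmooth (idempotentNear X p q) := by
  have := completeSpace_matrix (n := n) C(UnitAddCircle, ℂ)
  let ev : ℝ → Matrix (Fin n) (Fin n) C(UnitAddCircle, ℂ) →ₐ[ℂ] Matrix (Fin n) (Fin n) ℂ :=
    fun t => (ContinuousMap.evalAlgHom ℂ ℂ (t : UnitAddCircle)).mapMatrix
  have hev : ∀ t, Continuous (ev t) := fun t =>
    continuous_id.matrix_map (ContinuousEvalConst.continuous_eval_const (t : UnitAddCircle))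
  have hle : ∀ t Y, ‖ev t Y‖ ≤ ‖Y‖ := fun t Y => norm_matrix_le fun p q =>
    ContinuousMap.norm_coe_le_norm (Y p q) _
  have hnt : ∀ t, ‖ev t X - ev t X * ev t X‖ < 1 / 4 := fun t => by
    rw [← map_mul, ← map_sub]; exact (hle t _).trans_lt hn
  have hXt : ContDiff ℝ ((⊤ : ℕ∞) : WithTop ℕ∞) fun t => ev t X := by
    have e : (fun t => ev t X) = fun t : ℝ => ∑ p, ∑ q, X p q (t : UnitAddCircle) •
        Matrix.single p q (1 : ℂ) := by
      ext1 t
      refine (Matrix.matrix_eq_sum_single (ev t X)).trans ?_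
      refine Finset.sum_congr rfl fun p _ => Finset.sum_congr rfl fun q _ => ?_
      rw [Matrix.smul_single, smul_eq_mul, mul_one]
      rfl
    rw [e]
    exact ContDiff.sum fun p _ => ContDiff.sum fun q _ => ContDiff.smul (hX p q) contDiff_const
  have hF : ContDiff ℝ ((⊤ : ℕ∞) : WithTop ℕ∞) fun t => idempotentNear (ev t X) := by
    refine contDiff_iff_contDiffAt.2 fun t => ?_
    have h1 := ((analyticAt_idempotentNear (hnt t)).restrictScalars (𝕜 := ℝ)).contDiffAt
      (n := ((⊤ : ℕ∞) : WithTop ℕ∞))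
    exact ContDiffAt.comp (g := idempotentNear) (f := fun t => ev t X) t h1 hXt.contDiffAt
  let ℓ : Matrix (Fin n) (Fin n) ℂ →L[ℂ] ℂ :=
    LinearMap.toContinuousLinearMap (Matrix.entryLinearMap ℂ ℂ p q)
  have h2 := (ℓ.restrictScalars ℝ).contDiff.comp hF
  have e2 : (fun t : ℝ => idempotentNear X p q (t : UnitAddCircle)) =
      fun t => ℓ (idempotentNear (ev t X)) := by
    ext1 t
    exact congrArg (fun Y => Y p q) (map_idempotentNear (ev t) (hev t) hn)
  rw [IsSmooth, e2]
  exact h2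

end Matrices

/-! ### Idempotent matrices over the smooth Toeplitz algebra -/

section
variable {H : Type*} [NormedAddCommGroup H] [InnerProductSpace ℂ H] [CompleteSpace H]
  (E : HilbertBasis ℕ ℂ H)

theorem IsDecomp.symbol_eq {E : HilbertBasis ℕ ℂ H} {a : SmoothToeplitz E} {f : C(UnitAddCircle, ℂ)}
    {c : H →L[ℂ] H} (h : IsDecomp E (incl E a : H →L[ℂ] H) f c) : symbol a = f :=
  (toeplitz_symbol_unique (decomp a) h).1

/-- The symbol map as a homomorphism of algebras. -/
def symbolHom : SmoothToeplitz E →ₐ[ℂ] C(UnitAddCircle, ℂ) :=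
  AlgHom.ofLinearMap
    { toFun := symbol
      map_add' := fun a b => (decomp_add a b).1
      map_smul' := fun z a => (decomp_smul z a).1 }
    (IsDecomp.symbol_eq (c := 0) ⟨isSmooth_const 1, isSmoothCompact_zero E, by
      rw [map_one, toeplitzOp_one, add_zero]; rfl⟩)
    -- the product of `T(f) + c` and `T(g) + d` is `T(f g)`, plus the semicommutator
    -- `T(f) T(g) - T(f g)`, plus the products with a smooth compact factor
    fun a b => IsDecomp.symbol_eq (c := (toeplitzOp E (symbol a) * toeplitzOp E (symbol b) -
      toeplitzOp E (symbol a * symbol b)) + (toeplitzOp E (symbol a) * compactPart b +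
        (compactPart a * toeplitzOp E (symbol b) + compactPart a * compactPart b)))
      ⟨(decomp a).1.mul (decomp b).1,
        (toeplitzOp_mul_sub E (decomp a).1 (decomp b).1).add
          (((decomp b).2.1.tempered_mul ((decomp a).1.isTempered E)).add
            (((decomp a).2.1.mul_tempered ((decomp b).1.isTempered E)).add
              ((decomp b).2.1.tempered_mul (IsRD.isTempered (decomp a).2.1)))), by
        change _ = toeplitzOp E (symbol a * symbol b) + _
        rw [map_mul, MulMemClass.coe_mul, (decomp a).2.2, (decomp b).2.2]
        noncomm_ring⟩

variable {E}

theorem norm_symbolHom_le (a : SmoothToeplitz E) : ‖symbolHom E a‖ ≤ ‖incl E a‖ := by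
  change _ ≤ ‖(incl E a : H →L[ℂ] H)‖
  rw [(decomp a).2.2]
  exact norm_symbol_le (decomp a).2.1

theorem isSmoothCompact_of_symbolHom_eq_zero {a : SmoothToeplitz E} (h : symbolHom E a = 0) :
    IsSmoothCompact E (incl E a : H →L[ℂ] H) := by
  have h0 : toeplitzOp E 0 = 0 := (toeplitzCLM E).map_zero
  have h' : symbol a = 0 := h
  rw [(decomp a).2.2, h', h0, zero_add]
  exact (decomp a).2.1

variable (E) in
/-- The Toeplitz operator with a smooth symbol, as an element of the smooth Toeplitz algebra. -/
def smoothToeplitzOp (f : C(UnitAddCircle, ℂ)) (hf : IsSmooth f) : SmoothToeplitz E :=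
  (⟨⟨toeplitzOp E f, toeplitzOp_mem E f⟩, f, 0, hf, isSmoothCompact_zero E, (add_zero _).symm⟩ :
    smoothToeplitz E)

theorem symbolHom_smoothToeplitzOp {f : C(UnitAddCircle, ℂ)} (hf : IsSmooth f) :
    symbolHom E (smoothToeplitzOp E f hf) = f :=
  IsDecomp.symbol_eq (c := 0) ⟨hf, isSmoothCompact_zero E, (add_zero _).symm⟩

variable (E) in
/-- Smooth compact operators in the Toeplitz algebra, as a submodule. -/
def smoothCompactSubmodule : Submodule ℂ (toeplitzAlgebra E) where
  carrier := {a | IsSmoothCompact E (a : H →L[ℂ] H)}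
  add_mem' := fun ha hb => ha.add hb
  zero_mem' := isSmoothCompact_zero E
  smul_mem' := fun z _ ha => ha.smul z

theorem exists_incl_eq {a : toeplitzAlgebra E} (ha : a ∈ smoothCompactSubmodule E) :
    ∃ b : SmoothToeplitz E, incl E b = a :=
  ⟨(⟨a, 0, a, contDiff_const, ha, by
    have h0 : toeplitzOp E 0 = 0 := (toeplitzCLM E).map_zero
    rw [h0, zero_add]⟩ : smoothToeplitz E), rfl⟩

theorem incl_injective : Function.Injective (incl E) := Subtype.val_injective

end

section Lift
attribute [local instance] Matrix.linftyOpNormedRing Matrix.linftyOpNormedAlgebra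
variable {H : Type*} [NormedAddCommGroup H] [InnerProductSpace ℂ H] [CompleteSpace H]
  {E : HilbertBasis ℕ ℂ H} {n : ℕ}

theorem mul_mul_mem_smoothCompactSubmodule {w : Matrix (Fin n) (Fin n) (toeplitzAlgebra E)}
    (hw : ∀ p q, w p q ∈ smoothCompactSubmodule E) (b : Matrix (Fin n) (Fin n) (toeplitzAlgebra E))
    (p q : Fin n) : (w * b * w) p q ∈ smoothCompactSubmodule E := by
  rw [Matrix.mul_apply]
  refine Submodule.sum_mem _ fun r _ => ?_
  rw [Matrix.mul_apply, Finset.sum_mul]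
  exact Submodule.sum_mem _ fun s _ => (hw p s).mul_mul (hw r q) _

/-- If the symbol of a nearly idempotent matrix is idempotent, then the nearby idempotent is a
matrix over the smooth Toeplitz algebra: for `w = x - x²`, which has smooth compact entries, it is
`(1 - (1 - 2x) (1 + 2w + w b w)) / 2`. -/
theorem exists_map_incl_eq_idempotentNear {X : Matrix (Fin n) (Fin n) (SmoothToeplitz E)}
    (hX : ‖X.map (incl E) - X.map (incl E) * X.map (incl E)‖ < 1 / 4)
    (hs : IsIdempotentElem (X.map (symbolHom E))) :
    ∃ e : Matrix (Fin n) (Fin n) (SmoothToeplitz E),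
      e.map (incl E) = idempotentNear (X.map (incl E)) := by
  set x := X.map (incl E) with hx
  have hmap : (X - X * X).map (incl E) = x - x * x := by
    rw [Matrix.map_sub _ (map_sub (incl E)), Matrix.map_mul]
  have hw : ∀ p q, (x - x * x) p q ∈ smoothCompactSubmodule E := by
    intro p q
    rw [← hmap]
    refine isSmoothCompact_of_symbolHom_eq_zero ?_
    have h1 : (X - X * X).map (symbolHom E) = 0 := by
      rw [Matrix.map_sub _ (map_sub (symbolHom E)), Matrix.map_mul, hs.eq, sub_self]
    exact congrFun (congrFun h1 p) q
  have := completeSpace_matrix (n := n) (toeplitzAlgebra E)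
  obtain ⟨b, hb⟩ := exists_invSqrtOneSub_eq hX
  have h2 : ∀ p q, ∃ s : SmoothToeplitz E, incl E s =
      ((2 : ℂ) • (x - x * x) + (x - x * x) * b * (x - x * x)) p q := fun p q =>
    exists_incl_eq (Submodule.add_mem _ (Submodule.smul_mem _ _ (hw p q))
      (mul_mul_mem_smoothCompactSubmodule hw b p q))
  choose S hS using h2
  have hS' : (incl E).mapMatrix (Matrix.of S) =
      (2 : ℂ) • (x - x * x) + (x - x * x) * b * (x - x * x) := by
    ext1 p q
    exact hS p q
  refine ⟨(2 : ℂ)⁻¹ • (1 - (1 - (2 : ℂ) • X) * (1 + Matrix.of S)), ?_⟩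
  have hx' : (incl E).mapMatrix X = x := rfl
  change (incl E).mapMatrix _ = _
  rw [idempotentNear, hb, map_smul, map_sub, map_mul, map_sub, map_add, map_one, map_smul, hS', hx',
    add_assoc]

theorem denseRange_incl_matrix :
    DenseRange fun X : Matrix (Fin n) (Fin n) (SmoothToeplitz E) => X.map (incl E) :=
  denseRange_matrix_map (i := (incl E).toRingHom) (denseRange_incl E)

/-- Idempotent matrices over the smooth Toeplitz algebra are dense in those over the Toeplitz
algebra. A matrix near the idempotent is corrected in two steps: its symbol is made idempotent by a
small smooth change, and then the matrix itself. -/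
theorem exists_idempotent_mem_nhds {e : Matrix (Fin n) (Fin n) (toeplitzAlgebra E)}
    (he : IsIdempotentElem e) {U : Set (Matrix (Fin n) (Fin n) (toeplitzAlgebra E))} (hU : U ∈ 𝓝 e) :
    ∃ e' : Matrix (Fin n) (Fin n) (SmoothToeplitz E), IsIdempotentElem e' ∧ e'.map (incl E) ∈ U := by
  have cA := completeSpace_matrix (n := n) (toeplitzAlgebra E)
  have cC := completeSpace_matrix (n := n) C(UnitAddCircle, ℂ)
  let J : Matrix (Fin n) (Fin n) (SmoothToeplitz E) →ₐ[ℂ] Matrix (Fin n) (Fin n) (toeplitzAlgebra E) :=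
    (incl E).mapMatrix
  let G : Matrix (Fin n) (Fin n) (SmoothToeplitz E) →ₐ[ℂ] Matrix (Fin n) (Fin n) C(UnitAddCircle, ℂ) :=
    (symbolHom E).mapMatrix
  let D : Matrix (Fin n) (Fin n) C(UnitAddCircle, ℂ) → Matrix (Fin n) (Fin n) (toeplitzAlgebra E) :=
    fun q => q.map fun f => ⟨toeplitzOp E f, toeplitzOp_mem E f⟩
  have hGJ : ∀ X, ‖G X‖ ≤ ‖J X‖ := fun X => norm_matrix_le fun p q => norm_symbolHom_le (X p q)
  have hD : ∀ q, ‖D q‖ ≤ ‖q‖ := fun q => norm_matrix_le fun i j => norm_toeplitzOp_le E (q i j)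
  -- the limits below are over matrices `X` over the smooth algebra whose images `J X` tend to `e`
  let 𝓕 := comap J (𝓝 e)
  have hne : 𝓕.NeBot := comap_neBot fun t ht =>
    (denseRange_incl_matrix.exists_mem_open isOpen_interior ⟨e, mem_interior_iff_mem_nhds.2 ht⟩).imp
      fun X hX => interior_subset hX
  have tJ : Tendsto J 𝓕 (𝓝 e) := tendsto_comap
  have tW : Tendsto (fun X => J (X - X * X)) 𝓕 (𝓝 0) := by
    have := tJ.sub (tJ.mul tJ)
    rw [he.eq, sub_self] at this
    simpa only [map_sub, map_mul] using this
  have tG : Tendsto (fun X => G (X - X * X)) 𝓕 (𝓝 0) :=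
    squeeze_zero_norm (fun X => hGJ _) (by simpa using tW.norm)
  -- the correction of the symbol `G X` tends to `0`, although `G X` itself is not known to converge
  have th : Tendsto (fun X => idempotentNear (G X) - G X) 𝓕 (𝓝 0) := by
    simp only [map_sub, map_mul] at tG
    refine tendsto_idempotentNear_sub tG (b := fun X => ‖J (1 - (2 : ℂ) • X)‖) (fun X => ?_)
      (B := ‖1 - (2 : ℂ) • e‖) ?_
    · have := hGJ (1 - (2 : ℂ) • X)
      rwa [map_sub G, map_one G, map_smul G] at this
    · simp only [map_sub, map_one, map_smul]
      exact ((tJ.const_smul (2 : ℂ)).const_sub 1).norm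
  have tY : Tendsto (fun X => J X + D (idempotentNear (G X) - G X)) 𝓕 (𝓝 e) := by
    have h1 : Tendsto (fun X => D (idempotentNear (G X) - G X)) 𝓕 (𝓝 0) :=
      squeeze_zero_norm (fun X => hD _) (by simpa using th.norm)
    simpa using tJ.add h1
  have tYY := tY.sub (tY.mul tY)
  rw [he.eq, sub_self] at tYY
  obtain ⟨X, hX1, hX2, hX3⟩ := ((tG.norm.eventually_lt_const (u := 1 / 4) (by simp)).and
    ((tYY.norm.eventually_lt_const (u := 1 / 4) (by simp)).and
      (((tendsto_idempotentNear he).comp tY).eventually_mem hU))).exists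
  rw [map_sub, map_mul] at hX1
  have hsm : ∀ p q, IsSmooth ((idempotentNear (G X) - G X) p q) := by
    intro p q
    have h1 := isSmooth_idempotentNear (X := G X) (fun p q => (decomp (X p q)).1) hX1 p q
    exact ContDiff.sub h1 (decomp (X p q)).1
  -- `X` with its symbol replaced by the idempotent one
  let X' := X + Matrix.of fun p q => smoothToeplitzOp E _ (hsm p q)
  have hJ : X'.map (incl E) = J X + D (idempotentNear (G X) - G X) := by
    ext1 p q
    exact map_add (incl E) _ _
  have hG : X'.map (symbolHom E) = idempotentNear (G X) := by
    ext1 p q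
    refine (map_add (symbolHom E) _ _).trans ?_
    rw [Matrix.of_apply, symbolHom_smoothToeplitzOp]
    exact add_sub_cancel _ _
  rw [← hJ] at hX2
  have hX3' : idempotentNear (J X + D (idempotentNear (G X) - G X)) ∈ U := hX3
  rw [← hJ] at hX3'
  obtain ⟨e', he'⟩ := exists_map_incl_eq_idempotentNear hX2
    (hG ▸ isIdempotentElem_idempotentNear hX1)
  refine ⟨e', ?_, he' ▸ hX3'⟩
  have h5 := isIdempotentElem_idempotentNear hX2
  rw [← he', IsIdempotentElem, ← Matrix.map_mul] at h5
  exact Matrix.map_injective incl_injective h5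

end Lift

/-! ### The Fréchet topology and the norm topology -/

section
variable {H : Type*} [NormedAddCommGroup H] [InnerProductSpace ℂ H] [CompleteSpace H]
  {E : HilbertBasis ℕ ℂ H}

/-- The seminorm of index `(2, 2)` on smooth compact operators bounds the operator norm. -/
theorem norm_le_of_coeff_le {c : H →L[ℂ] H} {D : ℝ}
    (hc : ∀ k l : ℕ, (1 + k : ℝ) ^ 2 * (1 + l : ℝ) ^ 2 * ‖coeff E c k l‖ ≤ D) :
    ‖c‖ ≤ (∑' j : ℕ, ((1 + j : ℝ) ^ 2)⁻¹) ^ 2 * D := by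
  set S := ∑' j : ℕ, ((1 + j : ℝ) ^ 2)⁻¹ with hS
  have hS0 : 0 ≤ S := tsum_nonneg fun _ => by positivity
  have hD0 : 0 ≤ D := le_trans (by positivity) (hc 0 0)
  have hle : ∀ k l : ℕ, ‖coeff E c k l‖ ≤ D * ((1 + k : ℝ) ^ 2)⁻¹ * ((1 + l : ℝ) ^ 2)⁻¹ := by
    intro k l
    have h1 : (0 : ℝ) < (1 + k : ℝ) ^ 2 := by positivity
    have h2 : (0 : ℝ) < (1 + l : ℝ) ^ 2 := by positivity
    rw [← div_eq_mul_inv, ← div_eq_mul_inv, le_div_iff₀ h2, le_div_iff₀ h1]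
    exact le_trans (le_of_eq (by ring)) (hc k l)
  refine ContinuousLinearMap.opNorm_le_bound _ (by positivity) fun x => ?_
  have hk : ∀ k : ℕ, ‖inner ℂ (E k) (c x)‖ ≤ D * S * ‖x‖ * ((1 + k : ℝ) ^ 2)⁻¹ := by
    intro k
    have h1 := E.hasSum_inner_mul_inner (c.adjoint (E k)) x
    rw [ContinuousLinearMap.adjoint_inner_left] at h1
    rw [← h1.tsum_eq]
    have h2 : HasSum (fun l : ℕ => D * ‖x‖ * ((1 + k : ℝ) ^ 2)⁻¹ * ((1 + l : ℝ) ^ 2)⁻¹)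
        (D * ‖x‖ * ((1 + k : ℝ) ^ 2)⁻¹ * S) := summable_inv_sq.hasSum.mul_left _
    refine (tsum_of_norm_bounded h2 fun l => ?_).trans (le_of_eq (by ring))
    rw [norm_mul, ContinuousLinearMap.adjoint_inner_left]
    have h3 : ‖inner ℂ (E l) x‖ ≤ ‖x‖ := by
      simpa [E.orthonormal.1 l] using norm_inner_le_norm (𝕜 := ℂ) (E l) x
    calc ‖coeff E c k l‖ * ‖inner ℂ (E l) x‖
        ≤ (D * ((1 + k : ℝ) ^ 2)⁻¹ * ((1 + l : ℝ) ^ 2)⁻¹) * ‖x‖ :=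
          mul_le_mul (hle k l) h3 (norm_nonneg _) (by positivity)
      _ = _ := by ring
  refine (norm_le_tsum_norm_inner E (summable_inv_sq.mul_left _) hk).trans (le_of_eq ?_)
  rw [tsum_mul_left, ← hS]
  ring

/-- The restriction to a period of the symbol, a continuous function of `a` in the Fréchet
topology. -/
def symbolRestrict (a : SmoothToeplitz E) : C(Set.Icc (0 : ℝ) 1, ℂ) :=
  (symbolDeriv E 0 a).restrict (Set.Icc 0 1)

theorem continuous_symbolRestrict : Continuous (symbolRestrict (E := E)) :=
  (ContinuousMap.continuous_restrict _).comp
    (continuous_iff_le_induced.2 (inf_le_left.trans (iInf_le _ 0)))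

theorem continuous_weighted (M N : ℕ) : Continuous (weighted E M N) :=
  continuous_iff_le_induced.2 (inf_le_right.trans (iInf_le _ (M, N)))

theorem norm_symbol_le_symbolRestrict (a : SmoothToeplitz E) : ‖symbol a‖ ≤ ‖symbolRestrict a‖ := by
  refine (ContinuousMap.norm_le _ (norm_nonneg _)).2 fun x => ?_
  obtain ⟨t, ht, rfl⟩ : ∃ t ∈ Set.Icc (0 : ℝ) 1, (t : UnitAddCircle) = x := by
    have := AddCircle.coe_image_Icc_eq (1 : ℝ) 0
    rw [zero_add] at this
    have hx : x ∈ ((↑) : ℝ → UnitAddCircle) '' Set.Icc 0 1 := this ▸ Set.mem_univ x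
    exact hx
  have := (symbolRestrict a).norm_coe_le_norm ⟨t, ht⟩
  simpa [symbolRestrict, symbolDeriv] using this

theorem norm_incl_le (a : SmoothToeplitz E) : ‖incl E a‖ ≤
    ‖symbolRestrict a‖ + (∑' j : ℕ, ((1 + j : ℝ) ^ 2)⁻¹) ^ 2 * ‖weighted E 2 2 a‖ := by
  change ‖(incl E a : H →L[ℂ] H)‖ ≤ _
  rw [(decomp a).2.2]
  refine (norm_add_le _ _).trans (add_le_add
    ((norm_toeplitzOp_le E _).trans (norm_symbol_le_symbolRestrict a))
    (norm_le_of_coeff_le (E := E) fun k l => ?_))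
  have h := (weighted E 2 2 a).norm_coe_le_norm (k, l)
  have e : ∀ k : ℕ, ‖(1 + k : ℂ)‖ = 1 + k := fun k => by
    rw [← Nat.cast_one, ← Nat.cast_add, Complex.norm_natCast]; push_cast; rfl
  refine le_trans (le_of_eq ?_) h
  change _ = ‖(1 + k : ℂ) ^ 2 * (1 + l : ℂ) ^ 2 * coeff E (compactPart a) k l‖
  simp only [norm_mul, norm_pow, e]

/-- The Fréchet topology is finer than the norm topology. -/
theorem continuous_incl : Continuous (incl E) := by
  refine continuous_iff_continuousAt.2 fun a₀ => tendsto_iff_norm_sub_tendsto_zero.2 ?_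
  have h1 := tendsto_iff_norm_sub_tendsto_zero.1 (continuous_symbolRestrict.tendsto a₀)
  have h2 := tendsto_iff_norm_sub_tendsto_zero.1 ((continuous_weighted (E := E) 2 2).tendsto a₀)
  have h3 := h1.add (h2.const_mul ((∑' j : ℕ, ((1 + j : ℝ) ^ 2)⁻¹) ^ 2))
  rw [mul_zero, add_zero] at h3
  refine squeeze_zero (fun _ => norm_nonneg _) (fun a => ?_) h3
  rw [← map_sub, ← map_sub]
  have h4 : symbolRestrict a - symbolRestrict a₀ = symbolRestrict (a - a₀) := by
    ext t
    exact (congrArg (fun f : C(ℝ, ℂ) => f t) (map_sub (symbolDeriv E 0) a a₀)).symm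
  rw [h4]
  exact norm_incl_le _

/-- Inverse-closedness, stated for the smooth Toeplitz algebra as an algebra of its own. -/
theorem isUnit_of_isUnit_incl (b : SmoothToeplitz E) (hb : IsUnit (incl E b)) : IsUnit b := by
  have h1 := inverse_mem_smoothToeplitz (a := incl E b) b.2 hb
  let c : SmoothToeplitz E := (⟨Ring.inverse (incl E b), h1⟩ : smoothToeplitz E)
  exact isUnit_iff_exists.2 ⟨c, incl_injective (by
    rw [map_mul, map_one]; exact Ring.mul_inverse_cancel _ hb), incl_injective (by
    rw [map_mul, map_one]; exact Ring.inverse_mul_cancel _ hb)⟩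

end

end QDisk
end

theorem mainTheorem5 {H : Type*} [NormedAddCommGroup H] [InnerProductSpace ℂ H] [CompleteSpace H]
    (E : HilbertBasis ℕ ℂ H) :
    -- stability under the holomorphic functional calculus
    (∀ a ∈ smoothToeplitz E, ∀ (Ω : Set ℂ) (f : ℂ → ℂ), IsOpen Ω → spectrum ℂ a ⊆ Ω →
      DifferentiableOn ℂ f Ω →
        (∃ b, IsHolomorphicCalculus a Ω f b) ∧
        ∀ b, IsHolomorphicCalculus a Ω f b → b ∈ smoothToeplitz E) ∧
    -- inverse-closedness in the Toeplitz algebra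
    (∀ a ∈ smoothToeplitz E, IsUnit a → Ring.inverse a ∈ smoothToeplitz E) ∧
    -- the inverse of `T(f) + c` is `T(1/f) + b`
    (∀ (f : C(UnitAddCircle, ℂ)) (c : H →L[ℂ] H), IsSmooth f → IsSmoothCompact E c →
      IsUnit (toeplitzOp E f + c) →
        ∃ (g : C(UnitAddCircle, ℂ)) (b : H →L[ℂ] H),
          (∀ x, f x ≠ 0 ∧ g x = 1 / f x) ∧ IsSmooth g ∧ IsSmoothCompact E b ∧
          Ring.inverse (toeplitzOp E f + c) = toeplitzOp E g + b) ∧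
    -- the inclusion induces isomorphisms in K-theory
    (∃ φ : KZero (SmoothToeplitz E) ≃+ KZero (toeplitzAlgebra E),
      ∀ (n : ℕ) (e : Matrix (Fin n) (Fin n) (SmoothToeplitz E)) (he : IsIdempotentElem e),
        φ (KZero.mk e he) =
          KZero.mk ((incl E).toRingHom.mapMatrix e) (he.map (incl E).toRingHom.mapMatrix)) ∧
    (∃ ψ : KOne (SmoothToeplitz E) ≃+ KOne (toeplitzAlgebra E),
      ∀ (n : ℕ) (u : Matrix (Fin n) (Fin n) (SmoothToeplitz E)) (hu : IsUnit u),
        ψ (KOne.mk u hu) =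
          KOne.mk ((incl E).toRingHom.mapMatrix u) (hu.map (incl E).toRingHom.mapMatrix)) := by
  refine ⟨fun a ha Ω f hΩ hsp hf => ⟨exists_isHolomorphicCalculus a f hΩ hsp, fun b hb =>
    mem_smoothToeplitz_of_isHolomorphicCalculus ha hf hb⟩,
    fun a ha hu => inverse_mem_smoothToeplitz ha hu,
    fun f c hf hc hu => exists_inverse_decomp hf hc hu, ?_, ?_⟩
  · exact exists_kZero_equiv (incl E).toRingHom (bijective_idemClass_map (denseRange_incl E)
      isUnit_of_isUnit_incl fun n e he U hU => exists_idempotent_mem_nhds he hU)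
  · exact exists_kOne_equiv (denseRange_incl E) isUnit_of_isUnit_incl continuous_incl
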